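/- Let $\mu>2$, $m_\infty\in\mathbb{R}$, and let $V\in S^{-\mu}(\mathbb{R})$, i.e. $V$ is real, smooth, and $|\partial_x^jV(x)|\le C_j\langle x\rangle^{-\mu-j}$ for all $j\in\mathbb{N}$, where $\langle x\rangle=(1+x^2)^{1/2}$. Let $h=D^2+V+m_\infty^2$ on $L^2(\mathbb{R})$, $D=-i\,d/dx$. For real $k\neq0$ let $\theta_\pm(\cdot,k)$ be the Jost solutions, i.e. the solutions of $-u''+Vu=k^2u$ on $\mathbb{R}$ with $\theta_\pm(x,k)=e^{\pm ikx}(1+o(1))$ and $\theta_\pm'(x,k)=\pm ik\,e^{\pm ikx}(1+o(1))$ as $x\to\pm\infty$. Let $w(k)=\theta_+'\theta_--\theta_+\theta_-'$ be their Wronskian (evaluated at $k$), $m(k)=(2ik)^{-1}w(k)$, and $$\psi(x,k)=m(k)^{-1}\theta_+(x,k)\ (k>0),\qquad \psi(x,k)=m(-k)^{-1}\theta_-(x,-k)\ (k<0).$$ A zero energy resonance of $h$ is a solution $u$ of $-u''+Vu=0$ with $u(x)\to u_\pm$, $u'(x)\to0$ as $x\to\pm\infty$, where $u_+\ne0$ and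 $u_-\neq0$. A family $\{\phi(\cdot,k)\}_{k\in\mathbb{R}\setminus\{0\}}$ of (functions defining) tempered distributions is called a family of generalized eigenfunctions of $h$ if $h\phi(\cdot,k)=(k^2+m_\infty^2)\phi(\cdot,k)$ in the sense of distributions and if there are $\psi_l\in L^2(\mathbb{R})$, $l\in I$, with $I=\mathbb{N}$ or $I$ a finite subset of $\mathbb{N}$, such that $h\psi_l=\epsilon_l\psi_l$, $\epsilon_l\le m_\infty^2$, and $$\sum_{l\in I}|\psi_l)(\psi_l|+\frac1{2\pi}\int_{\mathbb{R}}|\phi(\cdot,k))(\phi(\cdot,k)|\,dk=1$$ (as a sesquilinear form on the Schwartz space). For a weight $M:\mathbb{R}\to[1,+\infty[$ such a family satisfies - (BM2) if there is $C$ with $\|M^{-1}\phi(\cdot,k)\|_\infty\le C$ for all $k\neq0$; - (BM2') if there are $\alpha\in[0,\tfrac12)$ and $C$ with $\|M^{-1}\phi(\cdot,k)\|_\infty\le C\sup(1,|k|^{-\alpha})$ for all $k\ne0$. Then, for every $k\neq0$, $\theta_\pm(\cdot,k)$ exist and are unique and $w(k)\neq0$, and: 1. If $h$ has no zero energy resonance,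 then $\{\psi(\cdot,k)\}$ is a family of generalized eigenfunctions of $h$ satisfying (BM2) with $M\equiv1$. 2. If $h$ has a zero energy resonance and, for some $C>0$ and $\epsilon>0$, $|w(k)|\ge C|k|^{3/2-\epsilon}$ for all sufficiently small $k\neq0$, then $\{\psi(\cdot,k)\}$ is a family of generalized eigenfunctions of $h$ satisfying (BM2') with $M\equiv1$. -/

import Mathlib

open Filter Topology MeasureTheory
open scoped ContDiff

noncomputable section

/-- The symbol class `S^ν` on the line: real smooth functions `a` with
`|a^{(j)}(x)| ≤ C_j ⟨x⟩^{ν - j}` for all `j`, where `⟨x⟩ = (1 + x²)^{1/2}`. -/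
def IsSymbol (ν : ℝ) (a : ℝ → ℝ) : Prop :=
  ContDiff ℝ ∞ a ∧
    ∀ j : ℕ, ∃ C : ℝ, ∀ x : ℝ, |iteratedDeriv j a x| ≤ C * Real.sqrt (1 + x ^ 2) ^ (ν - j)

/-- `u` is a (classical) solution of `-u'' + V u = ζ² u`. -/
def SolvesSchrodinger (V : ℝ → ℝ) (ζ : ℂ) (u : ℝ → ℂ) : Prop :=
  ContDiff ℝ 2 u ∧ ∀ x : ℝ, -deriv (deriv u) x + (V x : ℂ) * u x = ζ ^ 2 * u x

/-- Solution with `θ = e^{iζx}(1 + o(1))`, `θ' = iζ e^{iζx}(1 + o(1))` as `x → +∞`. -/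
def IsJostPlus (V : ℝ → ℝ) (ζ : ℂ) (θ : ℝ → ℂ) : Prop :=
  SolvesSchrodinger V ζ θ ∧
    Tendsto (fun x : ℝ => θ x / Complex.exp (Complex.I * ζ * x)) atTop (𝓝 1) ∧
    Tendsto (fun x : ℝ => deriv θ x / (Complex.I * ζ * Complex.exp (Complex.I * ζ * x)))
      atTop (𝓝 1)

/-- Solution with `θ = e^{-iζx}(1 + o(1))`, `θ' = -iζ e^{-iζx}(1 + o(1))` as `x → -∞`. -/
def IsJostMinus (V : ℝ → ℝ) (ζ : ℂ) (θ : ℝ → ℂ) : Prop :=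
  SolvesSchrodinger V ζ θ ∧
    Tendsto (fun x : ℝ => θ x / Complex.exp (-(Complex.I * ζ * x))) atBot (𝓝 1) ∧
    Tendsto (fun x : ℝ => deriv θ x / (-(Complex.I * ζ) * Complex.exp (-(Complex.I * ζ * x))))
      atBot (𝓝 1)

open Classical in
/-- The Jost solution `θ₊(·, ζ)` (`0` where there is none). -/
def jostPlus (V : ℝ → ℝ) (ζ : ℂ) : ℝ → ℂ :=
  if h : ∃ θ, IsJostPlus V ζ θ then h.choose else 0

open Classical in
/-- The Jost solution `θ₋(·, ζ)` (`0` where there is none). -/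
def jostMinus (V : ℝ → ℝ) (ζ : ℂ) : ℝ → ℂ :=
  if h : ∃ θ, IsJostMinus V ζ θ then h.choose else 0

/-- The Wronskian `W(f, g) = f' g - f g'` at the point `x`. -/
def wronskianAt (f g : ℝ → ℂ) (x : ℝ) : ℂ := deriv f x * g x - f x * deriv g x

/-- `w(k) = W(θ₊(·, k), θ₋(·, k))`; the Wronskian of two solutions does not depend on the
point, so it is evaluated at `0`. -/
def jostW (V : ℝ → ℝ) (k : ℝ) : ℂ := wronskianAt (jostPlus V k) (jostMinus V k) 0

/-- `m(k) = w(k) / (2ik)`. -/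
def jostM (V : ℝ → ℝ) (k : ℝ) : ℂ := (2 * Complex.I * k)⁻¹ * jostW V k

/-- The generalized eigenfunctions `ψ(x, k)`, written `jostPsi V k x`: equal to
`m(k)⁻¹ θ₊(x, k)` for `k > 0` and to `m(-k)⁻¹ θ₋(x, -k)` for `k < 0`.
The value at the single point `k = 0` is irrelevant. -/
def jostPsi (V : ℝ → ℝ) (k : ℝ) (x : ℝ) : ℂ :=
  if 0 < k then (jostM V k)⁻¹ * jostPlus V k x
  else if k < 0 then (jostM V (-k))⁻¹ * jostMinus V ((-k : ℝ) : ℂ) x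
  else 0

/-- A zero energy resonance: a solution of `-u'' + V u = 0` with `u → u_±`, `u' → 0` at `±∞`,
where both `u_±` are nonzero. -/
def HasZeroEnergyResonance (V : ℝ → ℝ) : Prop :=
  ∃ (u : ℝ → ℂ) (uplus uminus : ℂ), SolvesSchrodinger V 0 u ∧ uplus ≠ 0 ∧ uminus ≠ 0 ∧
    Tendsto u atTop (𝓝 uplus) ∧ Tendsto (deriv u) atTop (𝓝 0) ∧
    Tendsto u atBot (𝓝 uminus) ∧ Tendsto (deriv u) atBot (𝓝 0)

/-- `h u = E u` in the sense of tempered distributions, for `h = D² + V + m²`, `D = -i d/dx`. -/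
def IsDistribEigen (V : ℝ → ℝ) (m : ℝ) (E : ℝ) (u : ℝ → ℂ) : Prop :=
  ∀ φ : SchwartzMap ℝ ℂ,
    ∫ x : ℝ, u x * (-deriv (deriv (fun y => φ y)) x + ((V x : ℂ) + (m : ℂ) ^ 2) * φ x)
      = (E : ℂ) * ∫ x : ℝ, u x * φ x

/-- The function `u` defines a tempered distribution: it is integrable against some
inverse power of `1 + x²`. -/
def IsTemperedFun (u : ℝ → ℂ) : Prop :=
  ∃ N : ℕ, Integrable (fun x : ℝ => u x / (1 + (x : ℂ) ^ 2) ^ N)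

/-- The sesquilinear pairing `(u|f) = ∫ conj(u) f`. -/
def pairing (u f : ℝ → ℂ) : ℂ := ∫ x : ℝ, starRingEnd ℂ (u x) * f x

/-- The families `ψ_l` (`l ∈ I`) and `ψ(·, k)` (`k ∈ ℝ \ {0}`) form a basis of (generalized)
eigenfunctions of `h = D² + V + m²`; here `I` is `ℕ` or a finite subset of `ℕ`.  The last clause
is the resolution of the identity
`∑_l |ψ_l)(ψ_l| + (2π)⁻¹ ∫ |ψ(·,k))(ψ(·,k)| dk = 1`, tested on Schwartz functions. -/
structure IsEigenfunctionBasis (V : ℝ → ℝ) (m : ℝ) (I : Set ℕ) (ε : I → ℝ)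
    (ψd : I → ℝ → ℂ) (ψ : ℝ → ℝ → ℂ) : Prop where
  index : I = Set.univ ∨ I.Finite
  memLp : ∀ l, MemLp (ψd l) 2 volume
  eigen : ∀ l, IsDistribEigen V m (ε l) (ψd l)
  energy_le : ∀ l, ε l ≤ m ^ 2
  tempered : ∀ k : ℝ, k ≠ 0 → IsTemperedFun (ψ k)
  gen_eigen : ∀ k : ℝ, k ≠ 0 → IsDistribEigen V m (k ^ 2 + m ^ 2) (ψ k)
  complete : ∀ f g : SchwartzMap ℝ ℂ,
    Integrable (fun k : ℝ => pairing f (ψ k) * pairing (ψ k) g) ∧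
    HasSum (fun l : I => pairing f (ψd l) * pairing (ψd l) g)
      (pairing f g - (2 * Real.pi : ℂ)⁻¹ * ∫ k : ℝ, pairing f (ψ k) * pairing (ψ k) g)

/-- The family `ψ(·, k)`, `k ≠ 0`, belongs to a basis of (generalized) eigenfunctions. -/
def IsGenEigenfunctionFamily (V : ℝ → ℝ) (m : ℝ) (ψ : ℝ → ℝ → ℂ) : Prop :=
  ∃ (I : Set ℕ) (ε : I → ℝ) (ψd : I → ℝ → ℂ), IsEigenfunctionBasis V m I ε ψd ψ

/-- (BM2): `ψ` is a family of generalized eigenfunctions of `D² + V + m²` (part of a basis) and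
`‖M⁻¹ ψ(·, k)‖_∞ ≤ C` for all `k`. -/
def SatisfiesBM2 (V : ℝ → ℝ) (m : ℝ) (M : ℝ → ℝ) (ψ : ℝ → ℝ → ℂ) : Prop :=
  IsGenEigenfunctionFamily V m ψ ∧
    ∃ C : ℝ, ∀ k : ℝ, k ≠ 0 →
      eLpNorm (fun x => ((M x)⁻¹ : ℂ) * ψ k x) ⊤ volume ≤ ENNReal.ofReal C

/-- (BM2'): the same with `‖M⁻¹ ψ(·, k)‖_∞ ≤ C sup(1, |k|^{-α})` for some `0 ≤ α < 1/2`. -/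
def SatisfiesBM2' (V : ℝ → ℝ) (m : ℝ) (M : ℝ → ℝ) (ψ : ℝ → ℝ → ℂ) : Prop :=
  IsGenEigenfunctionFamily V m ψ ∧
    ∃ α : ℝ, 0 ≤ α ∧ α < 1 / 2 ∧ ∃ C : ℝ, ∀ k : ℝ, k ≠ 0 →
      eLpNorm (fun x => ((M x)⁻¹ : ℂ) * ψ k x) ⊤ volume
        ≤ ENNReal.ofReal (C * max 1 (|k| ^ (-α)))

end

/-! The two ingredients are a bound on `ψ(x,k)` uniform in `x` and `k`, and the eigenfunction
expansion.

Bound. Write `θ₊ = e^{ikx} a`. The amplitude solves the Volterra equation `a(x) = 1 + ∫_x^∞ K(y-x)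
V(y) a(y) dy` with `K(t) = (e^{2ikt} - 1)/(2ik)`. Since `|K(t)| ≤ t` and `y V(y)` is integrable, a
Gronwall argument bounds `θ₊` on `x ≥ 0` uniformly in `k` (`exists_jostSol_bound`); reflection does
the same for `θ₋` on `x ≤ 0`. A quadratic relation between Wronskians gives `|w|² = 4k² + |R|²` with
`R = W(θ₊, conj θ₋)` (`normSq_jw`). Hence `w ≠ 0`, `|2ik/w| ≤ 1` and `|R| ≤ |w|`. On the other half
line the connection formula `2ik θ₊ = w conj θ₋ - R θ₋` gives `|ψ| ≤ 2|θ₋|`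
(`exists_scattering_bound`). A small `w` is compensated by the factor `2ik`, so the bound persists
down to `k = 0`, and (BM2') holds with `α = 0`.

Expansion. Let `h` denote `D² + V`; the constant `m²` only shifts energies. For `c` large,
coercivity and the explicit Green function give a bounded self-adjoint inverse `A` of `h + c` on
`L²` (`exists_hamiltonian_inverse`). The spectral measure of `A` at `f`, transported by `t ↦ t⁻¹ -
c`, is a measure `ν` of mass `‖f‖²` whose Stieltjes transform is `(f, (h - z)⁻¹ f)`
(`exists_energyMeasure`). For decaying `f` and `z = ζ²` this form is a double integral of the Green
function, continuous up to the boundary of the upper half plane wherever `ζ ≠ 0` and `w(ζ) ≠ 0`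
(`continuousOn_greenForm`).

Stieltjes inversion then reads off `ν`. On `(0, ∞)` the jump of the Green function is `2ik/|w|²
(θ₊(x) conj θ₊(y) + θ₋(x) conj θ₋(y))`, so `ν (0, ∞) = (2π)⁻¹ ∫ |(ψ(·,k)|f)|² dk`
(`integral_density`). At `E < 0` with `w(i√(-E)) ≠ 0` the boundary values are real and `ν` vanishes
near `E`, while a zero of `w` produces an eigenfunction. So `ν` on `(-∞, 0]` is carried by the
eigenvalues, where its atoms are squared norms of spectral projections (`exists_eigenbasis`). Adding
the two masses is Parseval's identity (`exists_parseval`), and polarization turns it into the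
resolution of the identity. -/

open Filter Topology MeasureTheory
open scoped ContDiff ComplexConjugate

noncomputable section

/-! ### Scalar spectral measures of bounded self-adjoint operators -/

section SpectralMeasure

variable {H : Type*} [NormedAddCommGroup H] [InnerProductSpace ℂ H] [CompleteSpace H]

/-- The scalar spectral measure of a bounded self-adjoint operator at a vector. -/
theorem exists_spectralMeasure (A : H →L[ℂ] H) (hA : IsSelfAdjoint A) (f : H) :
    ∃ μ : Measure ℝ, IsFiniteMeasure μ ∧ ∀ φ : ℝ → ℝ, Continuous φ →
      Integrable φ μ ∧ inner ℂ f (cfc φ A f) = ((∫ t, φ t ∂μ : ℝ) : ℂ) := by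
  let L : CompactlySupportedContinuousMap (spectrum ℝ A) ℝ →ₗ[ℝ] ℝ :=
    { toFun := fun φ => (inner ℂ f (cfcHom hA φ.toContinuousMap f)).re
      map_add' := by
        intro φ ψ
        have : (φ + ψ).toContinuousMap = φ.toContinuousMap + ψ.toContinuousMap := rfl
        rw [this, map_add]
        simp
      map_smul' := by
        intro r φ
        have : (r • φ).toContinuousMap = r • φ.toContinuousMap := rfl
        rw [this, map_smul]
        simp }
  have hpos : ∀ φ : CompactlySupportedContinuousMap (spectrum ℝ A) ℝ, 0 ≤ φ → 0 ≤ L φ := by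
    intro φ hφ
    have h1 : 0 ≤ cfcHom hA φ.toContinuousMap := (cfcHom_nonneg_iff hA).2 hφ
    have h2 := ((ContinuousLinearMap.nonneg_iff_isPositive _).1 h1).re_inner_nonneg_right f
    exact h2
  let Λ := PositiveLinearMap.mk₀ L hpos
  refine ⟨(RealRMK.rieszMeasure Λ).map Subtype.val, inferInstance, fun φ hφ => ?_⟩
  have hmeas : Measurable (Subtype.val : spectrum ℝ A → ℝ) := measurable_subtype_coe
  let φ' : CompactlySupportedContinuousMap (spectrum ℝ A) ℝ :=
    CompactlySupportedContinuousMap.continuousMapEquiv ⟨fun t => φ t, by fun_prop⟩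
  refine ⟨?_, ?_⟩
  · rw [integrable_map_measure hφ.aestronglyMeasurable hmeas.aemeasurable]
    exact (ContinuousMap.mk (fun t : spectrum ℝ A => φ t) (by fun_prop)).continuous.integrable_of_hasCompactSupport
      (HasCompactSupport.of_compactSpace _)
  · rw [integral_map hmeas.aemeasurable hφ.aestronglyMeasurable]
    have h1 := RealRMK.integral_rieszMeasure Λ φ'
    have h2 : cfc φ A = cfcHom hA φ'.toContinuousMap := cfc_apply φ A hA hφ.continuousOn
    have h3 : (∫ x : spectrum ℝ A, φ x ∂(RealRMK.rieszMeasure Λ))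
        = (inner ℂ f (cfc φ A f)).re := by
      rw [h2]; exact h1
    -- The functional only records the real part; nothing is lost, because `cfc φ A` is self-adjoint
    -- and the inner product is real.
    rw [h3]
    have h4 : IsSelfAdjoint (cfc φ A) := cfc_predicate φ A
    have h5 := h4.isSymmetric f f
    apply Complex.ext
    · simp
    · simp only [Complex.ofReal_im]
      have h6 : (starRingEnd ℂ) (inner ℂ f (cfc φ A f)) = inner ℂ f (cfc φ A f) := by
        rw [inner_conj_symm]; exact h5
      exact Complex.conj_eq_iff_im.1 h6

theorem norm_sq_cfc_apply {A : H →L[ℂ] H} {f : H} {μ : Measure ℝ}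
    (hμ : ∀ φ : ℝ → ℝ, Continuous φ →
      Integrable φ μ ∧ inner ℂ f (cfc φ A f) = ((∫ t, φ t ∂μ : ℝ) : ℂ))
    {φ : ℝ → ℝ} (hφ : Continuous φ) : ‖cfc φ A f‖ ^ 2 = ∫ t, φ t ^ 2 ∂μ := by
  have h1 := (hμ (fun t => φ t * φ t) (hφ.mul hφ)).2
  rw [cfc_mul φ φ A hφ.continuousOn hφ.continuousOn] at h1
  have h4 : IsSelfAdjoint (cfc φ A) := cfc_predicate φ A
  have h5 : inner ℂ f ((cfc φ A * cfc φ A) f) = inner ℂ (cfc φ A f) (cfc φ A f) :=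
    (h4.isSymmetric f (cfc φ A f)).symm
  rw [h5, inner_self_eq_norm_sq_to_K] at h1
  apply Complex.ofReal_injective
  rw [Complex.ofReal_pow]
  simp only [sq] at h1 ⊢
  exact h1

/-- The spectral measure of an eigenvector sits at its eigenvalue: `∫ (t - p)² dμ = ‖(A - p) e‖² =
0`, hence `φ = φ(p)` almost everywhere. -/
theorem cfc_apply_eigenvector {A : H →L[ℂ] H} (hA : IsSelfAdjoint A) {e : H} {p : ℝ}
    (he : A e = (p : ℂ) • e) {φ : ℝ → ℝ} (hφ : Continuous φ) :
    cfc φ A e = (φ p : ℂ) • e := by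
  obtain ⟨μ, hfin, hμ⟩ := exists_spectralMeasure A hA e
  have key : ∀ ψ : ℝ → ℝ, Continuous ψ → ∀ q : ℝ,
      cfc (fun t => ψ t - q) A e = cfc ψ A e - (q : ℂ) • e := by
    intro ψ hψ q
    rw [cfc_sub ψ (fun _ => q) A hψ.continuousOn continuousOn_const, cfc_const q A]
    simp [Algebra.algebraMap_eq_smul_one]
  have h1 : ∫ t, (t - p) ^ 2 ∂μ = 0 := by
    rw [← norm_sq_cfc_apply hμ (φ := fun t => t - p) (by fun_prop),
      key (fun t => t) continuous_id p, cfc_id' ℝ A, he]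
    simp
  have h2 : ∀ᵐ t ∂μ, (t - p) ^ 2 = 0 := by
    have := (integral_eq_zero_iff_of_nonneg (fun t => sq_nonneg (t - p))
      (hμ (fun t => (t - p) ^ 2) (by fun_prop)).1).1 h1
    filter_upwards [this] with t ht using ht
  have h3 : ‖cfc (fun t => φ t - φ p) A e‖ ^ 2 = 0 := by
    rw [norm_sq_cfc_apply hμ (φ := fun t => φ t - φ p) (by fun_prop)]
    rw [integral_congr_ae (g := fun _ => (0 : ℝ)), integral_zero]
    filter_upwards [h2] with t ht
    have : t = p := by
      have := pow_eq_zero_iff (two_ne_zero) |>.1 ht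
      linarith
    simp [this]
  rw [key φ hφ] at h3
  have := pow_eq_zero_iff (two_ne_zero) |>.1 h3
  exact sub_eq_zero.1 (norm_eq_zero.1 this)

/-- The mass of the spectral measure at a point is the squared norm of the projection on the
eigenspace. -/
theorem spectralMeasure_real_singleton {A : H →L[ℂ] H} (hA : IsSelfAdjoint A) {f : H}
    {μ : Measure ℝ} [IsFiniteMeasure μ]
    (hμ : ∀ φ : ℝ → ℝ, Continuous φ →
      Integrable φ μ ∧ inner ℂ f (cfc φ A f) = ((∫ t, φ t ∂μ : ℝ) : ℂ))
    (p : ℝ) (K : Submodule ℂ H) [K.HasOrthogonalProjection]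
    (hK : ∀ u, u ∈ K ↔ A u = (p : ℂ) • u) :
    μ.real {p} = ‖K.starProjection f‖ ^ 2 := by
  -- Tent functions of half-width `1/n`, decreasing to the indicator of `{p}`. The vectors `φ n (A)
  -- f` converge to the projection of `f` on the eigenspace.
  let φ : ℕ → ℝ → ℝ := fun n t => max 0 (1 - n * |t - p|)
  have hφc : ∀ n, Continuous (φ n) := fun n => by dsimp only [φ]; fun_prop
  have hφ0 : ∀ n t, 0 ≤ φ n t := fun n t => le_max_left _ _
  have hφ1 : ∀ n t, φ n t ≤ 1 := fun n t => max_le zero_le_one (by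
    have : 0 ≤ (n : ℝ) * |t - p| := by positivity
    linarith)
  have hφp : ∀ n, φ n p = 1 := fun n => by simp [φ]
  have hanti : ∀ t, Antitone fun n => φ n t := by
    intro t n m hnm
    have : (n : ℝ) * |t - p| ≤ m * |t - p| :=
      mul_le_mul_of_nonneg_right (by exact_mod_cast hnm) (abs_nonneg _)
    exact max_le_max le_rfl (by linarith)
  have hlim : ∀ t, Tendsto (fun n => φ n t) atTop (𝓝 (Set.indicator {p} (fun _ => (1 : ℝ)) t)) := by
    intro t
    by_cases h : t = p
    · subst h; simp [hφp]
    · have h0 : 0 < |t - p| := abs_pos.2 (sub_ne_zero.2 h)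
      rw [Set.indicator_of_notMem (by simpa using h)]
      apply tendsto_const_nhds.congr'
      obtain ⟨N, hN⟩ := exists_nat_gt (1 / |t - p|)
      filter_upwards [eventually_ge_atTop N] with n hn
      have : 1 ≤ (n : ℝ) * |t - p| := by
        have h1 : 1 / |t - p| ≤ n := hN.le.trans (by exact_mod_cast hn)
        rwa [div_le_iff₀ h0] at h1
      exact (max_eq_left (by linarith)).symm
  let a : ℕ → ℝ := fun n => ∫ t, φ n t ^ 2 ∂μ
  have hI : ∀ n, Integrable (fun t => φ n t ^ 2) μ := fun n => (hμ _ ((hφc n).pow 2)).1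
  have ha : Tendsto a atTop (𝓝 (μ.real {p})) := by
    have : μ.real {p} = ∫ t, (Set.indicator {p} (fun _ => (1 : ℝ)) t) ^ 2 ∂μ := by
      have h : (fun t => (Set.indicator {p} (fun _ => (1 : ℝ)) t) ^ 2)
          = Set.indicator {p} (fun _ => (1 : ℝ)) := by
        ext t; by_cases h : t = p <;> simp [h]
      rw [h, integral_indicator (measurableSet_singleton p)]
      simp [Measure.real]
    rw [this]
    refine tendsto_integral_of_dominated_convergence (fun _ => 1)
      (fun n => (hI n).aestronglyMeasurable) (integrable_const _) (fun n => ?_) ?_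
    · refine Eventually.of_forall fun t => ?_
      rw [Real.norm_of_nonneg (sq_nonneg _)]
      exact pow_le_one₀ (hφ0 n t) (hφ1 n t)
    · exact Eventually.of_forall fun t => (hlim t).pow 2
  let g : ℕ → H := fun n => cfc (φ n) A f
  have hg2 : ∀ n, ‖g n‖ ^ 2 = a n := fun n => norm_sq_cfc_apply hμ (hφc n)
  have hgsub : ∀ n m, n ≤ m → ‖g n - g m‖ ^ 2 ≤ a n - a m := by
    intro n m hnm
    have h1 : g n - g m = cfc (fun t => φ n t - φ m t) A f := by
      rw [cfc_sub (φ n) (φ m) A (hφc n).continuousOn (hφc m).continuousOn]; rfl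
    rw [h1, norm_sq_cfc_apply hμ (φ := fun t => φ n t - φ m t) ((hφc n).sub (hφc m)), ← integral_sub (hI n) (hI m)]
    refine integral_mono (hμ _ (((hφc n).sub (hφc m)).pow 2)).1 ((hI n).sub (hI m)) fun t => ?_
    have h2 := hanti t hnm
    have h3 := hφ0 m t
    dsimp only at h2 ⊢
    nlinarith
  have hcau : CauchySeq g := by
    rw [Metric.cauchySeq_iff']
    intro ε hε
    have hc := Metric.cauchySeq_iff'.1 ha.cauchySeq (ε ^ 2) (by positivity)
    obtain ⟨N, hN⟩ := hc
    refine ⟨N, fun n hn => ?_⟩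
    have h1 := hgsub N n hn
    have h2 := hN n hn
    rw [Real.dist_eq, abs_sub_comm] at h2
    have h3 := (le_abs_self _).trans_lt h2
    rw [dist_eq_norm, norm_sub_rev]
    exact lt_of_pow_lt_pow_left₀ 2 hε.le (h1.trans_lt h3)
  obtain ⟨G, hG⟩ := cauchySeq_tendsto_of_complete hcau
  have hGK : G ∈ K := by
    rw [hK]
    have h1 : Tendsto (fun n => A (g n) - (p : ℂ) • g n) atTop (𝓝 (A G - (p : ℂ) • G)) :=
      ((A.continuous.tendsto _).comp hG).sub (hG.const_smul _)
    have h2 : Tendsto (fun n => A (g n) - (p : ℂ) • g n) atTop (𝓝 0) := by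
      rw [tendsto_zero_iff_norm_tendsto_zero]
      -- On the support of the tent `|t - p| ≤ 1/n`, so the limit is an eigenvector.
      have hb : ∀ n, 1 ≤ n → ‖A (g n) - (p : ℂ) • g n‖ ≤ (1 / n) * Real.sqrt (μ.real Set.univ) := by
        intro n hn
        have hn' : (0 : ℝ) < n := by exact_mod_cast hn
        have h3 : A (g n) - (p : ℂ) • g n = cfc (fun t => (t - p) * φ n t) A f := by
          rw [cfc_mul (fun t => t - p) (φ n) A (by fun_prop) (hφc n).continuousOn,
            cfc_sub (fun t => t) (fun _ => p) A (by fun_prop) (by fun_prop), cfc_const p A,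
            cfc_id' ℝ A]
          simp [Algebra.algebraMap_eq_smul_one, g]
        have hc : Continuous fun t => (t - p) * φ n t := by have := hφc n; fun_prop
        rw [← abs_of_nonneg (norm_nonneg (A (g n) - (p : ℂ) • g n)), ← Real.sqrt_sq_eq_abs, h3,
          norm_sq_cfc_apply hμ hc]
        have h4 : ∫ t, ((t - p) * φ n t) ^ 2 ∂μ ≤ (1 / n) ^ 2 * μ.real Set.univ := by
          have : (1 / n : ℝ) ^ 2 * μ.real Set.univ = ∫ t, (1 / n : ℝ) ^ 2 ∂μ := by
            rw [integral_const, smul_eq_mul, mul_comm]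
          rw [this]
          refine integral_mono (hμ _ (hc.pow 2)).1 (integrable_const _) fun t => ?_
          dsimp only
          rw [← sq_abs]
          refine pow_le_pow_left₀ (abs_nonneg _) ?_ 2
          rw [abs_mul, abs_of_nonneg (hφ0 n t)]
          by_cases h5 : |t - p| ≤ 1 / n
          · calc _ ≤ |t - p| * 1 := mul_le_mul_of_nonneg_left (hφ1 n t) (abs_nonneg _)
              _ ≤ _ := by rwa [mul_one]
          · push Not at h5
            have h6 : φ n t = 0 := by
              refine max_eq_left ?_
              rw [div_lt_iff₀ hn'] at h5
              linarith
            rw [h6, mul_zero]; positivity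
        calc Real.sqrt _ ≤ Real.sqrt ((1 / n) ^ 2 * μ.real Set.univ) := Real.sqrt_le_sqrt h4
          _ = _ := by rw [Real.sqrt_mul (by positivity), Real.sqrt_sq (by positivity)]
      refine squeeze_zero' (Eventually.of_forall fun n => norm_nonneg _)
        ((eventually_ge_atTop 1).mono hb) ?_
      have := (tendsto_one_div_atTop_nhds_zero_nat (𝕜 := ℝ)).mul_const (Real.sqrt (μ.real Set.univ))
      simpa using this
    exact sub_eq_zero.1 (tendsto_nhds_unique h1 h2)
  have hGP : K.starProjection f = G := by
    refine Submodule.eq_starProjection_of_mem_of_inner_eq_zero hGK fun e he => ?_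
    rw [hK] at he
    -- Moving `φ n (A)` onto the eigenvector `e` multiplies it by `φ n p = 1`.
    have h1 : ∀ n, inner ℂ (f - g n) e = 0 := by
      intro n
      have h4 : IsSelfAdjoint (cfc (φ n) A) := cfc_predicate (φ n) A
      have h5 : inner ℂ (g n) e = inner ℂ f (cfc (φ n) A e) := h4.isSymmetric f e
      rw [inner_sub_left, h5, cfc_apply_eigenvector hA he (hφc n), hφp]
      simp
    have h2 : Tendsto (fun n => inner ℂ (f - g n) e) atTop (𝓝 (inner ℂ (f - G) e)) :=
      (tendsto_const_nhds.sub hG).inner tendsto_const_nhds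
    simp only [h1] at h2
    exact tendsto_nhds_unique h2 tendsto_const_nhds |>.symm ▸ rfl
  rw [hGP]
  refine tendsto_nhds_unique ha ?_
  exact (hG.norm.pow 2).congr hg2

/-- The equation is solved by `u = Φ(A) f` with `Φ(t) = t/(1 - zt)`, which has no real pole since
`z` is not real. The functional calculus used is over `ℝ`, so the real and imaginary parts of `Φ`
are treated separately. -/
theorem inner_resolvent_eq_integral {A : H →L[ℂ] H} (hA : IsSelfAdjoint A) {f : H}
    {μ : Measure ℝ}
    (hμ : ∀ φ : ℝ → ℝ, Continuous φ →
      Integrable φ μ ∧ inner ℂ f (cfc φ A f) = ((∫ t, φ t ∂μ : ℝ) : ℂ))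
    {z : ℂ} (hz : z.im ≠ 0) {u : H} (hu : u - z • A u = A f) :
    inner ℂ f u = ∫ t : ℝ, (t : ℂ) / (1 - z * t) ∂μ := by
  have hne : ∀ t : ℝ, 1 - z * t ≠ 0 := by
    intro t h
    have h1 := congrArg Complex.im h
    have h2 := congrArg Complex.re h
    simp at h1 h2
    rcases h1 with h1 | h1
    · exact hz h1
    · simp [h1] at h2
  let Φ : ℝ → ℂ := fun t => (t : ℂ) / (1 - z * t)
  have hΦ : Continuous Φ := by
    refine Continuous.div (by fun_prop) (by fun_prop) hne
  let φ₁ : ℝ → ℝ := fun t => (Φ t).re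
  let φ₂ : ℝ → ℝ := fun t => (Φ t).im
  have h1c : Continuous φ₁ := Complex.continuous_re.comp hΦ
  have h2c : Continuous φ₂ := Complex.continuous_im.comp hΦ
  have hrel : ∀ t, Φ t - z * t * Φ t = t := by
    intro t
    have := hne t
    have h : Φ t * (1 - z * t) = t := div_mul_cancel₀ _ this
    linear_combination h
  let v : H := cfc φ₁ A f + Complex.I • cfc φ₂ A f
  have hv : v - z • A v = A f := by
    have e1 : φ₁ = fun t => t + (z.re * (t * φ₁ t) - z.im * (t * φ₂ t)) := by
      ext t
      have := congrArg Complex.re (hrel t)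
      simp at this
      simp only [φ₁, φ₂]; linear_combination this
    have e2 : φ₂ = fun t => z.re * (t * φ₂ t) + z.im * (t * φ₁ t) := by
      ext t
      have := congrArg Complex.im (hrel t)
      simp at this
      simp only [φ₁, φ₂]; linear_combination this
    have m1 : cfc (fun t => t * φ₁ t) A = A * cfc φ₁ A := by
      rw [cfc_mul (fun t => t) φ₁ A (by fun_prop) (by fun_prop), cfc_id' ℝ A]
    have m2 : cfc (fun t => t * φ₂ t) A = A * cfc φ₂ A := by
      rw [cfc_mul (fun t => t) φ₂ A (by fun_prop) (by fun_prop), cfc_id' ℝ A]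
    have c1 : cfc φ₁ A f = A f + ((z.re : ℂ) • A (cfc φ₁ A f) - (z.im : ℂ) • A (cfc φ₂ A f)) := by
      conv_lhs => rw [e1]
      rw [cfc_add A (fun t => t) _ (by fun_prop) (by fun_prop),
        cfc_sub (fun t => z.re * (t * φ₁ t)) (fun t => z.im * (t * φ₂ t)) A (by fun_prop) (by fun_prop),
        cfc_const_mul z.re (fun t => t * φ₁ t) A (by fun_prop),
        cfc_const_mul z.im (fun t => t * φ₂ t) A (by fun_prop), m1, m2, cfc_id' ℝ A]
      simp
    have c2 : cfc φ₂ A f = (z.re : ℂ) • A (cfc φ₂ A f) + (z.im : ℂ) • A (cfc φ₁ A f) := by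
      conv_lhs => rw [e2]
      rw [cfc_add A (fun t => z.re * (t * φ₂ t)) (fun t => z.im * (t * φ₁ t)) (by fun_prop) (by fun_prop),
        cfc_const_mul z.re (fun t => t * φ₂ t) A (by fun_prop),
        cfc_const_mul z.im (fun t => t * φ₁ t) A (by fun_prop), m1, m2]
      simp
    have hzz : z = z.re + z.im * Complex.I := (Complex.re_add_im z).symm
    have hI : Complex.I * Complex.I = -1 := Complex.I_mul_I
    simp only [v, map_add, map_smul]
    generalize A (cfc φ₁ A f) = a₁ at *
    generalize A (cfc φ₂ A f) = a₂ at *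
    rw [c1, c2]
    generalize A f = a₀
    have : ∀ r s : ℂ, z = r + s * Complex.I →
      a₀ + (r • a₁ - s • a₂) + Complex.I • (r • a₂ + s • a₁) - z • (a₁ + Complex.I • a₂) = a₀ := by
      rintro r s rfl
      match_scalars
      · ring
      · ring
      · linear_combination (-s) * hI
    exact this _ _ hzz
  -- If `d = z A d`, then `(Ad, d)` equals both `z ‖Ad‖²` and `conj z ‖Ad‖²` by self-adjointness, so
  -- `Ad = 0` and `d = 0`.
  have huv : u = v := by
    have h1 : (u - v) = z • A (u - v) := by
      rw [map_sub, smul_sub]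
      have := hu.trans hv.symm
      calc u - v = (u - z • A u) - (v - z • A v) + (z • A u - z • A v) := by abel
        _ = _ := by rw [this, sub_self, zero_add]
    have h2 : inner ℂ (A (u - v)) (u - v) = inner ℂ (u - v) (A (u - v)) := hA.isSymmetric _ _
    have h3 : inner ℂ (A (u - v)) (u - v) = z * inner ℂ (A (u - v)) (A (u - v)) := by
      conv_lhs => rw [h1]
      rw [map_smul, ← map_smul, ← h1, ← inner_smul_right, ← h1]
    have h4 : inner ℂ (u - v) (A (u - v)) = starRingEnd ℂ z * inner ℂ (A (u - v)) (A (u - v)) := by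
      rw [← inner_smul_left, ← h1]
    rw [h3, h4, inner_self_eq_norm_sq_to_K] at h2
    have h5 : z - starRingEnd ℂ z ≠ 0 := by
      rw [Complex.sub_conj]; simpa using hz
    have h6 : (z - starRingEnd ℂ z) * (‖A (u - v)‖ : ℂ) ^ 2 = 0 := by
      rw [sub_mul]; exact sub_eq_zero.2 h2
    have h7 : A (u - v) = 0 := by
      rcases mul_eq_zero.1 h6 with h | h
      · exact absurd h h5
      · simpa using h
    rw [h7, smul_zero] at h1
    exact sub_eq_zero.1 h1
  rw [huv]
  have hi : Integrable Φ μ := by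
    have := (((hμ φ₁ h1c).1.ofReal (𝕜 := ℂ)).add (((hμ φ₂ h2c).1.ofReal (𝕜 := ℂ)).mul_const Complex.I))
    refine this.congr (Eventually.of_forall fun t => ?_)
    exact Complex.re_add_im (Φ t)
  have h1 : ∫ t, Φ t ∂μ = ((∫ t, φ₁ t ∂μ : ℝ) : ℂ) + ((∫ t, φ₂ t ∂μ : ℝ) : ℂ) * Complex.I := by
    exact (integral_re_add_im hi).symm
  change _ = ∫ t, Φ t ∂μ
  rw [h1, ← (hμ φ₁ h1c).2, ← (hμ φ₂ h2c).2]
  simp only [v, inner_add_right, inner_smul_right]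
  ring

/-- The spectral measure, at the vector `f`, of the self-adjoint operator `A⁻¹ - c`. -/
theorem exists_energyMeasure (A : H →L[ℂ] H) (hA : IsSelfAdjoint A) (hker : ∀ u, A u = 0 → u = 0)
    (c : ℝ) (f : H) :
    ∃ ν : Measure ℝ, IsFiniteMeasure ν ∧ ν.real Set.univ = ‖f‖ ^ 2 ∧
      (∀ z : ℂ, z.im ≠ 0 → ∀ u, u - (z + c) • A u = A f →
        inner ℂ f u = ∫ s : ℝ, 1 / ((s : ℂ) - z) ∂ν) ∧
      ∀ (E : ℝ) (K : Submodule ℂ H) [K.HasOrthogonalProjection],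
        (∀ u, u ∈ K ↔ A u = (((E + c)⁻¹ : ℝ) : ℂ) • u) → ν.real {E} = ‖K.starProjection f‖ ^ 2 := by
  obtain ⟨μ, hfin, hμ⟩ := exists_spectralMeasure A hA f
  have hm : Measurable fun t : ℝ => t⁻¹ - c := by fun_prop
  -- Injectivity of `A` means that `0` carries no mass, so the value of `t⁻¹` at `0` is immaterial.
  have h0 : μ.real {0} = 0 := by
    rw [spectralMeasure_real_singleton hA hμ 0 ⊥ (fun u => ?_)]
    · simp
    · simp only [Submodule.mem_bot, Complex.ofReal_zero, zero_smul]
      exact ⟨fun h => by simp [h], hker u⟩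
  have h0' : ∀ᵐ t ∂μ, t ≠ 0 := by
    rw [ae_iff]
    simp only [not_not]
    exact (measureReal_eq_zero_iff).1 h0
  refine ⟨μ.map fun t => t⁻¹ - c, inferInstance, ?_, ?_, ?_⟩
  · rw [map_measureReal_apply hm MeasurableSet.univ, Set.preimage_univ]
    have := norm_sq_cfc_apply hμ (φ := fun _ => 1) continuous_const
    rw [cfc_const_one ℝ A] at this
    simpa using this.symm
  · intro z hz u hu
    rw [inner_resolvent_eq_integral hA hμ (z := z + c) (by simpa using hz) hu]
    rw [integral_map hm.aemeasurable]
    · refine integral_congr_ae ?_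
      filter_upwards [h0'] with t ht
      have : (t : ℂ) ≠ 0 := by exact_mod_cast ht
      push_cast
      have h2 : (t : ℂ)⁻¹ - c - z = (1 - (z + c) * t) / t := by field_simp; ring
      rw [h2, one_div_div]
    · exact (Measurable.aestronglyMeasurable (by fun_prop))
  · intro E K _ hK
    rw [map_measureReal_apply hm (measurableSet_singleton E)]
    -- Also true for `E = -c`, thanks to the convention `0⁻¹ = 0`.
    have : (fun t : ℝ => t⁻¹ - c) ⁻¹' {E} = {(E + c)⁻¹} := by
      ext t
      simp only [Set.mem_preimage, Set.mem_singleton_iff]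
      constructor
      · intro h; rw [← h]; simp
      · rintro rfl; simp
    rw [this]
    exact spectralMeasure_real_singleton hA hμ _ K hK

end SpectralMeasure

/-! ### Stieltjes inversion -/

section Stieltjes

theorem hasDerivAt_arctan_div {ε : ℝ} (hε : 0 < ε) (s x : ℝ) :
    HasDerivAt (fun x => Real.arctan ((x - s) / ε)) (ε / ((s - x) ^ 2 + ε ^ 2)) x := by
  have h := (((hasDerivAt_id x).sub_const s).div_const ε).arctan
  refine h.congr_deriv ?_
  have : (s - x) ^ 2 + ε ^ 2 ≠ 0 := by positivity
  have h2 : 1 + ((id x - s) / ε) ^ 2 = ((s - x) ^ 2 + ε ^ 2) / ε ^ 2 := by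
    simp only [id]; field_simp; ring
  rw [h2]; field_simp

theorem im_stieltjes_kernel (s x ε : ℝ) :
    (1 / ((s : ℂ) - (x + ε * Complex.I))).im = ε / ((s - x) ^ 2 + ε ^ 2) := by
  rw [one_div, Complex.inv_im, Complex.normSq_apply]
  simp
  ring_nf

theorem tendsto_arctan_div (r : ℝ) :
    Tendsto (fun ε : ℝ => Real.arctan (r / ε)) (𝓝[>] 0)
      (𝓝 (Real.pi / 2 * (if 0 < r then 1 else if r < 0 then -1 else 0))) := by
  rcases lt_trichotomy r 0 with h | h | h
  · rw [if_neg h.not_gt, if_pos h, mul_neg_one]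
    have h1 : Tendsto (fun ε : ℝ => r / ε) (𝓝[>] 0) atBot := by
      simp only [div_eq_mul_inv]
      exact tendsto_inv_nhdsGT_zero.const_mul_atTop_of_neg h
    exact (Real.tendsto_arctan_atBot.mono_right nhdsWithin_le_nhds).comp h1
  · subst h; simp
  · rw [if_pos h, mul_one]
    have h1 : Tendsto (fun ε : ℝ => r / ε) (𝓝[>] 0) atTop := by
      simp only [div_eq_mul_inv]
      exact tendsto_inv_nhdsGT_zero.const_mul_atTop h
    exact (Real.tendsto_arctan_atTop.mono_right nhdsWithin_le_nhds).comp h1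

variable {ν : Measure ℝ} [IsFiniteMeasure ν] {F : ℂ → ℂ} {ρ : ℝ → ℝ} {a b M : ℝ}

theorem continuous_poisson_integrand {ε : ℝ} (hε : 0 < ε) :
    Continuous fun p : ℝ × ℝ => ε / ((p.2 - p.1) ^ 2 + ε ^ 2) :=
  Continuous.div (by fun_prop) (by fun_prop) fun p => by positivity

theorem abs_poisson_integrand_le {ε : ℝ} (hε : 0 < ε) (x s : ℝ) :
    ‖ε / ((s - x) ^ 2 + ε ^ 2)‖ ≤ 1 / ε := by
  rw [Real.norm_of_nonneg (by positivity), div_le_div_iff₀ (by positivity) hε]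
  nlinarith [sq_nonneg (s - x)]

theorem im_stieltjes (hF : ∀ z : ℂ, 0 < z.im → F z = ∫ s : ℝ, 1 / ((s : ℂ) - z) ∂ν)
    {ε : ℝ} (hε : 0 < ε) (x : ℝ) :
    (F (x + ε * Complex.I)).im = ∫ s, ε / ((s - x) ^ 2 + ε ^ 2) ∂ν := by
  rw [hF _ (by simpa using hε)]
  have hne : ∀ s : ℝ, (s : ℂ) - (x + ε * Complex.I) ≠ 0 := by
    intro s h
    have := congrArg Complex.im h
    simp at this
    exact hε.ne' this
  have hi : Integrable (fun s : ℝ => 1 / ((s : ℂ) - (x + ε * Complex.I))) ν := by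
    refine Integrable.of_bound (C := 1 / ε) ?_ (Eventually.of_forall fun s => ?_)
    · exact (Continuous.div (by fun_prop) (by fun_prop) hne).aestronglyMeasurable
    · rw [norm_div, norm_one]
      refine one_div_le_one_div_of_le hε ?_
      have := Complex.abs_im_le_norm ((s : ℂ) - (x + ε * Complex.I))
      simp at this
      exact (le_abs_self _).trans this
  have h1 : (∫ s : ℝ, 1 / ((s : ℂ) - (x + ε * Complex.I)) ∂ν).im
      = ∫ s : ℝ, (1 / ((s : ℂ) - (x + ε * Complex.I))).im ∂ν := (integral_im hi).symm
  rw [h1]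
  simp only [im_stieltjes_kernel]

/-- Fubini: the Poisson kernel is integrated in `x` first, and its primitive is an arctangent. -/
theorem intervalIntegral_im_stieltjes (hF : ∀ z : ℂ, 0 < z.im → F z = ∫ s : ℝ, 1 / ((s : ℂ) - z) ∂ν)
    {ε : ℝ} (hε : 0 < ε) (hab : a ≤ b) :
    ∫ x in a..b, (F (x + ε * Complex.I)).im
      = ∫ s, (Real.arctan ((b - s) / ε) - Real.arctan ((a - s) / ε)) ∂ν := by
  simp only [im_stieltjes hF hε]
  rw [intervalIntegral.integral_of_le hab, integral_integral_swap]
  · refine integral_congr_ae (Eventually.of_forall fun s => ?_)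
    dsimp only
    rw [← intervalIntegral.integral_of_le hab]
    refine intervalIntegral.integral_eq_sub_of_hasDerivAt
      (fun x _ => hasDerivAt_arctan_div hε s x) ?_
    refine Continuous.intervalIntegrable ?_ _ _
    exact Continuous.div (by fun_prop) (by fun_prop) fun p => by positivity
  · refine Integrable.of_bound (C := 1 / ε) ?_ (Eventually.of_forall fun p => ?_)
    · exact (continuous_poisson_integrand hε).aestronglyMeasurable
    · exact abs_poisson_integrand_le hε p.1 p.2

/-- Stieltjes inversion on an interval. -/
theorem stieltjes_inversion (hF : ∀ z : ℂ, 0 < z.im → F z = ∫ s : ℝ, 1 / ((s : ℂ) - z) ∂ν)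
    (hab : a < b)
    (hlim : ∀ x ∈ Set.Icc a b,
      Tendsto (fun ε : ℝ => (F (x + ε * Complex.I)).im) (𝓝[>] 0) (𝓝 (ρ x)))
    (hbd : ∀ x ∈ Set.Icc a b, ∀ ε ∈ Set.Ioc (0 : ℝ) 1, |(F (x + ε * Complex.I)).im| ≤ M) :
    ∫ x in a..b, ρ x
      = Real.pi * (ν.real (Set.Ioo a b) + 1 / 2 * ν.real {a} + 1 / 2 * ν.real {b}) := by
  have hpos : ∀ᶠ ε : ℝ in 𝓝[>] 0, ε ∈ Set.Ioc (0 : ℝ) 1 := Ioc_mem_nhdsGT one_pos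
  have h1 : Tendsto (fun ε : ℝ => ∫ x in a..b, (F (x + ε * Complex.I)).im) (𝓝[>] 0)
      (𝓝 (∫ x in a..b, ρ x)) := by
    refine intervalIntegral.tendsto_integral_filter_of_dominated_convergence (fun _ => M) ?_ ?_ ?_ ?_
    · filter_upwards [hpos] with ε hε
      simp only [im_stieltjes hF hε.1]
      refine Continuous.aestronglyMeasurable ?_
      refine continuous_of_dominated (bound := fun _ => 1 / ε) (fun x => ?_)
        (fun x => Eventually.of_forall fun s => abs_poisson_integrand_le hε.1 x s)
        (integrable_const _) (Eventually.of_forall fun s => ?_)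
      · exact ((continuous_poisson_integrand hε.1).comp (Continuous.prodMk_right x)).aestronglyMeasurable
      · exact (continuous_poisson_integrand hε.1).comp (Continuous.prodMk_left s)
    · filter_upwards [hpos] with ε hε
      refine Eventually.of_forall fun x hx => ?_
      rw [Set.uIoc_of_le hab.le] at hx
      exact hbd x ⟨hx.1.le, hx.2⟩ ε hε
    · exact intervalIntegrable_const
    · refine Eventually.of_forall fun x hx => ?_
      rw [Set.uIoc_of_le hab.le] at hx
      exact hlim x ⟨hx.1.le, hx.2⟩
  -- The limit of the arctangents is `π/2` times the sign; its value `0` at `0` is why the endpoints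
  -- count with weight one half.
  let sg : ℝ → ℝ := fun r => Real.pi / 2 * (if 0 < r then 1 else if r < 0 then -1 else 0)
  have h2 : Tendsto (fun ε : ℝ => ∫ s, (Real.arctan ((b - s) / ε) - Real.arctan ((a - s) / ε)) ∂ν)
      (𝓝[>] 0) (𝓝 (∫ s, (sg (b - s) - sg (a - s)) ∂ν)) := by
    refine tendsto_integral_filter_of_dominated_convergence (fun _ => Real.pi) ?_ ?_
      (integrable_const _) ?_
    · refine Eventually.of_forall fun ε => Measurable.aestronglyMeasurable ?_
      fun_prop
    · refine Eventually.of_forall fun ε => Eventually.of_forall fun s => ?_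
      rw [Real.norm_eq_abs, abs_le]
      have := Real.arctan_lt_pi_div_two ((b - s) / ε)
      have := Real.arctan_lt_pi_div_two ((a - s) / ε)
      have := Real.neg_pi_div_two_lt_arctan ((b - s) / ε)
      have := Real.neg_pi_div_two_lt_arctan ((a - s) / ε)
      constructor <;> linarith
    · exact Eventually.of_forall fun s => (tendsto_arctan_div _).sub (tendsto_arctan_div _)
  have h3 : ∫ s, (sg (b - s) - sg (a - s)) ∂ν
      = Real.pi * (ν.real (Set.Ioo a b) + 1 / 2 * ν.real {a} + 1 / 2 * ν.real {b}) := by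
    have : (fun s => sg (b - s) - sg (a - s)) = fun s =>
        (Set.Ioo a b).indicator (fun _ => Real.pi) s
          + (({a} : Set ℝ).indicator (fun _ => Real.pi / 2) s
            + ({b} : Set ℝ).indicator (fun _ => Real.pi / 2) s) := by
      ext s
      simp only [sg, Set.indicator_apply, Set.mem_Ioo, Set.mem_singleton_iff]
      rcases lt_trichotomy s a with h | h | h
      · have h' : s < b := h.trans hab
        simp [h, h', h.not_gt, h.ne, h'.ne]
      · subst h
        simp [hab, hab.ne]
      · rcases lt_trichotomy s b with h' | h' | h'
        · simp [h, h', h.ne', h'.ne, h.not_gt]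
        · subst h'
          simp [hab, hab.ne', hab.not_gt]
        · simp [h.not_gt, h'.not_gt, h.ne', h'.ne', h, h']
    have hi1 : Integrable ((Set.Ioo a b).indicator (fun _ => Real.pi)) ν :=
      (integrable_const _).indicator measurableSet_Ioo
    have hi2 : Integrable (({a} : Set ℝ).indicator (fun _ => Real.pi / 2)) ν :=
      (integrable_const _).indicator (measurableSet_singleton _)
    have hi3 : Integrable (({b} : Set ℝ).indicator (fun _ => Real.pi / 2)) ν :=
      (integrable_const _).indicator (measurableSet_singleton _)
    rw [this, integral_add (g := fun s => _ + _) hi1 (hi2.add hi3), integral_add hi2 hi3,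
      integral_indicator_const _ measurableSet_Ioo,
      integral_indicator_const _ (measurableSet_singleton _),
      integral_indicator_const _ (measurableSet_singleton _)]
    simp only [smul_eq_mul]; ring
  rw [← h3]
  refine tendsto_nhds_unique (h1.congr' ?_) h2
  filter_upwards [hpos] with ε hε
  exact intervalIntegral_im_stieltjes hF hε.1 hab.le

/-- If the boundary values of the imaginary part of the Stieltjes transform exist boundedly on
`[a, b]`, then the measure is given there by the density `ρ / π`. -/
theorem measureReal_Icc_of_stieltjes
    (hF : ∀ z : ℂ, 0 < z.im → F z = ∫ s : ℝ, 1 / ((s : ℂ) - z) ∂ν) (hab : a < b)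
    (hlim : ∀ x ∈ Set.Icc a b,
      Tendsto (fun ε : ℝ => (F (x + ε * Complex.I)).im) (𝓝[>] 0) (𝓝 (ρ x)))
    (hbd : ∀ x ∈ Set.Icc a b, ∀ ε ∈ Set.Ioc (0 : ℝ) 1, |(F (x + ε * Complex.I)).im| ≤ M) :
    ν.real (Set.Icc a b) = Real.pi⁻¹ * ∫ x in a..b, ρ x := by
  have hpi := Real.pi_pos
  have hρ : ∀ x ∈ Set.Icc a b, ‖ρ x‖ ≤ M := by
    intro x hx
    refine le_of_tendsto (hlim x hx).abs ?_
    filter_upwards [Ioc_mem_nhdsGT one_pos] with ε hε using hbd x hx ε hε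
  -- Inversion on a subinterval bounds its mass by a multiple of its length. Shrinking subintervals
  -- that abut an endpoint then show that neither endpoint is an atom.
  have hsub : ∀ a' b', a ≤ a' → a' < b' → b' ≤ b →
      Real.pi * (ν.real (Set.Ioo a' b') + 1 / 2 * ν.real {a'} + 1 / 2 * ν.real {b'})
        ≤ M * (b' - a') := by
    intro a' b' h1 h2 h3
    have hs : Set.Icc a' b' ⊆ Set.Icc a b := Set.Icc_subset_Icc h1 h3
    rw [← stieltjes_inversion hF h2 (fun x hx => hlim x (hs hx)) (fun x hx => hbd x (hs hx))]
    have := intervalIntegral.norm_integral_le_of_norm_le_const (a := a') (b := b') (f := ρ) (C := M)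
      (fun x hx => by
        rw [Set.uIoc_of_le h2.le] at hx
        exact hρ x (hs ⟨hx.1.le, hx.2⟩))
    rw [abs_of_pos (sub_pos.2 h2)] at this
    exact (le_abs_self _).trans this
  have hM : 0 ≤ M := (norm_nonneg _).trans (hρ a ⟨le_rfl, hab.le⟩)
  have hend : ∀ t : ℝ, (∀ δ, 0 < δ → δ ≤ b - a → Real.pi * (1 / 2 * t) ≤ M * δ) → t ≤ 0 := by
    intro t ht
    have h1 : Tendsto (fun δ : ℝ => M * δ) (𝓝[>] 0) (𝓝 (M * 0)) :=
      (tendsto_id.const_mul M).mono_left nhdsWithin_le_nhds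
    have h2 : Real.pi * (1 / 2 * t) ≤ M * 0 := by
      refine ge_of_tendsto h1 ?_
      filter_upwards [Ioc_mem_nhdsGT (sub_pos.2 hab)] with δ hδ using ht δ hδ.1 hδ.2
    rw [mul_zero] at h2
    by_contra! h3
    have : 0 < Real.pi * (1 / 2 * t) := by positivity
    linarith
  have n := fun s : Set ℝ => measureReal_nonneg (μ := ν) (s := s)
  have ha : ν.real {a} = 0 := by
    refine le_antisymm (hend _ fun δ h1 h2 => ?_) (n _)
    have := hsub a (a + δ) le_rfl (by linarith) (by linarith)
    have h4 : 1 / 2 * ν.real {a} ≤ (ν.real (Set.Ioo a (a + δ)) + 1 / 2 * ν.real {a} + 1 / 2 * ν.real {a + δ}) := by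
      linarith [n (Set.Ioo a (a + δ)), n {a + δ}]
    have := mul_le_mul_of_nonneg_left h4 hpi.le
    linarith
  have hb : ν.real {b} = 0 := by
    refine le_antisymm (hend _ fun δ h1 h2 => ?_) (n _)
    have := hsub (b - δ) b (by linarith) (by linarith) le_rfl
    have h4 : 1 / 2 * ν.real {b} ≤ (ν.real (Set.Ioo (b - δ) b) + 1 / 2 * ν.real {b - δ} + 1 / 2 * ν.real {b}) := by
      linarith [n (Set.Ioo (b - δ) b), n {b - δ}]
    have := mul_le_mul_of_nonneg_left h4 hpi.le
    linarith
  have h5 : ν.real (Set.Icc a b) = ν.real (Set.Ioo a b) := by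
    refine measureReal_congr ?_
    have ha' : ν {a} = 0 := (measureReal_eq_zero_iff).1 ha
    have hb' : ν {b} = 0 := (measureReal_eq_zero_iff).1 hb
    have h6 : ∀ᵐ s ∂ν, s ≠ a := by rw [ae_iff]; simpa using ha'
    have h7 : ∀ᵐ s ∂ν, s ≠ b := by rw [ae_iff]; simpa using hb'
    filter_upwards [h6, h7] with s hs1 hs2
    apply propext
    constructor
    · rintro ⟨h1, h2⟩; exact ⟨lt_of_le_of_ne h1 hs1.symm, lt_of_le_of_ne h2 hs2⟩
    · rintro ⟨h1, h2⟩; exact ⟨h1.le, h2.le⟩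
  rw [stieltjes_inversion hF hab hlim hbd, ha, hb, h5]
  field_simp; ring

end Stieltjes

/-! ### Short-range potentials -/

/-- Continuous bounded potentials with finite first moment. -/
structure ShortRange (V : ℝ → ℝ) : Prop where
  cont : Continuous V
  int : Integrable V
  moment : Integrable fun x => x * V x
  bdd : ∃ B, ∀ x, |V x| ≤ B

theorem ShortRange.comp_neg {V : ℝ → ℝ} (hV : ShortRange V) : ShortRange fun x => V (-x) where
  cont := hV.cont.comp continuous_neg
  int := hV.int.comp_neg
  moment := by simpa using hV.moment.comp_neg.neg
  bdd := hV.bdd.imp fun _ h x => h (-x)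

/-! ### Differentiation of tail integrals -/

section Tail

variable {E : Type*} [NormedAddCommGroup E] [NormedSpace ℝ E] [CompleteSpace E]

theorem hasDerivAt_integral_Ioi {g : ℝ → E} (hc : Continuous g)
    (hi : ∀ a, IntegrableOn g (Set.Ioi a)) (x : ℝ) :
    HasDerivAt (fun x => ∫ y in Set.Ioi x, g y) (-g x) x := by
  have h : (fun x => ∫ y in Set.Ioi x, g y)
      = fun x => (∫ y in Set.Ioi 0, g y) - ∫ y in (0 : ℝ)..x, g y := by
    ext x
    rw [eq_sub_iff_add_eq', intervalIntegral.integral_interval_add_Ioi (hi 0) (hi x)]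
  rw [h]
  simpa using (hc.integral_hasStrictDerivAt 0 x).hasDerivAt.const_sub (∫ y in Set.Ioi 0, g y)

theorem hasDerivAt_integral_Iic {g : ℝ → E} (hc : Continuous g)
    (hi : ∀ a, IntegrableOn g (Set.Iic a)) (x : ℝ) :
    HasDerivAt (fun x => ∫ y in Set.Iic x, g y) (g x) x := by
  have h : (fun x => ∫ y in Set.Iic x, g y)
      = fun x => (∫ y in Set.Iic 0, g y) + ∫ y in (0 : ℝ)..x, g y := by
    ext x
    rw [← sub_eq_iff_eq_add', intervalIntegral.integral_Iic_sub_Iic (hi 0) (hi x)]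
  rw [h]
  exact (hc.integral_hasStrictDerivAt 0 x).hasDerivAt.const_add (∫ y in Set.Iic 0, g y)

end Tail

/-! ### Volterra weights and a Gronwall inequality -/

section Weight

variable {q : ℝ → ℝ}

theorem tendsto_integral_Ioi_atTop (q : ℝ → ℝ) :
    Tendsto (fun x => ∫ y in Set.Ioi x, q y) atTop (𝓝 0) :=
  tendsto_integral_Ioi_zero tendsto_id

/-- The weight estimate behind the contraction property of Volterra operators. -/
theorem integral_Ioi_volterra_weight (hc : Continuous q) (hi : Integrable q) (h0 : ∀ y, 0 ≤ q y)
    (x : ℝ) :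
    IntegrableOn (fun y => q y * Real.exp (2 * ∫ s in Set.Ioi y, q s)) (Set.Ioi x) ∧
    ∫ y in Set.Ioi x, q y * Real.exp (2 * ∫ s in Set.Ioi y, q s)
      ≤ 1 / 2 * Real.exp (2 * ∫ s in Set.Ioi x, q s) := by
  let p : ℝ → ℝ := fun y => ∫ s in Set.Ioi y, q s
  have hp : ∀ y, HasDerivAt p (-q y) y := hasDerivAt_integral_Ioi hc fun a => hi.integrableOn
  have hpc : Continuous p := continuous_iff_continuousAt.2 fun y => (hp y).continuousAt
  have hple : ∀ y, p y ≤ ∫ s, q s := fun y =>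
    setIntegral_le_integral hi (Eventually.of_forall h0)
  have hint : IntegrableOn (fun y => q y * Real.exp (2 * p y)) (Set.Ioi x) := by
    refine Integrable.integrableOn ?_
    refine hi.mul_bdd (c := Real.exp (2 * ∫ s, q s)) ?_ (Eventually.of_forall fun y => ?_)
    · exact Continuous.aestronglyMeasurable (by fun_prop)
    · rw [Real.norm_of_nonneg (Real.exp_pos _).le]
      exact Real.exp_le_exp.2 (by linarith [hple y])
  refine ⟨hint, ?_⟩
  -- The integrand is an exact derivative because `p' = -q`; the factor `2` in the exponent produces
  -- the constant `1/2`.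
  have hd : ∀ y ∈ Set.Ici x, HasDerivAt (fun y => -(1 / 2) * Real.exp (2 * p y))
      (q y * Real.exp (2 * p y)) y := by
    intro y _
    refine (((hp y).const_mul 2).exp.const_mul (-(1 / 2))).congr_deriv ?_
    ring
  have hl : Tendsto (fun y => -(1 / 2) * Real.exp (2 * p y)) atTop
      (𝓝 (-(1 / 2) * Real.exp (2 * 0))) := by
    have := tendsto_integral_Ioi_atTop q
    exact ((Real.continuous_exp.tendsto _).comp (this.const_mul 2)).const_mul _
  have := integral_Ioi_of_hasDerivAt_of_tendsto' hd hint hl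
  change ∫ y in Set.Ioi x, q y * Real.exp (2 * p y) ≤ 1 / 2 * Real.exp (2 * p x)
  rw [this]; simp

/-- A Gronwall inequality for bounded functions dominated by their Volterra integral. -/
theorem le_exp_of_le_integral_Ioi (hc : Continuous q) (hi : Integrable q) (h0 : ∀ y, 0 ≤ q y)
    {f : ℝ → ℝ} (hf0 : ∀ y, 0 ≤ f y) (hfc : Continuous f) {S a : ℝ} (hS : ∀ y, f y ≤ S)
    (hf : ∀ x, a ≤ x → f x ≤ 1 + ∫ y in Set.Ioi x, q y * f y) (x : ℝ) (hx : a ≤ x) :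
    f x ≤ 2 * Real.exp (2 * ∫ s in Set.Ioi x, q s) := by
  let p : ℝ → ℝ := fun y => ∫ s in Set.Ioi y, q s
  have hp0 : ∀ y, 0 ≤ p y := fun y => setIntegral_nonneg measurableSet_Ioi fun s _ => h0 s
  -- The crude bound `S` serves only to make this supremum finite. The weight estimate then gives
  -- `sSup B ≤ 1 + sSup B / 2`, so `S` disappears from the conclusion.
  let B : Set ℝ := (fun y => f y * Real.exp (-(2 * p y))) '' Set.Ici a
  have hBne : B.Nonempty := ⟨_, a, Set.mem_Ici.2 le_rfl, rfl⟩
  have hBb : BddAbove B := by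
    refine ⟨S, ?_⟩
    rintro _ ⟨y, _, rfl⟩
    calc f y * Real.exp (-(2 * p y)) ≤ f y * 1 :=
          mul_le_mul_of_nonneg_left (Real.exp_le_one_iff.2 (by linarith [hp0 y])) (hf0 y)
      _ ≤ S := by rw [mul_one]; exact hS y
  have hle : ∀ y, a ≤ y → f y ≤ sSup B * Real.exp (2 * p y) := by
    intro y hy
    have := le_csSup hBb (Set.mem_image_of_mem (fun y => f y * Real.exp (-(2 * p y))) hy)
    calc f y = f y * Real.exp (-(2 * p y)) * Real.exp (2 * p y) := by
          rw [mul_assoc, ← Real.exp_add]; simp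
      _ ≤ _ := mul_le_mul_of_nonneg_right this (Real.exp_pos _).le
  have hS0 : 0 ≤ sSup B := by
    refine Real.sSup_nonneg ?_
    rintro _ ⟨y, _, rfl⟩
    exact mul_nonneg (hf0 y) (Real.exp_pos _).le
  have hstep : sSup B ≤ 1 + sSup B / 2 := by
    refine csSup_le hBne ?_
    rintro _ ⟨y, hy, rfl⟩
    have hw := integral_Ioi_volterra_weight hc hi h0 y
    have h1 : ∫ s in Set.Ioi y, q s * f s ≤ sSup B * (1 / 2 * Real.exp (2 * p y)) := by
      calc _ ≤ ∫ s in Set.Ioi y, sSup B * (q s * Real.exp (2 * p s)) := by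
            refine setIntegral_mono_on ?_ (hw.1.const_mul _) measurableSet_Ioi fun s hs => ?_
            · refine Integrable.integrableOn (hi.mul_bdd (c := S) hfc.aestronglyMeasurable
                (Eventually.of_forall fun s => ?_))
              rw [Real.norm_of_nonneg (hf0 s)]; exact hS s
            · have := mul_le_mul_of_nonneg_left (hle s ((Set.mem_Ici.1 hy).trans (le_of_lt hs))) (h0 s)
              linarith
        _ = sSup B * ∫ s in Set.Ioi y, (q s * Real.exp (2 * p s)) := integral_const_mul _ _
        _ ≤ _ := mul_le_mul_of_nonneg_left hw.2 hS0
    have h2 := hf y hy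
    calc f y * Real.exp (-(2 * p y))
        ≤ (1 + sSup B * (1 / 2 * Real.exp (2 * p y))) * Real.exp (-(2 * p y)) :=
          mul_le_mul_of_nonneg_right (h2.trans (by linarith)) (Real.exp_pos _).le
      _ = Real.exp (-(2 * p y)) + sSup B / 2 * (Real.exp (2 * p y) * Real.exp (-(2 * p y))) := by ring
      _ ≤ 1 + sSup B / 2 := by
          rw [← Real.exp_add, add_neg_cancel, Real.exp_zero, mul_one]
          have : Real.exp (-(2 * p y)) ≤ 1 := Real.exp_le_one_iff.2 (by linarith [hp0 y])
          linarith
  have : sSup B ≤ 2 := by linarith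
  exact (hle x hx).trans (mul_le_mul_of_nonneg_right this (Real.exp_pos _).le)

end Weight

/-! ### The Volterra kernel of the Jost equation -/

/-- The closed upper half plane without the origin. -/
def closedUpper : Set ℂ := {ζ | 0 ≤ ζ.im ∧ ζ ≠ 0}

/-- The kernel `(e^{2iζt} - 1) / (2iζ)`. -/
def jostKernel (ζ : ℂ) (t : ℝ) : ℂ :=
  (Complex.exp (2 * Complex.I * ζ * t) - 1) / (2 * Complex.I * ζ)

theorem norm_exp_two_I_mul_le {ζ : ℂ} (hζ : 0 ≤ ζ.im) {t : ℝ} (ht : 0 ≤ t) :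
    ‖Complex.exp (2 * Complex.I * ζ * t)‖ ≤ 1 := by
  rw [Complex.norm_exp, Real.exp_le_one_iff]
  simp
  positivity

/-- Used to construct the solutions for every `ζ`; it degenerates as `ζ → 0`. -/
theorem norm_jostKernel_le {ζ : ℂ} (hζ : ζ ∈ closedUpper) {t : ℝ} (ht : 0 ≤ t) :
    ‖jostKernel ζ t‖ ≤ 1 / ‖ζ‖ := by
  have h0 : 0 < ‖ζ‖ := norm_pos_iff.2 hζ.2
  have h1 := norm_exp_two_I_mul_le hζ.1 ht
  have h2 : ‖Complex.exp (2 * Complex.I * ζ * t) - 1‖ ≤ 2 := by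
    refine (norm_sub_le _ _).trans ?_
    rw [norm_one]; linarith
  rw [jostKernel, norm_div]
  have : ‖2 * Complex.I * ζ‖ = 2 * ‖ζ‖ := by simp
  rw [this, div_le_div_iff₀ (by positivity) h0]
  nlinarith

/-- Uniform in `k`, at the price of a factor `t`: this is where the first moment of `V` enters the
low-energy bound. -/
theorem norm_jostKernel_ofReal_le {k : ℝ} (hk : k ≠ 0) {t : ℝ} (ht : 0 ≤ t) :
    ‖jostKernel k t‖ ≤ t := by
  have h := Real.norm_exp_I_mul_ofReal_sub_one_le (x := 2 * k * t)
  have e : Complex.I * ((2 * k * t : ℝ) : ℂ) = 2 * Complex.I * k * t := by push_cast; ring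
  rw [e] at h
  rw [jostKernel, norm_div]
  have : ‖2 * Complex.I * (k : ℂ)‖ = 2 * |k| := by simp
  have hk' : 0 < |k| := abs_pos.2 hk
  rw [this, div_le_iff₀ (by positivity)]
  refine h.trans (le_of_eq ?_)
  rw [Real.norm_eq_abs, abs_mul, abs_mul, abs_of_nonneg ht]
  simp; ring

theorem continuousOn_jostKernel :
    ContinuousOn (fun p : ℂ × ℝ => jostKernel p.1 p.2) (closedUpper ×ˢ Set.univ) := by
  refine ContinuousOn.div (by fun_prop) (by fun_prop) ?_
  rintro ⟨ζ, t⟩ ⟨h, _⟩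
  simpa using h.2

theorem jostKernel_zero (ζ : ℂ) : jostKernel ζ 0 = 0 := by simp [jostKernel]

/-! ### Existence of the Jost amplitude -/

section Existence

variable {V : ℝ → ℝ}

/-- The total potential to the right of `x`. -/
def tail (V : ℝ → ℝ) (x : ℝ) : ℝ := ∫ y in Set.Ioi x, |V y|

theorem tail_nonneg (V : ℝ → ℝ) (x : ℝ) : 0 ≤ tail V x :=
  setIntegral_nonneg measurableSet_Ioi fun _ _ => abs_nonneg _

theorem tail_le (hV : ShortRange V) (x : ℝ) : tail V x ≤ ∫ y, |V y| :=
  setIntegral_le_integral hV.int.abs (Eventually.of_forall fun _ => abs_nonneg _)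

theorem tail_anti (hV : ShortRange V) {x y : ℝ} (h : x ≤ y) : tail V y ≤ tail V x :=
  setIntegral_mono_set hV.int.abs.integrableOn (Eventually.of_forall fun _ => abs_nonneg _)
    (Set.Ioi_subset_Ioi h).eventuallyLE

theorem continuous_tail (hV : ShortRange V) : Continuous (tail V) :=
  continuous_iff_continuousAt.2 fun y => (hasDerivAt_integral_Ioi (g := fun y => |V y|)
    hV.cont.abs (fun _ => hV.int.abs.integrableOn) y).continuousAt

theorem tendsto_tail (V : ℝ → ℝ) : Tendsto (tail V) atTop (𝓝 0) :=
  tendsto_integral_Ioi_atTop _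

/-- The kernel of the Volterra operator, conjugated by the weight `e^{2 tail / |ζ|}`. -/
def weightedKernel (V : ℝ → ℝ) (x : ℝ) (ζ : ℂ) (y : ℝ) : ℂ :=
  jostKernel ζ (max (y - x) 0) * V y * Real.exp (2 * (tail V y - tail V x) / ‖ζ‖)

theorem norm_weightedKernel_le (x : ℝ) {ζ : ℂ} (hζ : ζ ∈ closedUpper) (y : ℝ) :
    ‖weightedKernel V x ζ y‖ ≤ (Set.Ioi x).indicator
      (fun y => |V y| / ‖ζ‖ * Real.exp (2 * (tail V y - tail V x) / ‖ζ‖)) y := by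
  by_cases h : x < y
  · rw [Set.indicator_of_mem (Set.mem_Ioi.2 h), weightedKernel, norm_mul, norm_mul,
      Complex.norm_real, Complex.norm_real, Real.norm_of_nonneg (Real.exp_pos _).le]
    refine mul_le_mul_of_nonneg_right ?_ (Real.exp_pos _).le
    have := norm_jostKernel_le hζ (le_max_right (y - x) 0)
    calc _ ≤ 1 / ‖ζ‖ * |V y| := mul_le_mul_of_nonneg_right this (abs_nonneg _)
      _ = _ := by ring
  · rw [Set.indicator_of_notMem (by simpa using h), weightedKernel,
      max_eq_right (by linarith [not_lt.1 h]), jostKernel_zero]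
    simp

/-- For `y > x` the tail of `|V|` is no larger at `y` than at `x`, so the conjugating weight is at
most `1`; for `y ≤ x` the truncated argument `max (y - x) 0` makes the kernel vanish. -/
theorem norm_weightedKernel_le' (hV : ShortRange V) (x : ℝ) {ζ : ℂ} (hζ : ζ ∈ closedUpper) (y : ℝ) :
    ‖weightedKernel V x ζ y‖ ≤ |V y| / ‖ζ‖ := by
  refine (norm_weightedKernel_le x hζ y).trans ?_
  by_cases h : x < y
  · rw [Set.indicator_of_mem (Set.mem_Ioi.2 h)]
    refine mul_le_of_le_one_right (by positivity) (Real.exp_le_one_iff.2 ?_)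
    have := tail_anti hV h.le
    exact div_nonpos_of_nonpos_of_nonneg (by linarith) (norm_nonneg _)
  · rw [Set.indicator_of_notMem (by simpa using h)]
    positivity

theorem integral_weight_le (hV : ShortRange V) (x : ℝ) {ζ : ℂ} (hζ : ζ ≠ 0) :
    IntegrableOn (fun y => |V y| / ‖ζ‖ * Real.exp (2 * (tail V y - tail V x) / ‖ζ‖)) (Set.Ioi x) ∧
    ∫ y in Set.Ioi x, |V y| / ‖ζ‖ * Real.exp (2 * (tail V y - tail V x) / ‖ζ‖) ≤ 1 / 2 := by
  have h := integral_Ioi_volterra_weight (q := fun y => |V y| / ‖ζ‖) (hV.cont.abs.div_const _)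
    (hV.int.abs.div_const _) (fun y => by positivity) x
  have e : ∀ y, |V y| / ‖ζ‖ * Real.exp (2 * (tail V y - tail V x) / ‖ζ‖)
      = Real.exp (-(2 * tail V x / ‖ζ‖)) *
        (|V y| / ‖ζ‖ * Real.exp (2 * ∫ s in Set.Ioi y, |V s| / ‖ζ‖)) := by
    intro y
    have : ∫ s in Set.Ioi y, |V s| / ‖ζ‖ = tail V y / ‖ζ‖ := integral_div _ _
    rw [this, mul_left_comm, ← Real.exp_add]
    congr 2; ring
  simp only [e]
  refine ⟨h.1.const_mul _, ?_⟩
  rw [integral_const_mul]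
  have e2 : ∫ s in Set.Ioi x, |V s| / ‖ζ‖ = tail V x / ‖ζ‖ := integral_div _ _
  calc _ ≤ Real.exp (-(2 * tail V x / ‖ζ‖)) * (1 / 2 * Real.exp (2 * (tail V x / ‖ζ‖))) := by
        refine mul_le_mul_of_nonneg_left ?_ (Real.exp_pos _).le
        rw [← e2]; exact h.2
    _ = 1 / 2 * (Real.exp (-(2 * tail V x / ‖ζ‖)) * Real.exp (2 * (tail V x / ‖ζ‖))) := by ring
    _ = 1 / 2 := by rw [← Real.exp_add]; ring_nf; simp

theorem continuous_weightedKernel_right (hV : ShortRange V) (x : ℝ) (ζ : ℂ) :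
    Continuous (weightedKernel V x ζ) := by
  have h1 : Continuous fun y : ℝ => jostKernel ζ (max (y - x) 0) := by
    unfold jostKernel; fun_prop
  have := continuous_tail hV
  have := hV.cont
  unfold weightedKernel
  fun_prop

theorem continuousOn_weightedKernel_left (hV : ShortRange V) (y : ℝ) :
    ContinuousOn (fun p : ℝ × ℂ => weightedKernel V p.1 p.2 y) (Set.univ ×ˢ closedUpper) := by
  unfold weightedKernel
  have h1 : ContinuousOn (fun p : ℝ × ℂ => jostKernel p.2 (max (y - p.1) 0))
      (Set.univ ×ˢ closedUpper) := by
    refine continuousOn_jostKernel.comp (f := fun p : ℝ × ℂ => (p.2, max (y - p.1) 0))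
      (by fun_prop) ?_
    rintro ⟨x, ζ⟩ ⟨_, h⟩
    exact ⟨h, trivial⟩
  have h2 := continuous_tail hV
  refine (h1.mul continuousOn_const).mul ?_
  refine Complex.continuous_ofReal.comp_continuousOn (Real.continuous_exp.comp_continuousOn ?_)
  refine ContinuousOn.div (by fun_prop) (by fun_prop) ?_
  rintro ⟨x, ζ⟩ ⟨_, h⟩
  simpa using h.2

theorem integrable_weightedKernel_mul (hV : ShortRange V) (x : ℝ) {ζ : ℂ} (hζ : ζ ∈ closedUpper)
    {g : ℝ → ℂ} (hg : Continuous g) {C : ℝ} (hC : ∀ y, ‖g y‖ ≤ C) :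
    Integrable fun y => weightedKernel V x ζ y * g y := by
  have h1 : Integrable (weightedKernel V x ζ) :=
    (hV.int.abs.div_const ‖ζ‖).mono' (continuous_weightedKernel_right hV x ζ).aestronglyMeasurable
      (Eventually.of_forall fun y => norm_weightedKernel_le' hV x hζ y)
  exact h1.mul_bdd hg.aestronglyMeasurable (Eventually.of_forall hC)

theorem norm_integral_weightedKernel_mul_le (hV : ShortRange V) (x : ℝ) {ζ : ℂ}
    (hζ : ζ ∈ closedUpper) {g : ℝ → ℂ} {C : ℝ} (hC : ∀ y, ‖g y‖ ≤ C) :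
    ‖∫ y, weightedKernel V x ζ y * g y‖ ≤ C / 2 := by
  have hC0 : 0 ≤ C := (norm_nonneg _).trans (hC 0)
  have hw := integral_weight_le hV x hζ.2
  have h1 : ∀ y, ‖weightedKernel V x ζ y * g y‖ ≤ C * (Set.Ioi x).indicator
      (fun y => |V y| / ‖ζ‖ * Real.exp (2 * (tail V y - tail V x) / ‖ζ‖)) y := by
    intro y
    rw [norm_mul, mul_comm C]
    exact mul_le_mul (norm_weightedKernel_le x hζ y) (hC y) (norm_nonneg _)
      (Set.indicator_nonneg (fun y _ => by positivity) _)
  refine (norm_integral_le_of_norm_le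
    ((hw.1.integrable_indicator measurableSet_Ioi).const_mul C) (Eventually.of_forall h1)).trans ?_
  rw [integral_const_mul, integral_indicator measurableSet_Ioi]
  have := mul_le_mul_of_nonneg_left hw.2 hC0
  linarith

-- After conjugation with `e^{2 tail / |ζ|}` the Volterra operator is a contraction with constant
-- `1/2`. Solving on functions of `(x, ζ)` jointly, instead of for each `ζ`, yields continuity in
-- `ζ` up to the real axis at no extra cost.
open scoped BoundedContinuousFunction in
theorem exists_weighted_fixedPoint (hV : ShortRange V) :
    ∃ g : ℝ × closedUpper →ᵇ ℂ, ‖g‖ ≤ 2 ∧ ∀ x (ζ : closedUpper),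
      g (x, ζ) = Real.exp (-(2 * tail V x / ‖(ζ : ℂ)‖))
        + ∫ y, weightedKernel V x ζ y * g (y, ζ) := by
  have hcont : ∀ g : ℝ × closedUpper →ᵇ ℂ, Continuous fun p : ℝ × closedUpper =>
      ((Real.exp (-(2 * tail V p.1 / ‖(p.2 : ℂ)‖)) : ℝ) : ℂ)
        + ∫ y, weightedKernel V p.1 p.2 y * g (y, p.2) := by
    intro g
    refine Continuous.add ?_ ?_
    · refine Complex.continuous_ofReal.comp (Real.continuous_exp.comp (Continuous.neg ?_))
      have := continuous_tail hV
      refine Continuous.div (by fun_prop) (by fun_prop) fun p => norm_ne_zero_iff.2 p.2.2.2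
    · refine continuous_iff_continuousAt.2 fun p₀ => ?_
      have hr : 0 < ‖(p₀.2 : ℂ)‖ := norm_pos_iff.2 p₀.2.2.2
      refine continuousAt_of_dominated (bound := fun y => |V y| / (‖(p₀.2 : ℂ)‖ / 2) * ‖g‖)
        -- The domination is local in the parameter: near `p₀` one has `‖ζ‖ > ‖ζ₀‖ / 2`.
        ?_ ?_ ?_ ?_
      · refine Eventually.of_forall fun p => Continuous.aestronglyMeasurable ?_
        have := continuous_weightedKernel_right hV p.1 p.2
        fun_prop
      · have : ∀ᶠ p : ℝ × closedUpper in 𝓝 p₀, ‖(p₀.2 : ℂ)‖ / 2 < ‖(p.2 : ℂ)‖ := by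
          have hc : Continuous fun p : ℝ × closedUpper => ‖(p.2 : ℂ)‖ := by fun_prop
          exact hc.continuousAt.eventually (lt_mem_nhds (by linarith))
        filter_upwards [this] with p hp
        refine Eventually.of_forall fun y => ?_
        rw [norm_mul]
        refine mul_le_mul ((norm_weightedKernel_le' hV p.1 p.2.2 y).trans ?_)
          (g.norm_coe_le_norm _) (norm_nonneg _) (by positivity)
        exact div_le_div_of_nonneg_left (abs_nonneg _) (by positivity) hp.le
      · exact (hV.int.abs.div_const _).mul_const _
      · refine Eventually.of_forall fun y => Continuous.continuousAt ?_
        refine Continuous.mul ?_ (by fun_prop)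
        exact (continuousOn_weightedKernel_left hV y).comp_continuous
          (f := fun p : ℝ × closedUpper => (p.1, (p.2 : ℂ))) (by fun_prop)
          fun p => ⟨trivial, p.2.2⟩
  have hbd : ∀ (g : ℝ × closedUpper →ᵇ ℂ) (p : ℝ × closedUpper),
      ‖((Real.exp (-(2 * tail V p.1 / ‖(p.2 : ℂ)‖)) : ℝ) : ℂ)
        + ∫ y, weightedKernel V p.1 p.2 y * g (y, p.2)‖ ≤ 1 + ‖g‖ / 2 := by
    intro g p
    refine (norm_add_le _ _).trans (add_le_add ?_ ?_)
    · rw [Complex.norm_real, Real.norm_of_nonneg (Real.exp_pos _).le, Real.exp_le_one_iff]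
      have := tail_nonneg V p.1
      rw [neg_nonpos]; positivity
    · exact norm_integral_weightedKernel_mul_le hV p.1 p.2.2 fun y => g.norm_coe_le_norm _
  let T : (ℝ × closedUpper →ᵇ ℂ) → (ℝ × closedUpper →ᵇ ℂ) := fun g =>
    BoundedContinuousFunction.ofNormedAddCommGroup _ (hcont g) _ (hbd g)
  have hT : ContractingWith (1 / 2) T := by
    refine ⟨by rw [← NNReal.coe_lt_coe]; norm_num, LipschitzWith.of_dist_le_mul fun g g' => ?_⟩
    refine (BoundedContinuousFunction.dist_le (by positivity)).2 fun p => ?_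
    have hgi := integrable_weightedKernel_mul hV p.1 p.2.2 (g := fun y => g (y, p.2))
      (by fun_prop) (fun y => g.norm_coe_le_norm _)
    have hgi' := integrable_weightedKernel_mul hV p.1 p.2.2 (g := fun y => g' (y, p.2))
      (by fun_prop) (fun y => g'.norm_coe_le_norm _)
    have e : T g p - T g' p = ∫ y, weightedKernel V p.1 p.2 y * (g (y, p.2) - g' (y, p.2)) := by
      simp only [T, BoundedContinuousFunction.coe_ofNormedAddCommGroup, mul_sub]
      rw [integral_sub hgi hgi']
      ring
    rw [dist_eq_norm, e]
    refine (norm_integral_weightedKernel_mul_le hV p.1 p.2.2 (C := dist g g') fun y => ?_).trans ?_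
    · rw [← dist_eq_norm]; exact BoundedContinuousFunction.dist_coe_le_dist _
    · push_cast; linarith
  have : Nonempty (ℝ × closedUpper →ᵇ ℂ) := ⟨0⟩
  let g := hT.fixedPoint T
  have hg : T g = g := hT.fixedPoint_isFixedPt
  refine ⟨g, ?_, fun x ζ => ?_⟩
  · have : ‖g‖ ≤ 1 + ‖g‖ / 2 := by
      refine (BoundedContinuousFunction.norm_le (by positivity)).2 fun p => ?_
      conv_lhs => rw [← hg]
      exact hbd g p
    linarith
  · conv_lhs => rw [← hg]
    rfl

/-- Removing the weight from the fixed point restores the inhomogeneous term `1`; the weight itself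
becomes the growth bound. -/
theorem exists_jostAmp (hV : ShortRange V) :
    ∃ f : ℝ → ℂ → ℂ, ContinuousOn (fun p : ℝ × ℂ => f p.1 p.2) (Set.univ ×ˢ closedUpper) ∧
      ∀ ζ ∈ closedUpper, ∀ x, ‖f x ζ‖ ≤ 2 * Real.exp (2 * tail V x / ‖ζ‖) ∧
        f x ζ = 1 + ∫ y, jostKernel ζ (max (y - x) 0) * V y * f y ζ := by
  classical
  obtain ⟨g, hg2, hg⟩ := exists_weighted_fixedPoint hV
  have ht := continuous_tail hV
  refine ⟨fun x ζ => if h : ζ ∈ closedUpper then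
    Real.exp (2 * tail V x / ‖ζ‖) * g (x, ⟨ζ, h⟩) else 0, ?_, ?_⟩
  · rw [continuousOn_iff_continuous_domRestrict]
    have h1 : Continuous fun p : (Set.univ ×ˢ closedUpper : Set (ℝ × ℂ)) =>
        ((Real.exp (2 * tail V p.1.1 / ‖p.1.2‖) : ℝ) : ℂ) * g (p.1.1, ⟨p.1.2, (Set.mem_prod.1 p.2).2⟩) := by
      refine Continuous.mul ?_ ?_
      · refine Complex.continuous_ofReal.comp (Real.continuous_exp.comp ?_)
        exact Continuous.div (by fun_prop) (by fun_prop) fun p =>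
          norm_ne_zero_iff.2 (Set.mem_prod.1 p.2).2.2
      · exact g.continuous.comp (Continuous.prodMk (by fun_prop)
          (Continuous.subtype_mk (by fun_prop) _))
    refine h1.congr fun p => ?_
    have h2 : p.1.2 ∈ closedUpper := (Set.mem_prod.1 p.2).2
    simp only [Set.domRestrict_apply, dif_pos h2]
  · intro ζ hζ x
    simp only [dif_pos hζ]
    constructor
    · rw [norm_mul, Complex.norm_real, Real.norm_of_nonneg (Real.exp_pos _).le, mul_comm]
      exact mul_le_mul_of_nonneg_right ((g.norm_coe_le_norm _).trans hg2) (Real.exp_pos _).le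
    · rw [hg x ⟨ζ, hζ⟩, mul_add, ← integral_const_mul]
      congr 1
      · rw [← Complex.ofReal_mul, ← Real.exp_add, add_neg_cancel]; simp
      · refine integral_congr_ae (Eventually.of_forall fun y => ?_)
        simp only [weightedKernel]
        have : Real.exp (2 * tail V x / ‖ζ‖) * Real.exp (2 * (tail V y - tail V x) / ‖ζ‖)
            = Real.exp (2 * tail V y / ‖ζ‖) := by
          rw [← Real.exp_add]; congr 1; ring
        rw [← this]; push_cast; ring

end Existence

/-! ### Jost solutions -/

section JostSolutions

variable {V : ℝ → ℝ} {ζ : ℂ}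

open Classical in
/-- The amplitude `e^{-iζx} θ₊(x, ζ)` of the Jost solution. -/
def jostAmp (V : ℝ → ℝ) : ℝ → ℂ → ℂ :=
  if h : ShortRange V then (exists_jostAmp h).choose else 0

/-- An upper bound for the Jost amplitude on the whole line. -/
def jostBound (V : ℝ → ℝ) (ζ : ℂ) : ℝ := 2 * Real.exp (2 * (∫ y, |V y|) / ‖ζ‖)

theorem continuousOn_jostAmp (hV : ShortRange V) :
    ContinuousOn (fun p : ℝ × ℂ => jostAmp V p.1 p.2) (Set.univ ×ˢ closedUpper) := by
  rw [jostAmp, dif_pos hV]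
  exact (exists_jostAmp hV).choose_spec.1

theorem continuous_jostAmp_left (hV : ShortRange V) (hζ : ζ ∈ closedUpper) :
    Continuous fun x => jostAmp V x ζ :=
  (continuousOn_jostAmp hV).comp_continuous (f := fun x : ℝ => (x, ζ)) (by fun_prop)
    fun _ => ⟨trivial, hζ⟩

theorem norm_jostAmp_le (hV : ShortRange V) (hζ : ζ ∈ closedUpper) (x : ℝ) :
    ‖jostAmp V x ζ‖ ≤ jostBound V ζ := by
  rw [jostAmp, dif_pos hV]
  refine ((exists_jostAmp hV).choose_spec.2 ζ hζ x).1.trans ?_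
  have := tail_le hV x
  unfold jostBound
  gcongr

theorem jostAmp_eq (hV : ShortRange V) (hζ : ζ ∈ closedUpper) (x : ℝ) :
    jostAmp V x ζ = 1 + ∫ y, jostKernel ζ (max (y - x) 0) * V y * jostAmp V y ζ := by
  rw [jostAmp, dif_pos hV]
  exact ((exists_jostAmp hV).choose_spec.2 ζ hζ x).2

theorem jostAmp_eq_Ioi (hV : ShortRange V) (hζ : ζ ∈ closedUpper) (x : ℝ) :
    jostAmp V x ζ = 1 + ∫ y in Set.Ioi x, jostKernel ζ (y - x) * V y * jostAmp V y ζ := by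
  rw [jostAmp_eq hV hζ]
  congr 1
  rw [← setIntegral_eq_integral_of_forall_compl_eq_zero (s := Set.Ioi x)]
  · refine setIntegral_congr_fun measurableSet_Ioi fun y hy => ?_
    simp only [max_eq_left (sub_nonneg.2 (le_of_lt (Set.mem_Ioi.1 hy)))]
  · intro y hy
    have : y ≤ x := not_lt.1 hy
    rw [max_eq_right (by linarith), jostKernel_zero]; simp

/-- `∫_x^∞ e^{2iζy} V m`. -/
def jostA (V : ℝ → ℝ) (ζ : ℂ) (x : ℝ) : ℂ :=
  ∫ y in Set.Ioi x, Complex.exp (2 * Complex.I * ζ * y) * (V y * jostAmp V y ζ)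

/-- `∫_x^∞ V m`. -/
def jostB (V : ℝ → ℝ) (ζ : ℂ) (x : ℝ) : ℂ := ∫ y in Set.Ioi x, V y * jostAmp V y ζ

/-- The solution `θ₊(·, ζ)` for `ζ` in the closed upper half plane. -/
def jostSol (V : ℝ → ℝ) (ζ : ℂ) (x : ℝ) : ℂ := Complex.exp (Complex.I * ζ * x) * jostAmp V x ζ

/-- The derivative of `θ₊(·, ζ)`. -/
def jostSolDeriv (V : ℝ → ℝ) (ζ : ℂ) (x : ℝ) : ℂ :=
  Complex.I * ζ * Complex.exp (Complex.I * ζ * x)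
    - 1 / 2 * (Complex.exp (-(Complex.I * ζ * x)) * jostA V ζ x
      + Complex.exp (Complex.I * ζ * x) * jostB V ζ x)

theorem norm_V_mul_jostAmp_le (hV : ShortRange V) (hζ : ζ ∈ closedUpper) (y : ℝ) :
    ‖(V y : ℂ) * jostAmp V y ζ‖ ≤ |V y| * jostBound V ζ := by
  rw [norm_mul, Complex.norm_real]
  exact mul_le_mul_of_nonneg_left (norm_jostAmp_le hV hζ y) (abs_nonneg _)

theorem continuous_V_mul_jostAmp (hV : ShortRange V) (hζ : ζ ∈ closedUpper) :
    Continuous fun y => (V y : ℂ) * jostAmp V y ζ := by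
  have := continuous_jostAmp_left hV hζ
  have := hV.cont
  fun_prop

theorem integrable_V_mul_jostAmp (hV : ShortRange V) (hζ : ζ ∈ closedUpper) :
    Integrable fun y => (V y : ℂ) * jostAmp V y ζ :=
  (hV.int.abs.mul_const (jostBound V ζ)).mono'
    (continuous_V_mul_jostAmp hV hζ).aestronglyMeasurable
    (Eventually.of_forall (norm_V_mul_jostAmp_le hV hζ))

theorem norm_exp_I_mul (ζ : ℂ) (x : ℝ) : ‖Complex.exp (Complex.I * ζ * x)‖ = Real.exp (-(ζ.im * x)) := by
  rw [Complex.norm_exp]; simp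

theorem norm_exp_neg_I_mul (ζ : ℂ) (x : ℝ) :
    ‖Complex.exp (-(Complex.I * ζ * x))‖ = Real.exp (ζ.im * x) := by
  rw [Complex.norm_exp]; simp

theorem norm_exp_two_I_mul (ζ : ℂ) (x : ℝ) :
    ‖Complex.exp (2 * Complex.I * ζ * x)‖ = Real.exp (-(2 * ζ.im * x)) := by
  rw [Complex.norm_exp]; simp

theorem norm_jostA_integrand_le (hV : ShortRange V) (hζ : ζ ∈ closedUpper) {x y : ℝ} (h : x ≤ y) :
    ‖Complex.exp (2 * Complex.I * ζ * y) * (V y * jostAmp V y ζ)‖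
      ≤ Real.exp (-(2 * ζ.im * x)) * (|V y| * jostBound V ζ) := by
  rw [norm_mul]
  refine mul_le_mul ?_ (norm_V_mul_jostAmp_le hV hζ y) (norm_nonneg _) (Real.exp_pos _).le
  rw [norm_exp_two_I_mul, Real.exp_le_exp]
  have := mul_le_mul_of_nonneg_left h hζ.1
  linarith

theorem integrableOn_jostA (hV : ShortRange V) (hζ : ζ ∈ closedUpper) (x : ℝ) :
    IntegrableOn (fun y : ℝ => Complex.exp (2 * Complex.I * ζ * y) * (V y * jostAmp V y ζ))
      (Set.Ioi x) := by
  have hc := continuous_V_mul_jostAmp hV hζ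
  refine ((hV.int.abs.mul_const (jostBound V ζ)).const_mul
    (Real.exp (-(2 * ζ.im * x)))).integrableOn.mono'
    (Continuous.aestronglyMeasurable (by fun_prop)) ?_
  exact (ae_restrict_iff' measurableSet_Ioi).2
    (Eventually.of_forall fun y hy => norm_jostA_integrand_le hV hζ (le_of_lt hy))

theorem norm_jostA_le (hV : ShortRange V) (hζ : ζ ∈ closedUpper) (x : ℝ) :
    ‖jostA V ζ x‖ ≤ Real.exp (-(2 * ζ.im * x)) * (tail V x * jostBound V ζ) := by
  have : Real.exp (-(2 * ζ.im * x)) * (tail V x * jostBound V ζ)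
      = ∫ y in Set.Ioi x, Real.exp (-(2 * ζ.im * x)) * (|V y| * jostBound V ζ) := by
    rw [integral_const_mul, integral_mul_const]; rfl
  rw [this]
  refine norm_integral_le_of_norm_le
    ((hV.int.abs.mul_const (jostBound V ζ)).const_mul _).integrableOn ?_
  exact (ae_restrict_iff' measurableSet_Ioi).2
    (Eventually.of_forall fun y hy => norm_jostA_integrand_le hV hζ (le_of_lt hy))

theorem norm_jostB_le (hV : ShortRange V) (hζ : ζ ∈ closedUpper) (x : ℝ) :
    ‖jostB V ζ x‖ ≤ tail V x * jostBound V ζ := by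
  have : tail V x * jostBound V ζ = ∫ y in Set.Ioi x, (|V y| * jostBound V ζ) := by
    rw [integral_mul_const]; rfl
  rw [this]
  exact norm_integral_le_of_norm_le (hV.int.abs.mul_const (jostBound V ζ)).integrableOn
    (Eventually.of_forall (norm_V_mul_jostAmp_le hV hζ))

/-- The modulus `e^{Im ζ x}` of the prefactor is beaten by the factor `e^{-2 Im ζ x}` in the bound
on `jostA`, leaving the rate of `e^{iζx}`. -/
theorem norm_exp_mul_jostA_le (hV : ShortRange V) (hζ : ζ ∈ closedUpper) (x : ℝ) :
    ‖Complex.exp (-(Complex.I * ζ * x)) * jostA V ζ x‖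
      ≤ Real.exp (-(ζ.im * x)) * (tail V x * jostBound V ζ) := by
  rw [norm_mul, norm_exp_neg_I_mul]
  calc _ ≤ Real.exp (ζ.im * x) * (Real.exp (-(2 * ζ.im * x)) * (tail V x * jostBound V ζ)) :=
        mul_le_mul_of_nonneg_left (norm_jostA_le hV hζ x) (Real.exp_pos _).le
    _ = _ := by rw [← mul_assoc, ← Real.exp_add]; congr 2; ring

/-- Splitting the kernel into its two exponentials gives the variation-of-constants form, in which
`x` occurs only in explicit exponentials and in limits of integration, so it can be differentiated
directly. -/
theorem jostSol_eq (hV : ShortRange V) (hζ : ζ ∈ closedUpper) (x : ℝ) :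
    jostSol V ζ x = Complex.exp (Complex.I * ζ * x)
      + (2 * Complex.I * ζ)⁻¹ * (Complex.exp (-(Complex.I * ζ * x)) * jostA V ζ x
        - Complex.exp (Complex.I * ζ * x) * jostB V ζ x) := by
  have h1 : ∀ y : ℝ, jostKernel ζ (y - x) * V y * jostAmp V y ζ
      = (2 * Complex.I * ζ)⁻¹ * (Complex.exp (-(2 * Complex.I * ζ * x)) *
        (Complex.exp (2 * Complex.I * ζ * y) * (V y * jostAmp V y ζ)) - V y * jostAmp V y ζ) := by
    intro y
    have : Complex.exp (2 * Complex.I * ζ * ((y - x : ℝ) : ℂ))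
        = Complex.exp (-(2 * Complex.I * ζ * x)) * Complex.exp (2 * Complex.I * ζ * y) := by
      rw [← Complex.exp_add]; congr 1; push_cast; ring
    rw [jostKernel, this, div_eq_mul_inv]; ring
  have h2 : ∫ y in Set.Ioi x, jostKernel ζ (y - x) * V y * jostAmp V y ζ
      = (2 * Complex.I * ζ)⁻¹ *
        (Complex.exp (-(2 * Complex.I * ζ * x)) * jostA V ζ x - jostB V ζ x) := by
    simp only [h1]
    rw [integral_const_mul, integral_sub ((integrableOn_jostA hV hζ x).const_mul _)
      (integrable_V_mul_jostAmp hV hζ).integrableOn, integral_const_mul]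
    rfl
  rw [jostSol, jostAmp_eq_Ioi hV hζ, h2]
  have h3 : Complex.exp (-(Complex.I * ζ * x))
      = Complex.exp (Complex.I * ζ * x) * Complex.exp (-(2 * Complex.I * ζ * x)) := by
    rw [← Complex.exp_add]; congr 1; ring
  rw [h3]; ring

theorem hasDerivAt_exp_mul_ofReal (c : ℂ) (x : ℝ) :
    HasDerivAt (fun x : ℝ => Complex.exp (c * x)) (c * Complex.exp (c * x)) x := by
  have h := ((hasDerivAt_id (x : ℂ)).const_mul c).cexp.comp_ofReal
  simp only [id] at h
  refine h.congr_deriv ?_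
  ring

/-- A solution `u` of `-u'' + V u = z u`, together with its derivative. -/
structure SolPair (V : ℝ → ℝ) (z : ℂ) (u u' : ℝ → ℂ) : Prop where
  deriv₁ : ∀ x, HasDerivAt u (u' x) x
  deriv₂ : ∀ x, HasDerivAt u' ((V x - z) * u x) x

theorem hasDerivAt_jostA (hV : ShortRange V) (hζ : ζ ∈ closedUpper) (x : ℝ) :
    HasDerivAt (jostA V ζ) (-(Complex.exp (2 * Complex.I * ζ * x) * (V x * jostAmp V x ζ))) x := by
  have hc := continuous_V_mul_jostAmp hV hζ
  exact hasDerivAt_integral_Ioi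
    (g := fun y : ℝ => Complex.exp (2 * Complex.I * ζ * y) * (V y * jostAmp V y ζ))
    (by fun_prop) (fun a => integrableOn_jostA hV hζ a) x

theorem hasDerivAt_jostB (hV : ShortRange V) (hζ : ζ ∈ closedUpper) (x : ℝ) :
    HasDerivAt (jostB V ζ) (-(V x * jostAmp V x ζ)) x :=
  hasDerivAt_integral_Ioi (continuous_V_mul_jostAmp hV hζ)
    (fun _ => (integrable_V_mul_jostAmp hV hζ).integrableOn) x

/-- The endpoint terms of the two integrals cancel in the first derivative and add up to `V θ₊` in
the second. -/
theorem solPair_jostSol (hV : ShortRange V) (hζ : ζ ∈ closedUpper) :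
    SolPair V (ζ ^ 2) (jostSol V ζ) (jostSolDeriv V ζ) := by
  have e1 : ∀ x : ℝ, HasDerivAt (fun x : ℝ => Complex.exp (Complex.I * ζ * x))
      (Complex.I * ζ * Complex.exp (Complex.I * ζ * x)) x := hasDerivAt_exp_mul_ofReal _
  have e2 : ∀ x : ℝ, HasDerivAt (fun x : ℝ => Complex.exp (-(Complex.I * ζ * x)))
      (-(Complex.I * ζ) * Complex.exp (-(Complex.I * ζ * x))) x := by
    intro x
    simpa only [neg_mul] using hasDerivAt_exp_mul_ofReal (-(Complex.I * ζ)) x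
  have hA := hasDerivAt_jostA hV hζ
  have hB := hasDerivAt_jostB hV hζ
  have hne : 2 * Complex.I * ζ ≠ 0 := by simpa using hζ.2
  have hinv : (2 * Complex.I * ζ)⁻¹ * (2 * Complex.I * ζ) = 1 := inv_mul_cancel₀ hne
  have hee : ∀ x : ℝ, Complex.exp (-(Complex.I * ζ * x)) * Complex.exp (2 * Complex.I * ζ * x)
      = Complex.exp (Complex.I * ζ * x) := by
    intro x; rw [← Complex.exp_add]; congr 1; ring
  constructor
  · intro x
    have h0 : jostSol V ζ = fun x : ℝ => Complex.exp (Complex.I * ζ * x)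
        + (2 * Complex.I * ζ)⁻¹ * (Complex.exp (-(Complex.I * ζ * x)) * jostA V ζ x
          - Complex.exp (Complex.I * ζ * x) * jostB V ζ x) := funext (jostSol_eq hV hζ)
    rw [h0]
    refine ((e1 x).add ((((e2 x).mul (hA x)).sub ((e1 x).mul (hB x))).const_mul _)).congr_deriv ?_
    rw [jostSolDeriv]
    linear_combination (-(1 / 2) * (Complex.exp (-(Complex.I * ζ * x)) * jostA V ζ x
        + Complex.exp (Complex.I * ζ * x) * jostB V ζ x)) * hinv
      - (2 * Complex.I * ζ)⁻¹ * (V x * jostAmp V x ζ) * hee x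
  · intro x
    refine (((e1 x).const_mul (Complex.I * ζ)).sub
      ((((e2 x).mul (hA x)).add ((e1 x).mul (hB x))).const_mul (1 / 2))).congr_deriv ?_
    have hs := jostSol_eq hV hζ x
    have hI := Complex.I_mul_I
    have h5 : ζ ^ 2 * (2 * Complex.I * ζ)⁻¹ = -(Complex.I * ζ) / 2 := by
      have := hζ.2
      field_simp
      linear_combination hI
    have h4 : (V x : ℂ) * jostSol V ζ x = V x * (Complex.exp (Complex.I * ζ * x) * jostAmp V x ζ) :=
      rfl
    rw [sub_mul, h4, hs]
    linear_combination (ζ ^ 2 * Complex.exp (Complex.I * ζ * x)) * hI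
      + (1 / 2) * (V x * jostAmp V x ζ) * hee x
      + (Complex.exp (-(Complex.I * ζ * x)) * jostA V ζ x
        - Complex.exp (Complex.I * ζ * x) * jostB V ζ x) * h5

theorem jostBound_pos (V : ℝ → ℝ) (ζ : ℂ) : 0 < jostBound V ζ := by
  unfold jostBound; positivity

theorem norm_jostSol_le (hV : ShortRange V) (hζ : ζ ∈ closedUpper) (x : ℝ) :
    ‖jostSol V ζ x‖ ≤ jostBound V ζ * Real.exp (-(ζ.im * x)) := by
  rw [jostSol, norm_mul, norm_exp_I_mul, mul_comm]
  exact mul_le_mul_of_nonneg_right (norm_jostAmp_le hV hζ x) (Real.exp_pos _).le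

theorem norm_jostSolDeriv_le (hV : ShortRange V) (hζ : ζ ∈ closedUpper) (x : ℝ) :
    ‖jostSolDeriv V ζ x‖
      ≤ (‖ζ‖ + (∫ y, |V y|) * jostBound V ζ) * Real.exp (-(ζ.im * x)) := by
  have ht := mul_le_mul_of_nonneg_right (tail_le hV x) (jostBound_pos V ζ).le
  have hE := (Real.exp_pos (-(ζ.im * x))).le
  have h1 := (norm_exp_mul_jostA_le hV hζ x).trans (mul_le_mul_of_nonneg_left ht hE)
  have h2 : ‖Complex.exp (Complex.I * ζ * x) * jostB V ζ x‖
      ≤ Real.exp (-(ζ.im * x)) * ((∫ y, |V y|) * jostBound V ζ) := by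
    rw [norm_mul, norm_exp_I_mul]
    exact mul_le_mul_of_nonneg_left ((norm_jostB_le hV hζ x).trans ht) hE
  have h3 : ‖Complex.I * ζ * Complex.exp (Complex.I * ζ * x)‖ = ‖ζ‖ * Real.exp (-(ζ.im * x)) := by
    rw [norm_mul, norm_exp_I_mul, norm_mul, Complex.norm_I, one_mul]
  refine (norm_sub_le _ _).trans ?_
  rw [h3, norm_mul]
  have h4 := norm_add_le (Complex.exp (-(Complex.I * ζ * x)) * jostA V ζ x)
    (Complex.exp (Complex.I * ζ * x) * jostB V ζ x)
  have : ‖(1 / 2 : ℂ)‖ = 1 / 2 := by norm_num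
  rw [this]
  linarith

theorem tendsto_jostB (hV : ShortRange V) (hζ : ζ ∈ closedUpper) :
    Tendsto (jostB V ζ) atTop (𝓝 0) := by
  refine squeeze_zero_norm (norm_jostB_le hV hζ) ?_
  simpa using (tendsto_tail V).mul_const (jostBound V ζ)

theorem tendsto_exp_mul_jostA (hV : ShortRange V) (hζ : ζ ∈ closedUpper) :
    Tendsto (fun x : ℝ => Complex.exp (-(2 * Complex.I * ζ * x)) * jostA V ζ x) atTop (𝓝 0) := by
  refine squeeze_zero_norm (a := fun x => tail V x * jostBound V ζ) (fun x => ?_) ?_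
  · rw [norm_mul]
    have : ‖Complex.exp (-(2 * Complex.I * ζ * x))‖ = Real.exp (2 * ζ.im * x) := by
      rw [Complex.norm_exp]; simp
    rw [this]
    calc _ ≤ Real.exp (2 * ζ.im * x) * (Real.exp (-(2 * ζ.im * x)) * (tail V x * jostBound V ζ)) :=
          mul_le_mul_of_nonneg_left (norm_jostA_le hV hζ x) (Real.exp_pos _).le
      _ = _ := by rw [← mul_assoc, ← Real.exp_add]; simp
  · simpa using (tendsto_tail V).mul_const (jostBound V ζ)

theorem tendsto_jostSol_div (hV : ShortRange V) (hζ : ζ ∈ closedUpper) :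
    Tendsto (fun x : ℝ => jostSol V ζ x / Complex.exp (Complex.I * ζ * x)) atTop (𝓝 1) := by
  have h : ∀ x : ℝ, jostSol V ζ x / Complex.exp (Complex.I * ζ * x) = 1 + (2 * Complex.I * ζ)⁻¹ *
      (Complex.exp (-(2 * Complex.I * ζ * x)) * jostA V ζ x - jostB V ζ x) := by
    intro x
    rw [jostSol_eq hV hζ, div_eq_iff (Complex.exp_ne_zero _)]
    have h3 : Complex.exp (-(Complex.I * ζ * x))
        = Complex.exp (Complex.I * ζ * x) * Complex.exp (-(2 * Complex.I * ζ * x)) := by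
      rw [← Complex.exp_add]; congr 1; ring
    rw [h3]; ring
  simp only [h]
  simpa using (((tendsto_exp_mul_jostA hV hζ).sub (tendsto_jostB hV hζ)).const_mul
    ((2 * Complex.I * ζ)⁻¹)).const_add 1

theorem tendsto_jostSolDeriv_div (hV : ShortRange V) (hζ : ζ ∈ closedUpper) :
    Tendsto (fun x : ℝ => jostSolDeriv V ζ x / (Complex.I * ζ * Complex.exp (Complex.I * ζ * x)))
      atTop (𝓝 1) := by
  have hne : Complex.I * ζ ≠ 0 := by simpa using hζ.2
  have h : ∀ x : ℝ, jostSolDeriv V ζ x / (Complex.I * ζ * Complex.exp (Complex.I * ζ * x))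
      = 1 - (Complex.I * ζ)⁻¹ / 2 *
      (Complex.exp (-(2 * Complex.I * ζ * x)) * jostA V ζ x + jostB V ζ x) := by
    intro x
    rw [jostSolDeriv, div_eq_iff (mul_ne_zero hne (Complex.exp_ne_zero _))]
    have h3 : Complex.exp (-(Complex.I * ζ * x))
        = Complex.exp (Complex.I * ζ * x) * Complex.exp (-(2 * Complex.I * ζ * x)) := by
      rw [← Complex.exp_add]; congr 1; ring
    have hinv := inv_mul_cancel₀ hne
    rw [h3]
    linear_combination (1 / 2 * Complex.exp (Complex.I * ζ * x)
      * (Complex.exp (-(2 * Complex.I * ζ * x)) * jostA V ζ x + jostB V ζ x)) * hinv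
  simp only [h]
  simpa using (((tendsto_exp_mul_jostA hV hζ).add (tendsto_jostB hV hζ)).const_mul
    ((Complex.I * ζ)⁻¹ / 2)).const_sub 1

/-! ### Pairs of solutions and their Wronskians -/

namespace SolPair

variable {z : ℂ} {u u' v v' : ℝ → ℂ}

theorem continuous (h : SolPair V z u u') : Continuous u :=
  continuous_iff_continuousAt.2 fun x => (h.deriv₁ x).continuousAt

theorem continuous' (h : SolPair V z u u') : Continuous u' :=
  continuous_iff_continuousAt.2 fun x => (h.deriv₂ x).continuousAt

theorem deriv_eq (h : SolPair V z u u') : deriv u = u' := funext fun x => (h.deriv₁ x).deriv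

theorem conjugate (h : SolPair V z u u') :
    SolPair V (conj z) (fun x => conj (u x)) (fun x => conj (u' x)) where
  deriv₁ x := (h.deriv₁ x).star
  deriv₂ x := by
    refine (h.deriv₂ x).star.congr_deriv ?_
    simp

theorem reflect (h : SolPair (fun x => V (-x)) z u u') :
    SolPair V z (fun x => u (-x)) (fun x => -u' (-x)) where
  deriv₁ x := by
    refine ((h.deriv₁ (-x)).scomp x (hasDerivAt_neg x)).congr_deriv ?_
    simp
  deriv₂ x := by
    refine ((h.deriv₂ (-x)).scomp x (hasDerivAt_neg x)).neg.congr_deriv ?_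
    simp

theorem sub (h : SolPair V z u u') (h₂ : SolPair V z v v') :
    SolPair V z (fun x => u x - v x) (fun x => u' x - v' x) where
  deriv₁ x := (h.deriv₁ x).sub (h₂.deriv₁ x)
  deriv₂ x := ((h.deriv₂ x).sub (h₂.deriv₂ x)).congr_deriv (by ring)

theorem const_mul (h : SolPair V z u u') (c : ℂ) :
    SolPair V z (fun x => c * u x) (fun x => c * u' x) where
  deriv₁ x := (h.deriv₁ x).const_mul c
  deriv₂ x := ((h.deriv₂ x).const_mul c).congr_deriv (by ring)

theorem wronskian_eq (h : SolPair V z u u') (h₂ : SolPair V z v v') (x y : ℝ) :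
    u' x * v x - u x * v' x = u' y * v y - u y * v' y := by
  have hd : ∀ x, HasDerivAt (fun x => u' x * v x - u x * v' x) 0 x := by
    intro x
    refine (((h.deriv₂ x).mul (h₂.deriv₁ x)).sub ((h.deriv₁ x).mul (h₂.deriv₂ x))).congr_deriv ?_
    ring
  exact is_const_of_deriv_eq_zero (fun x => (hd x).differentiableAt) (fun x => (hd x).deriv) x y

/-- Being constant, a Wronskian can be evaluated from asymptotics at either end of the line. -/
theorem wronskian_eq_of_tendsto (h : SolPair V z u u') (h₂ : SolPair V z v v') {l : Filter ℝ}
    [l.NeBot] {c : ℂ} (hl : Tendsto (fun x => u' x * v x - u x * v' x) l (𝓝 c)) (x : ℝ) :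
    u' x * v x - u x * v' x = c := by
  refine tendsto_nhds_unique (tendsto_const_nhds.congr fun y => ?_) hl
  exact h.wronskian_eq h₂ x y

theorem contDiff (hV : Continuous V) (h : SolPair V z u u') : ContDiff ℝ 2 u := by
  have h1 : ContDiff ℝ 1 u' := by
    rw [contDiff_one_iff_deriv]
    refine ⟨fun x => (h.deriv₂ x).differentiableAt, ?_⟩
    have : deriv u' = fun x => (V x - z) * u x := funext fun x => (h.deriv₂ x).deriv
    rw [this]
    have := h.continuous
    fun_prop
  have : (2 : WithTop ℕ∞) = 1 + 1 := by norm_num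
  rw [this, contDiff_succ_iff_deriv, h.deriv_eq]
  exact ⟨fun x => (h.deriv₁ x).differentiableAt, by simp, h1⟩

theorem solves (hV : Continuous V) (h : SolPair V (ζ ^ 2) u u') : SolvesSchrodinger V ζ u := by
  refine ⟨h.contDiff hV, fun x => ?_⟩
  rw [h.deriv_eq, (h.deriv₂ x).deriv]
  ring

end SolPair

theorem SolvesSchrodinger.solPair {u : ℝ → ℂ} (h : SolvesSchrodinger V ζ u) :
    SolPair V (ζ ^ 2) u (deriv u) := by
  have h1 : ContDiff ℝ (1 + 1) u := by
    have : (1 + 1 : WithTop ℕ∞) = 2 := by norm_num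
    rw [this]; exact h.1
  rw [contDiff_succ_iff_deriv] at h1
  refine ⟨fun x => (h1.1 x).hasDerivAt, fun x => ?_⟩
  have h2 := ((contDiff_one_iff_deriv.1 h1.2.2).1 x).hasDerivAt
  refine h2.congr_deriv ?_
  linear_combination -(h.2 x)

theorem isJostPlus_jostSol (hV : ShortRange V) (hζ : ζ ∈ closedUpper) :
    IsJostPlus V ζ (jostSol V ζ) := by
  have h := solPair_jostSol hV hζ
  refine ⟨h.solves hV.cont, tendsto_jostSol_div hV hζ, ?_⟩
  rw [h.deriv_eq]
  exact tendsto_jostSolDeriv_div hV hζ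

theorem ofReal_mem_closedUpper {k : ℝ} (hk : k ≠ 0) : (k : ℂ) ∈ closedUpper :=
  ⟨by simp, by exact_mod_cast hk⟩

theorem norm_exp_I_mul_real (k x : ℝ) : ‖Complex.exp (Complex.I * k * x)‖ = 1 := by
  rw [norm_exp_I_mul]; simp

theorem tendsto_zero_of_div_exp {k : ℝ} {l : Filter ℝ} {u : ℝ → ℂ}
    (h : Tendsto (fun x : ℝ => u x / Complex.exp (Complex.I * k * x)) l (𝓝 0)) :
    Tendsto u l (𝓝 0) := by
  rw [tendsto_zero_iff_norm_tendsto_zero] at h ⊢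
  simpa [norm_div, norm_exp_I_mul_real] using h

theorem conj_exp_I_mul_real (k x : ℝ) :
    Complex.exp (Complex.I * k * x) * conj (Complex.exp (Complex.I * k * x)) = 1 := by
  rw [Complex.mul_conj, Complex.normSq_eq_norm_sq, norm_exp_I_mul_real]; simp

theorem wronskian_conj_of_tendsto {k : ℝ} (hk : k ≠ 0) {u u' : ℝ → ℂ} {l : Filter ℝ}
    (h1 : Tendsto (fun x : ℝ => u x / Complex.exp (Complex.I * k * x)) l (𝓝 1))
    (h2 : Tendsto (fun x : ℝ => u' x / (Complex.I * k * Complex.exp (Complex.I * k * x))) l (𝓝 1)) :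
    Tendsto (fun x => u' x * conj (u x) - u x * conj (u' x)) l (𝓝 (2 * Complex.I * k)) := by
  have hk' : (k : ℂ) ≠ 0 := by exact_mod_cast hk
  have c1 := (Complex.continuous_conj.tendsto _).comp h1
  have c2 := (Complex.continuous_conj.tendsto _).comp h2
  have h := ((h2.mul c1).const_mul (Complex.I * k)).add ((h1.mul c2).const_mul (Complex.I * k))
  have e : Complex.I * k * (1 * conj (1 : ℂ)) + Complex.I * k * (1 * conj (1 : ℂ))
      = 2 * Complex.I * k := by simp; ring
  rw [e] at h
  refine h.congr fun x => ?_
  have hE := conj_exp_I_mul_real k x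
  have hI := Complex.I_mul_I
  simp only [Function.comp, map_div₀, map_mul, Complex.conj_I, Complex.conj_ofReal]
  set E := Complex.exp (Complex.I * k * x)
  have hE0 : E ≠ 0 := Complex.exp_ne_zero _
  have hE1 : conj E ≠ 0 := (map_ne_zero _).2 hE0
  have hIne := Complex.I_ne_zero
  have hb : conj E = E⁻¹ := eq_inv_of_mul_eq_one_right hE
  rw [hb]
  field_simp
  ring

/-- For real `k` the conjugate solves the same equation, so the Wronskian is constant and equal to
its limit at `+∞`. -/
theorem jostSol_wronskian_conj (hV : ShortRange V) {k : ℝ} (hk : k ≠ 0) (x : ℝ) :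
    jostSolDeriv V k x * conj (jostSol V k x) - jostSol V k x * conj (jostSolDeriv V k x)
      = 2 * Complex.I * k := by
  have hζ := ofReal_mem_closedUpper hk
  have h := solPair_jostSol hV hζ
  have hc := h.conjugate
  have e : conj ((k : ℂ) ^ 2) = (k : ℂ) ^ 2 := by simp
  rw [e] at hc
  exact h.wronskian_eq_of_tendsto hc
    (wronskian_conj_of_tendsto hk (tendsto_jostSol_div hV hζ) (tendsto_jostSolDeriv_div hV hζ)) x

/-- The difference of two candidates tends to `0` with its derivative, so its Wronskians with the
bounded solutions `θ₊` and `conj θ₊` vanish. These two are independent, hence the difference is `0`.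
-/
theorem eq_jostSol_of_isJostPlus (hV : ShortRange V) {k : ℝ} (hk : k ≠ 0) {θ : ℝ → ℂ}
    (hθ : IsJostPlus V k θ) : θ = jostSol V k := by
  have hζ := ofReal_mem_closedUpper hk
  have hk' : (k : ℂ) ≠ 0 := hζ.2
  have hs := solPair_jostSol hV hζ
  have hsc := hs.conjugate
  have e : conj ((k : ℂ) ^ 2) = (k : ℂ) ^ 2 := by simp
  rw [e] at hsc
  have hu := hθ.1.solPair.sub hs
  have h0 : Tendsto (fun x => θ x - jostSol V k x) atTop (𝓝 0) := by
    refine tendsto_zero_of_div_exp (k := k) ?_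
    have := hθ.2.1.sub (tendsto_jostSol_div hV hζ)
    simp only [← sub_div, sub_self] at this
    exact this
  have h0' : Tendsto (fun x => deriv θ x - jostSolDeriv V k x) atTop (𝓝 0) := by
    refine tendsto_zero_of_div_exp (k := k) ?_
    have := (hθ.2.2.sub (tendsto_jostSolDeriv_div hV hζ)).const_mul (Complex.I * k)
    simp only [← sub_div, sub_self, mul_zero] at this
    refine this.congr fun x => ?_
    have := Complex.exp_ne_zero (Complex.I * k * x)
    have := Complex.I_ne_zero
    field_simp
  have b1 : ∀ x, ‖jostSol V k x‖ ≤ jostBound V k := fun x => by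
    simpa using norm_jostSol_le hV hζ x
  have b2 : ∀ x, ‖jostSolDeriv V k x‖ ≤ ‖(k : ℂ)‖ + (∫ y, |V y|) * jostBound V k := fun x => by
    simpa using norm_jostSolDeriv_le hV hζ x
  have bdd : ∀ (f : ℝ → ℂ) (C : ℝ), (∀ x, ‖f x‖ ≤ C) →
      IsBoundedUnder (· ≤ ·) atTop fun x => ‖f x‖ := fun f C h => isBoundedUnder_of ⟨C, h⟩
  have w1 : ∀ x, (deriv θ x - jostSolDeriv V k x) * jostSol V k x
      - (θ x - jostSol V k x) * jostSolDeriv V k x = 0 := by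
    refine hu.wronskian_eq_of_tendsto hs (l := atTop) ?_
    simpa using (h0'.zero_mul_isBoundedUnder_le (bdd _ _ b1)).sub
      (h0.zero_mul_isBoundedUnder_le (bdd _ _ b2))
  have w2 : ∀ x, (deriv θ x - jostSolDeriv V k x) * conj (jostSol V k x)
      - (θ x - jostSol V k x) * conj (jostSolDeriv V k x) = 0 := by
    refine hu.wronskian_eq_of_tendsto hsc (l := atTop) ?_
    simpa using (h0'.zero_mul_isBoundedUnder_le
        (bdd (fun x => conj (jostSol V k x)) _ fun x => by rw [RCLike.norm_conj]; exact b1 x)).sub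
      (h0.zero_mul_isBoundedUnder_le
        (bdd (fun x => conj (jostSolDeriv V k x)) _ fun x => by rw [RCLike.norm_conj]; exact b2 x))
  ext x
  have hw := jostSol_wronskian_conj hV hk x
  have : (2 * Complex.I * k) * (θ x - jostSol V k x) = 0 := by
    rw [← hw]
    linear_combination jostSol V k x * w2 x - conj (jostSol V k x) * w1 x
  rcases mul_eq_zero.1 this with h | h
  · simp [hk] at h
  · exact sub_eq_zero.1 h

/-- Reflection `x ↦ -x` exchanges the two ends of the line; every fact on `θ₋` is deduced from one
on `θ₊` for the reflected potential. -/
theorem isJostMinus_iff {θ : ℝ → ℂ} :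
    IsJostMinus V ζ θ ↔ IsJostPlus (fun x => V (-x)) ζ fun x => θ (-x) := by
  have hd : ∀ x, deriv (fun x => θ (-x)) x = -deriv θ (-x) := fun x => deriv_comp_neg θ x
  have hs : SolvesSchrodinger V ζ θ ↔ SolvesSchrodinger (fun x => V (-x)) ζ fun x => θ (-x) := by
    constructor
    · intro h
      have h1 : SolPair (fun x => V (-(-x))) (ζ ^ 2) θ (deriv θ) := by simpa using h.solPair
      have h2 := h1.reflect (V := fun x => V (-x))
      refine ⟨h.1.comp contDiff_neg, fun x => ?_⟩
      rw [h2.deriv_eq, (h2.deriv₂ x).deriv]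
      ring
    · intro h
      have h2 := h.solPair.reflect (V := V)
      simp only [neg_neg] at h2
      refine ⟨by simpa [Function.comp_def] using h.1.comp (contDiff_neg (F := ℝ)), fun x => ?_⟩
      have : deriv θ = _ := h2.deriv_eq
      rw [this, (h2.deriv₂ x).deriv]
      ring
  have key : ∀ g : ℝ → ℂ, Tendsto g atBot (𝓝 1) ↔ Tendsto (fun x => g (-x)) atTop (𝓝 1) := by
    intro g
    constructor
    · intro h; exact h.comp tendsto_neg_atTop_atBot
    · intro h; simpa [Function.comp_def] using h.comp tendsto_neg_atBot_atTop
  unfold IsJostMinus IsJostPlus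
  rw [hs, key, key]
  simp only [hd, Complex.ofReal_neg, mul_neg, neg_neg, neg_mul, div_neg, neg_div]

/-- The solution `θ₋(·, ζ)` for `ζ` in the closed upper half plane. -/
def jostSolM (V : ℝ → ℝ) (ζ : ℂ) (x : ℝ) : ℂ := jostSol (fun x => V (-x)) ζ (-x)

/-- The derivative of `θ₋(·, ζ)`. -/
def jostSolMDeriv (V : ℝ → ℝ) (ζ : ℂ) (x : ℝ) : ℂ := -jostSolDeriv (fun x => V (-x)) ζ (-x)

theorem solPair_jostSolM (hV : ShortRange V) (hζ : ζ ∈ closedUpper) :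
    SolPair V (ζ ^ 2) (jostSolM V ζ) (jostSolMDeriv V ζ) :=
  (solPair_jostSol hV.comp_neg hζ).reflect

theorem isJostMinus_jostSolM (hV : ShortRange V) (hζ : ζ ∈ closedUpper) :
    IsJostMinus V ζ (jostSolM V ζ) := by
  rw [isJostMinus_iff]
  simpa [jostSolM] using isJostPlus_jostSol hV.comp_neg hζ

theorem eq_jostSolM_of_isJostMinus (hV : ShortRange V) {k : ℝ} (hk : k ≠ 0) {θ : ℝ → ℂ}
    (hθ : IsJostMinus V k θ) : θ = jostSolM V k := by
  have h := eq_jostSol_of_isJostPlus hV.comp_neg hk (isJostMinus_iff.1 hθ)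
  ext x
  simpa [jostSolM] using congrFun h (-x)

theorem jostPlus_eq (hV : ShortRange V) {k : ℝ} (hk : k ≠ 0) : jostPlus V k = jostSol V k := by
  have h : ∃ θ, IsJostPlus V k θ := ⟨_, isJostPlus_jostSol hV (ofReal_mem_closedUpper hk)⟩
  rw [jostPlus, dif_pos h]
  exact eq_jostSol_of_isJostPlus hV hk h.choose_spec

theorem jostMinus_eq (hV : ShortRange V) {k : ℝ} (hk : k ≠ 0) : jostMinus V k = jostSolM V k := by
  have h : ∃ θ, IsJostMinus V k θ := ⟨_, isJostMinus_jostSolM hV (ofReal_mem_closedUpper hk)⟩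
  rw [jostMinus, dif_pos h]
  exact eq_jostSolM_of_isJostMinus hV hk h.choose_spec

theorem jostSolM_wronskian_conj (hV : ShortRange V) {k : ℝ} (hk : k ≠ 0) (x : ℝ) :
    jostSolMDeriv V k x * conj (jostSolM V k x) - jostSolM V k x * conj (jostSolMDeriv V k x)
      = -(2 * Complex.I * k) := by
  have := jostSol_wronskian_conj hV.comp_neg hk (-x)
  simp only [jostSolM, jostSolMDeriv, map_neg]
  linear_combination -this

/-! ### The Wronskian on the real axis -/

/-- The Wronskian of `θ₊(·, ζ)` and `θ₋(·, ζ)`. -/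
def jw (V : ℝ → ℝ) (ζ : ℂ) : ℂ :=
  jostSolDeriv V ζ 0 * jostSolM V ζ 0 - jostSol V ζ 0 * jostSolMDeriv V ζ 0

theorem jw_eq (hV : ShortRange V) (hζ : ζ ∈ closedUpper) (x : ℝ) :
    jostSolDeriv V ζ x * jostSolM V ζ x - jostSol V ζ x * jostSolMDeriv V ζ x = jw V ζ :=
  (solPair_jostSol hV hζ).wronskian_eq (solPair_jostSolM hV hζ) x 0

theorem jostW_eq (hV : ShortRange V) {k : ℝ} (hk : k ≠ 0) : jostW V k = jw V k := by
  have hζ := ofReal_mem_closedUpper hk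
  rw [jostW, wronskianAt, jostPlus_eq hV hk, jostMinus_eq hV hk, (solPair_jostSol hV hζ).deriv_eq,
    (solPair_jostSolM hV hζ).deriv_eq, jw]

/-- `|w(k)|² = 4k² + |W(θ₊, conj θ₋)|²`. -/
theorem normSq_jw (hV : ShortRange V) {k : ℝ} (hk : k ≠ 0) (x : ℝ) :
    ‖jw V k‖ ^ 2 = 4 * k ^ 2 + ‖jostSolDeriv V k x * conj (jostSolM V k x)
      - jostSol V k x * conj (jostSolMDeriv V k x)‖ ^ 2 := by
  have hp := jostSol_wronskian_conj hV hk x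
  have hm := jostSolM_wronskian_conj hV hk x
  rw [← jw_eq hV (ofReal_mem_closedUpper hk) x]
  apply Complex.ofReal_injective
  push_cast
  rw [← Complex.mul_conj', ← Complex.mul_conj']
  simp only [map_sub, map_mul, Complex.conj_conj]
  have hI := Complex.I_mul_I
  -- The Plücker relation for the four solutions `θ₊, θ₋` and their conjugates: `|w|² - |R|² = W(θ₊,
  -- conj θ₊) W(θ₋, conj θ₋) = (2ik)(-2ik) = 4k²`.
  linear_combination (jostSolMDeriv V k x * conj (jostSolM V k x)
    - jostSolM V k x * conj (jostSolMDeriv V k x)) * hp + (2 * Complex.I * k) * hm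
    - 4 * (k : ℂ) ^ 2 * hI

/-- Equivalently, the transmission coefficient `2ik/w` has modulus at most `1`. -/
theorem two_mul_abs_le_norm_jw (hV : ShortRange V) {k : ℝ} (hk : k ≠ 0) : 2 * |k| ≤ ‖jw V k‖ := by
  have h := normSq_jw hV hk 0
  refine abs_le_of_sq_le_sq' ?_ (norm_nonneg _) |>.2
  rw [h, mul_pow, sq_abs]
  nlinarith [sq_nonneg ‖jostSolDeriv V k 0 * conj (jostSolM V k 0)
      - jostSol V k 0 * conj (jostSolMDeriv V k 0)‖]

theorem jw_ofReal_ne_zero (hV : ShortRange V) {k : ℝ} (hk : k ≠ 0) : jw V k ≠ 0 := by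
  have h := two_mul_abs_le_norm_jw hV hk
  have : 0 < |k| := abs_pos.2 hk
  exact norm_pos_iff.1 (by linarith)

end JostSolutions

/-! ### Bounds uniform in the energy -/

section Bounds

/-- Only the estimate with `j = 0` enters; `x V(x) = O(⟨x⟩^{1-μ})` is integrable because `μ > 2`. -/
theorem shortRange_of_isSymbol {V : ℝ → ℝ} {μ : ℝ} (hμ : 2 < μ) (hV : IsSymbol (-μ) V) :
    ShortRange V := by
  obtain ⟨C, hC⟩ := hV.2 0
  have hc : Continuous V := hV.1.continuous
  have hC' : ∀ x, |V x| ≤ C * (1 + ‖x‖ ^ 2) ^ (-μ / 2) := by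
    intro x
    have h := hC x
    simp only [iteratedDeriv_zero, Nat.cast_zero, sub_zero] at h
    rw [Real.sqrt_eq_rpow, ← Real.rpow_mul (by positivity)] at h
    rw [Real.norm_eq_abs, sq_abs]
    refine h.trans (le_of_eq ?_)
    congr 2; ring
  have hC0 : 0 ≤ C := by
    have := (abs_nonneg _).trans (hC' 0)
    simpa using this
  refine ⟨hc, ?_, ?_, C, fun x => ?_⟩
  · refine ((integrable_rpow_neg_one_add_norm_sq (μ := volume) (E := ℝ) (r := μ) ?_).const_mul C).mono'
      hc.aestronglyMeasurable (Eventually.of_forall hC')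
    simp; linarith
  · refine ((integrable_rpow_neg_one_add_norm_sq (μ := volume) (E := ℝ) (r := μ - 1)
      ?_).const_mul C).mono' (by fun_prop) (Eventually.of_forall fun x => ?_)
    · simp; linarith
    · have h1 : |x| ≤ (1 + ‖x‖ ^ 2) ^ (1 / 2 : ℝ) := by
        rw [← Real.sqrt_eq_rpow, Real.norm_eq_abs, sq_abs]
        exact Real.abs_le_sqrt (by linarith)
      rw [Real.norm_eq_abs, abs_mul]
      calc |x| * |V x| ≤ (1 + ‖x‖ ^ 2) ^ (1 / 2 : ℝ) * (C * (1 + ‖x‖ ^ 2) ^ (-μ / 2)) :=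
            mul_le_mul h1 (hC' x) (abs_nonneg _) (by positivity)
        _ = C * ((1 + ‖x‖ ^ 2) ^ (1 / 2 : ℝ) * (1 + ‖x‖ ^ 2) ^ (-μ / 2)) := by ring
        _ = _ := by
          rw [← Real.rpow_add (by positivity)]
          congr 2; ring
  · refine (hC' x).trans (mul_le_of_le_one_right hC0 ?_)
    refine Real.rpow_le_one_of_one_le_of_nonpos ?_ (by linarith)
    have := sq_nonneg ‖x‖
    linarith

variable {V : ℝ → ℝ}

/-- The Jost solutions are bounded on the half line, uniformly in the energy. -/
theorem exists_jostSol_bound (hV : ShortRange V) :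
    ∃ B : ℝ, 0 ≤ B ∧ ∀ k : ℝ, k ≠ 0 → ∀ x, 0 ≤ x → ‖jostSol V k x‖ ≤ B := by
  have hqi : Integrable fun y => |y| * |V y| := by
    simpa [abs_mul] using hV.moment.abs
  have hqc : Continuous fun y => |y| * |V y| := by have := hV.cont; fun_prop
  refine ⟨2 * Real.exp (2 * ∫ y, |y| * |V y|), by positivity, fun k hk x hx => ?_⟩
  have hζ := ofReal_mem_closedUpper hk
  have hmc := continuous_jostAmp_left hV hζ
  -- For `0 ≤ x < y` the kernel is at most `y - x ≤ |y|`, so Gronwall applies with `q = |y| |V y|`.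
  -- The bound that blows up as `k → 0` is used only as the qualitative bound required there.
  have h1 : ‖jostAmp V x k‖ ≤ 2 * Real.exp (2 * ∫ s in Set.Ioi x, |s| * |V s|) := by
    refine le_exp_of_le_integral_Ioi (q := fun y => |y| * |V y|) (f := fun x => ‖jostAmp V x k‖)
      hqc hqi (fun y => by positivity) (fun y => norm_nonneg _)
      hmc.norm (norm_jostAmp_le hV hζ) (a := 0) (fun x hx => ?_) x hx
    conv_lhs => rw [jostAmp_eq_Ioi hV hζ]
    refine (norm_add_le _ _).trans ?_
    rw [norm_one]
    refine add_le_add le_rfl (norm_integral_le_of_norm_le ?_ ?_)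
    · exact (hqi.mul_bdd hmc.norm.aestronglyMeasurable (Eventually.of_forall fun y => by
        rw [norm_norm]; exact norm_jostAmp_le hV hζ y)).integrableOn
    · refine (ae_restrict_iff' measurableSet_Ioi).2 (Eventually.of_forall fun y hy => ?_)
      have hy' : x < y := hy
      rw [norm_mul, norm_mul, Complex.norm_real, Real.norm_eq_abs]
      refine mul_le_mul_of_nonneg_right (mul_le_mul_of_nonneg_right ?_ (abs_nonneg _)) (norm_nonneg _)
      refine (norm_jostKernel_ofReal_le hk (by linarith)).trans ?_
      rw [abs_of_nonneg (by linarith)]; linarith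
  rw [jostSol, norm_mul, norm_exp_I_mul_real, one_mul]
  refine h1.trans ?_
  have : ∫ s in Set.Ioi x, |s| * |V s| ≤ ∫ s, |s| * |V s| :=
    setIntegral_le_integral hqi (Eventually.of_forall fun y => by positivity)
  gcongr

/-- `m(k)⁻¹ θ₊(x, k)` and `m(k)⁻¹ θ₋(x, k)` are bounded, uniformly in `x` and `k`. -/
theorem exists_scattering_bound (hV : ShortRange V) :
    ∃ B : ℝ, 0 ≤ B ∧ ∀ k : ℝ, k ≠ 0 → ∀ x,
      ‖2 * Complex.I * k / jw V k * jostSol V k x‖ ≤ B ∧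
      ‖2 * Complex.I * k / jw V k * jostSolM V k x‖ ≤ B := by
  obtain ⟨B₁, h₁, hB₁⟩ := exists_jostSol_bound hV
  obtain ⟨B₂, h₂, hB₂⟩ := exists_jostSol_bound hV.comp_neg
  refine ⟨2 * (B₁ + B₂), by positivity, fun k hk x => ?_⟩
  have hw := two_mul_abs_le_norm_jw hV hk
  have hw0 : 0 < ‖jw V k‖ := norm_pos_iff.2 (jw_ofReal_ne_zero hV hk)
  have hsq := normSq_jw hV hk x
  set R := jostSolDeriv V k x * conj (jostSolM V k x)
    - jostSol V k x * conj (jostSolMDeriv V k x) with hR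
  have hRle : ‖R‖ ≤ ‖jw V k‖ := by
    refine abs_le_of_sq_le_sq' ?_ (norm_nonneg _) |>.2
    nlinarith [sq_nonneg k]
  have hn : ‖2 * Complex.I * (k : ℂ)‖ = 2 * |k| := by simp
  have hp := jostSol_wronskian_conj hV hk x
  have hm := jostSolM_wronskian_conj hV hk x
  have hj := jw_eq hV (ofReal_mem_closedUpper hk) x
  have hT : ‖2 * Complex.I * (k : ℂ) / jw V k‖ ≤ 1 := by
    rw [norm_div, hn]; exact (div_le_one hw0).2 hw
  -- On the half line where a Jost solution is not controlled directly, it is expanded in the other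
  -- one and its conjugate, with coefficients `w` and `R` (or `conj R`). Since `|R| ≤ |w|`, division
  -- by `w` costs at most a factor `2`.
  have key : ∀ (a b c : ℂ), ‖b‖ = ‖c‖ → 2 * Complex.I * k * a = jw V k * c - R * b ∨
      2 * Complex.I * k * a = jw V k * c - conj R * b →
      ‖2 * Complex.I * k / jw V k * a‖ ≤ 2 * ‖b‖ := by
    intro a b c hbc h
    rw [div_mul_eq_mul_div, norm_div, div_le_iff₀ hw0]
    have hb := mul_le_mul_of_nonneg_right hRle (norm_nonneg b)
    rcases h with h | h
    · rw [h]
      refine (norm_sub_le _ _).trans ?_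
      rw [norm_mul, norm_mul, ← hbc]; linarith
    · rw [h]
      refine (norm_sub_le _ _).trans ?_
      rw [norm_mul, norm_mul, RCLike.norm_conj, ← hbc]; linarith
  constructor
  · rcases le_total 0 x with hx | hx
    · rw [norm_mul]
      have := mul_le_mul hT (hB₁ k hk x hx) (norm_nonneg _) zero_le_one
      linarith
    · have hb : ‖jostSolM V k x‖ ≤ B₂ := hB₂ k hk (-x) (by linarith)
      have := key (jostSol V k x) (jostSolM V k x) (conj (jostSolM V k x))
        (by rw [RCLike.norm_conj]) ?_
      · linarith
      · left
        rw [hR, ← hj]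
        linear_combination jostSol V k x * hm
  · rcases le_total 0 x with hx | hx
    · have hb : ‖jostSol V k x‖ ≤ B₁ := hB₁ k hk x hx
      have := key (jostSolM V k x) (jostSol V k x) (conj (jostSol V k x))
        (by rw [RCLike.norm_conj]) ?_
      · linarith
      · right
        rw [hR, ← hj]
        simp only [map_sub, map_mul, Complex.conj_conj]
        linear_combination (-jostSolM V k x) * hp
    · rw [norm_mul]
      have hb : ‖jostSolM V k x‖ ≤ B₂ := hB₂ k hk (-x) (by linarith)
      have := mul_le_mul hT hb (norm_nonneg _) zero_le_one
      linarith

theorem jostM_inv (hV : ShortRange V) {k : ℝ} (hk : k ≠ 0) :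
    (jostM V k)⁻¹ = 2 * Complex.I * k / jw V k := by
  rw [jostM, jostW_eq hV hk, mul_inv, inv_inv, div_eq_mul_inv]

theorem jostPsi_of_pos (hV : ShortRange V) {k : ℝ} (hk : 0 < k) :
    jostPsi V k = fun x => 2 * Complex.I * k / jw V k * jostSol V k x := by
  ext x
  rw [jostPsi, if_pos hk, jostM_inv hV hk.ne', jostPlus_eq hV hk.ne']

theorem jostPsi_of_neg (hV : ShortRange V) {k : ℝ} (hk : k < 0) :
    jostPsi V k = fun x => 2 * Complex.I * (-k : ℝ) / jw V (-k : ℝ) * jostSolM V (-k : ℝ) x := by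
  ext x
  rw [jostPsi, if_neg hk.not_gt, if_pos hk, jostM_inv hV (neg_pos.2 hk).ne',
    jostMinus_eq hV (neg_pos.2 hk).ne']

theorem exists_jostPsi_bound (hV : ShortRange V) :
    ∃ B : ℝ, 0 ≤ B ∧ ∀ k : ℝ, k ≠ 0 → ∀ x, ‖jostPsi V k x‖ ≤ B := by
  obtain ⟨B, h0, hB⟩ := exists_scattering_bound hV
  refine ⟨B, h0, fun k hk x => ?_⟩
  rcases lt_or_gt_of_ne hk with h | h
  · rw [jostPsi_of_neg hV h]; exact (hB (-k) (neg_pos.2 h).ne' x).2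
  · rw [jostPsi_of_pos hV h]; exact (hB k hk x).1

end Bounds

/-! ### Function classes, integration by parts and the eigenfunction equation -/

section Decay

/-- Continuous functions that are bounded. -/
def BddCont (f : ℝ → ℂ) : Prop := Continuous f ∧ ∃ C, ∀ x, ‖f x‖ ≤ C

/-- Continuous functions that are `O((1 + x²)⁻¹)`. -/
def Dec (f : ℝ → ℂ) : Prop := Continuous f ∧ ∃ C, ∀ x, ‖f x‖ ≤ C * (1 + x ^ 2)⁻¹

variable {f g : ℝ → ℂ}

theorem Dec.add (hf : Dec f) (hg : Dec g) : Dec fun x => f x + g x := by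
  obtain ⟨hf, C, hC⟩ := hf
  obtain ⟨hg, D, hD⟩ := hg
  refine ⟨hf.add hg, C + D, fun x => (norm_add_le _ _).trans ?_⟩
  rw [add_mul]; exact add_le_add (hC x) (hD x)

theorem Dec.const_mul (hf : Dec f) (c : ℂ) : Dec fun x => c * f x := by
  obtain ⟨hf, C, hC⟩ := hf
  refine ⟨hf.const_mul c, ‖c‖ * C, fun x => ?_⟩
  rw [norm_mul, mul_assoc]
  exact mul_le_mul_of_nonneg_left (hC x) (norm_nonneg _)

theorem Dec.zero : Dec fun _ => 0 := ⟨continuous_const, 0, fun x => by simp⟩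

theorem Dec.neg (hf : Dec f) : Dec fun x => -f x := by simpa using hf.const_mul (-1)

theorem Dec.sub (hf : Dec f) (hg : Dec g) : Dec fun x => f x - g x := by
  simpa [sub_eq_add_neg] using hf.add hg.neg

theorem Dec.conj (hf : Dec f) : Dec fun x => conj (f x) :=
  ⟨Complex.continuous_conj.comp hf.1, hf.2.imp fun C h x => by rw [RCLike.norm_conj]; exact h x⟩

theorem Dec.bddCont (hf : Dec f) : BddCont f := by
  obtain ⟨hf, C, hC⟩ := hf
  refine ⟨hf, C, fun x => (hC x).trans ?_⟩
  have hC0 : 0 ≤ C := by simpa using (norm_nonneg _).trans (hC 0)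
  exact mul_le_of_le_one_right hC0 (inv_le_one_of_one_le₀ (by nlinarith [sq_nonneg x]))

theorem BddCont.conj (hf : BddCont f) : BddCont fun x => conj (f x) :=
  ⟨Complex.continuous_conj.comp hf.1, hf.2.imp fun C h x => by rw [RCLike.norm_conj]; exact h x⟩

theorem BddCont.const_mul (hf : BddCont f) (c : ℂ) : BddCont fun x => c * f x := by
  obtain ⟨hf, C, hC⟩ := hf
  exact ⟨hf.const_mul c, ‖c‖ * C, fun x => by
    rw [norm_mul]; exact mul_le_mul_of_nonneg_left (hC x) (norm_nonneg _)⟩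

theorem Dec.bdd_mul (hf : Dec f) (hg : BddCont g) : Dec fun x => g x * f x := by
  obtain ⟨hf, C, hC⟩ := hf
  obtain ⟨hg, D, hD⟩ := hg
  refine ⟨hg.mul hf, D * C, fun x => ?_⟩
  rw [norm_mul, mul_assoc]
  exact mul_le_mul (hD x) (hC x) (norm_nonneg _) ((norm_nonneg _).trans (hD x))

theorem Dec.integrable (hf : Dec f) : Integrable f := by
  obtain ⟨hf, C, hC⟩ := hf
  exact (integrable_inv_one_add_sq.const_mul C).mono' hf.aestronglyMeasurable
    (Eventually.of_forall hC)

theorem Dec.memLp (hf : Dec f) : MemLp f 2 volume := by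
  rw [memLp_two_iff_integrable_sq_norm hf.1.aestronglyMeasurable]
  have := (hf.bdd_mul hf.bddCont).integrable.norm
  simpa [sq] using this

theorem dec_schwartz (φ : SchwartzMap ℝ ℂ) : Dec φ := by
  obtain ⟨C₀, _, h₀⟩ := φ.decay 0 0
  obtain ⟨C₂, _, h₂⟩ := φ.decay 2 0
  refine ⟨φ.continuous, C₀ + C₂, fun x => ?_⟩
  have a := h₀ x
  have b := h₂ x
  simp only [pow_zero, norm_iteratedFDeriv_zero, one_mul, Real.norm_eq_abs, sq_abs] at a b
  rw [← div_eq_mul_inv, le_div_iff₀ (by positivity)]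
  linarith

theorem hasDerivAt_schwartz (φ : SchwartzMap ℝ ℂ) (x : ℝ) :
    HasDerivAt φ (SchwartzMap.derivCLM ℂ ℂ φ x) x := by
  rw [SchwartzMap.derivCLM_apply]
  exact φ.differentiableAt.hasDerivAt

/-- Integration by parts on the line. -/
theorem integral_mul_deriv_of_dec {u u' v v' : ℝ → ℂ} (hu : BddCont u) (hu' : BddCont u')
    (hv : Dec v) (hv' : Dec v') (h₁ : ∀ x, HasDerivAt u (u' x) x)
    (h₂ : ∀ x, HasDerivAt v (v' x) x) :
    ∫ x, u x * v' x = -∫ x, u' x * v x :=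
  integral_mul_deriv_eq_deriv_mul_of_integrable (fun x _ => h₁ x) (fun x _ => h₂ x)
    (hv'.bdd_mul hu).integrable (hv.bdd_mul hu').integrable (hv.bdd_mul hu).integrable

variable {V : ℝ → ℝ}

theorem ShortRange.bddCont (hV : ShortRange V) : BddCont fun x => (V x : ℂ) := by
  refine ⟨Complex.continuous_ofReal.comp hV.cont, hV.bdd.imp fun B h x => ?_⟩
  rw [Complex.norm_real]; exact h x

theorem BddCont.mul (hf : BddCont f) (hg : BddCont g) : BddCont fun x => f x * g x := by
  obtain ⟨hf, C, hC⟩ := hf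
  obtain ⟨hg, D, hD⟩ := hg
  refine ⟨hf.mul hg, C * D, fun x => ?_⟩
  rw [norm_mul]
  exact mul_le_mul (hC x) (hD x) (norm_nonneg _) ((norm_nonneg _).trans (hC x))

theorem BddCont.sub_const (hf : BddCont f) (c : ℂ) : BddCont fun x => f x - c := by
  obtain ⟨hf, C, hC⟩ := hf
  exact ⟨hf.sub continuous_const, C + ‖c‖, fun x =>
    (norm_sub_le _ _).trans (by linarith [hC x])⟩

theorem isTemperedFun_of_bddCont (hf : BddCont f) : IsTemperedFun f := by
  refine ⟨1, ?_⟩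
  have h1 : Dec fun x : ℝ => (1 + (x : ℂ) ^ 2)⁻¹ := by
    have hn : ∀ x : ℝ, (1 + (x : ℂ) ^ 2) = ((1 + x ^ 2 : ℝ) : ℂ) := fun x => by push_cast; ring
    refine ⟨Continuous.inv₀ (by fun_prop) fun x => ?_, 1, fun x => ?_⟩
    · rw [hn, Ne, Complex.ofReal_eq_zero]; positivity
    · dsimp only
      rw [hn, norm_inv, Complex.norm_real, Real.norm_of_nonneg (by positivity), one_mul]
  simpa [div_eq_mul_inv] using (h1.bdd_mul hf).integrable

/-- Two integrations by parts move both derivatives between `u` and the test function; boundedness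
of `u` and `u'` suffices because the test function decays. -/
theorem isDistribEigen_of_solPair (hV : ShortRange V) {E m : ℝ} {u u' : ℝ → ℂ}
    (h : SolPair V E u u') (hu : BddCont u) (hu' : BddCont u') :
    IsDistribEigen V m (E + m ^ 2) u := by
  intro φ
  let φ' := SchwartzMap.derivCLM ℂ ℂ φ
  let φ'' := SchwartzMap.derivCLM ℂ ℂ φ'
  have d1 : deriv (fun y => φ y) = φ' := funext fun x => (hasDerivAt_schwartz φ x).deriv
  have d2 : deriv φ' = φ'' := funext fun x => (hasDerivAt_schwartz φ' x).deriv
  rw [d1, d2]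
  have hw : BddCont fun x => (V x - E) * u x := (hV.bddCont.sub_const E).mul hu
  have i1 := integral_mul_deriv_of_dec hu hu' (dec_schwartz φ') (dec_schwartz φ'') h.deriv₁
    (hasDerivAt_schwartz φ')
  have i2 := integral_mul_deriv_of_dec hu' hw (dec_schwartz φ) (dec_schwartz φ') h.deriv₂
    (hasDerivAt_schwartz φ)
  have i3 : ∫ x, u x * φ'' x = ∫ x, (V x - E) * u x * φ x := by rw [i1, i2, neg_neg]
  have e : ∀ x, u x * (-φ'' x + (V x + (m : ℂ) ^ 2) * φ x)
      = ((E : ℂ) + (m : ℂ) ^ 2) * (u x * φ x) - (u x * φ'' x - (V x - E) * u x * φ x) := by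
    intro x; ring
  simp only [e]
  rw [integral_sub (g := fun x => _ - _) (((dec_schwartz φ).bdd_mul hu).integrable.const_mul _)
    (((dec_schwartz φ'').bdd_mul hu).integrable.sub ((dec_schwartz φ).bdd_mul hw).integrable),
    integral_sub ((dec_schwartz φ'').bdd_mul hu).integrable ((dec_schwartz φ).bdd_mul hw).integrable,
    i3, integral_const_mul]
  push_cast; ring

theorem bddCont_jostSol (hV : ShortRange V) {k : ℝ} (hk : k ≠ 0) :
    BddCont (jostSol V k) ∧ BddCont (jostSolDeriv V k) := by
  have hζ := ofReal_mem_closedUpper hk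
  have h := solPair_jostSol hV hζ
  exact ⟨⟨h.continuous, _, fun x => by simpa using norm_jostSol_le hV hζ x⟩,
    ⟨h.continuous', _, fun x => by simpa using norm_jostSolDeriv_le hV hζ x⟩⟩

theorem bddCont_jostSolM (hV : ShortRange V) {k : ℝ} (hk : k ≠ 0) :
    BddCont (jostSolM V k) ∧ BddCont (jostSolMDeriv V k) := by
  have hζ := ofReal_mem_closedUpper hk
  have h := solPair_jostSolM hV hζ
  exact ⟨⟨h.continuous, _, fun x => by simpa [jostSolM] using norm_jostSol_le hV.comp_neg hζ (-x)⟩,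
    ⟨h.continuous', _, fun x => by
      simpa [jostSolMDeriv] using norm_jostSolDeriv_le hV.comp_neg hζ (-x)⟩⟩

theorem jostPsi_isGenEigen (hV : ShortRange V) (m : ℝ) {k : ℝ} (hk : k ≠ 0) :
    IsTemperedFun (jostPsi V k) ∧ IsDistribEigen V m (k ^ 2 + m ^ 2) (jostPsi V k) := by
  rcases lt_or_gt_of_ne hk with h | h
  · have hk' := (neg_pos.2 h).ne'
    have hb := bddCont_jostSolM hV hk'
    have hs := (solPair_jostSolM hV (ofReal_mem_closedUpper hk')).const_mul
      (2 * Complex.I * (-k : ℝ) / jw V (-k : ℝ))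
    have e : ((-k : ℝ) : ℂ) ^ 2 = ((k ^ 2 : ℝ) : ℂ) := by push_cast; ring
    rw [e] at hs
    rw [jostPsi_of_neg hV h]
    exact ⟨isTemperedFun_of_bddCont (hb.1.const_mul _),
      isDistribEigen_of_solPair hV hs (hb.1.const_mul _) (hb.2.const_mul _)⟩
  · have hb := bddCont_jostSol hV hk
    have hs := (solPair_jostSol hV (ofReal_mem_closedUpper hk)).const_mul
      (2 * Complex.I * k / jw V k)
    have e : (k : ℂ) ^ 2 = ((k ^ 2 : ℝ) : ℂ) := by push_cast; ring
    rw [e] at hs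
    rw [jostPsi_of_pos hV h]
    exact ⟨isTemperedFun_of_bddCont (hb.1.const_mul _),
      isDistribEigen_of_solPair hV hs (hb.1.const_mul _) (hb.2.const_mul _)⟩

end Decay

/-! ### Exponentially decaying kernels -/

section ExponentialDecay

theorem exp_neg_mul_abs_le {η : ℝ} (hη : 0 < η) (t : ℝ) :
    Real.exp (-(η * |t|)) ≤ (2 + 48 / η ^ 4) * (1 + t ^ 2)⁻¹ * (1 + t ^ 2)⁻¹ := by
  -- The fourth Taylor term of the exponential: `(1 + t²)² ≤ 2 + 2t⁴ ≤ (2 + 2·24/η⁴) e^{η|t|}`.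
  have h1 : (η * |t|) ^ 4 / 24 ≤ Real.exp (η * |t|) := by
    have := Real.pow_div_factorial_le_exp (η * |t|) (by positivity) 4
    norm_num [Nat.factorial] at this ⊢
    exact this
  have h2 : (1 : ℝ) ≤ Real.exp (η * |t|) := Real.one_le_exp (by positivity)
  have h3 : (η * |t|) ^ 4 = η ^ 4 * t ^ 4 := by
    rw [mul_pow]; congr 1
    calc |t| ^ 4 = (|t| ^ 2) ^ 2 := by ring
      _ = t ^ 4 := by rw [sq_abs]; ring
  rw [h3] at h1
  have h4 : (1 + t ^ 2) * (1 + t ^ 2) ≤ (2 + 48 / η ^ 4) * Real.exp (η * |t|) := by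
    have h5 : t ^ 4 ≤ 24 / η ^ 4 * Real.exp (η * |t|) := by
      rw [div_mul_eq_mul_div, le_div_iff₀ (by positivity)]
      linarith
    have h6 : (2 + 48 / η ^ 4) * Real.exp (η * |t|)
        = 2 * Real.exp (η * |t|) + 2 * (24 / η ^ 4 * Real.exp (η * |t|)) := by ring
    rw [h6]
    nlinarith [sq_nonneg (t ^ 2 - 1)]
  rw [Real.exp_neg, mul_assoc, ← mul_inv, ← div_eq_mul_inv, inv_eq_one_div,
    div_le_div_iff₀ (Real.exp_pos _) (by positivity)]
  linarith

/-- Of the two inverse powers gained from the exponential, one transfers the decay from `y` to `x`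
by Peetre's inequality and the other remains to integrate in `y`. -/
theorem exp_neg_mul_abs_mul_inv_le {η : ℝ} (hη : 0 < η) (x y : ℝ) :
    Real.exp (-(η * |x - y|)) * (1 + y ^ 2)⁻¹
      ≤ (2 * (2 + 48 / η ^ 4) * (1 + x ^ 2)⁻¹) * (1 + (x - y) ^ 2)⁻¹ := by
  have h1 := exp_neg_mul_abs_le hη (x - y)
  have h2 : (1 + (x - y) ^ 2)⁻¹ * (1 + y ^ 2)⁻¹ ≤ 2 * (1 + x ^ 2)⁻¹ := by
    rw [← mul_inv, ← div_eq_mul_inv, inv_eq_one_div, div_le_div_iff₀ (by positivity) (by positivity)]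
    nlinarith [sq_nonneg ((x - y) - y), sq_nonneg ((x - y) * y)]
  calc _ ≤ ((2 + 48 / η ^ 4) * (1 + (x - y) ^ 2)⁻¹ * (1 + (x - y) ^ 2)⁻¹) * (1 + y ^ 2)⁻¹ :=
        mul_le_mul_of_nonneg_right h1 (by positivity)
    _ = ((2 + 48 / η ^ 4) * (1 + (x - y) ^ 2)⁻¹) * ((1 + (x - y) ^ 2)⁻¹ * (1 + y ^ 2)⁻¹) := by ring
    _ ≤ ((2 + 48 / η ^ 4) * (1 + (x - y) ^ 2)⁻¹) * (2 * (1 + x ^ 2)⁻¹) :=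
        mul_le_mul_of_nonneg_left h2 (by positivity)
    _ = _ := by ring

/-- Integrals against exponentially decaying kernels preserve the class `Dec`. -/
theorem exists_norm_setIntegral_exp_le {η : ℝ} (hη : 0 < η) {f : ℝ → ℂ} (hf : Dec f) :
    ∃ C : ℝ, ∀ (D : ℝ) (S : Set ℝ) (g : ℝ → ℂ) (x : ℝ), 0 ≤ D → MeasurableSet S →
      (∀ y ∈ S, ‖g y‖ ≤ D * Real.exp (-(η * |x - y|)) * ‖f y‖) →
      ‖∫ y in S, g y‖ ≤ D * C * (1 + x ^ 2)⁻¹ := by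
  obtain ⟨_, M, hM⟩ := hf
  have hM0 : 0 ≤ M := by simpa using (norm_nonneg _).trans (hM 0)
  refine ⟨M * (2 * (2 + 48 / η ^ 4)) * Real.pi, fun D S g x hD hS hg => ?_⟩
  have hi : Integrable fun y : ℝ => (1 + (x - y) ^ 2)⁻¹ :=
    integrable_inv_one_add_sq.comp_sub_left x
  have hI : ∫ y : ℝ, (1 + (x - y) ^ 2)⁻¹ = Real.pi := by
    rw [integral_sub_left_eq_self (fun y : ℝ => (1 + y ^ 2)⁻¹) volume x]
    exact integral_univ_inv_one_add_sq
  have hi' := hi.const_mul (D * (M * (2 * (2 + 48 / η ^ 4) * (1 + x ^ 2)⁻¹)))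
  calc _ ≤ ∫ y in S, D * (M * (2 * (2 + 48 / η ^ 4) * (1 + x ^ 2)⁻¹)) * (1 + (x - y) ^ 2)⁻¹ := by
        refine norm_integral_le_of_norm_le hi'.integrableOn ?_
        refine (ae_restrict_iff' hS).2 (Eventually.of_forall fun y hy => (hg y hy).trans ?_)
        have h1 := exp_neg_mul_abs_mul_inv_le hη x y
        calc _ ≤ D * Real.exp (-(η * |x - y|)) * (M * (1 + y ^ 2)⁻¹) :=
              mul_le_mul_of_nonneg_left (hM y) (by positivity)
          _ = D * M * (Real.exp (-(η * |x - y|)) * (1 + y ^ 2)⁻¹) := by ring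
          _ ≤ D * M * ((2 * (2 + 48 / η ^ 4) * (1 + x ^ 2)⁻¹) * (1 + (x - y) ^ 2)⁻¹) :=
              mul_le_mul_of_nonneg_left h1 (by positivity)
          _ = _ := by ring
    _ ≤ ∫ y, D * (M * (2 * (2 + 48 / η ^ 4) * (1 + x ^ 2)⁻¹)) * (1 + (x - y) ^ 2)⁻¹ :=
        setIntegral_le_integral hi' (Eventually.of_forall fun y => by positivity)
    _ = _ := by rw [integral_const_mul, hI]; ring

end ExponentialDecay

/-! ### Green's function and the resolvent -/

section Resolvent

variable {V : ℝ → ℝ} {ζ : ℂ}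

theorem mem_closedUpper_of_im_pos (hζ : 0 < ζ.im) : ζ ∈ closedUpper :=
  ⟨hζ.le, fun h => by simp [h] at hζ⟩

theorem norm_jostSolM_le (hV : ShortRange V) (hζ : ζ ∈ closedUpper) (x : ℝ) :
    ‖jostSolM V ζ x‖ ≤ jostBound (fun x => V (-x)) ζ * Real.exp (ζ.im * x) := by
  simpa [jostSolM] using norm_jostSol_le hV.comp_neg hζ (-x)

theorem norm_jostSolMDeriv_le (hV : ShortRange V) (hζ : ζ ∈ closedUpper) (x : ℝ) :
    ‖jostSolMDeriv V ζ x‖ ≤ (‖ζ‖ + (∫ y, |V (-y)|) * jostBound (fun x => V (-x)) ζ)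
      * Real.exp (ζ.im * x) := by
  simpa [jostSolMDeriv] using norm_jostSolDeriv_le hV.comp_neg hζ (-x)

/-- Green's function of `h - ζ²`. -/
def green (V : ℝ → ℝ) (ζ : ℂ) (x y : ℝ) : ℂ :=
  -(jostSol V ζ (max x y) * jostSolM V ζ (min x y)) / jw V ζ

/-- The function `(h - ζ²)⁻¹ f`. -/
def resol (V : ℝ → ℝ) (ζ : ℂ) (f : ℝ → ℂ) (x : ℝ) : ℂ := ∫ y, green V ζ x y * f y

/-- The constant in the bound for Green's function. -/
def greenBound (V : ℝ → ℝ) (ζ : ℂ) : ℝ :=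
  jostBound V ζ * jostBound (fun x => V (-x)) ζ / ‖jw V ζ‖

theorem green_comm (V : ℝ → ℝ) (ζ : ℂ) (x y : ℝ) : green V ζ x y = green V ζ y x := by
  rw [green, green, max_comm, min_comm]

theorem norm_green_le (hV : ShortRange V) (hζ : ζ ∈ closedUpper) (x y : ℝ) :
    ‖green V ζ x y‖ ≤ greenBound V ζ * Real.exp (-(ζ.im * |x - y|)) := by
  rw [green, norm_div, norm_neg, norm_mul, greenBound, div_mul_eq_mul_div]
  refine div_le_div_of_nonneg_right ?_ (norm_nonneg _)
  have h := mul_le_mul (norm_jostSol_le hV hζ (max x y)) (norm_jostSolM_le hV hζ (min x y))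
    (norm_nonneg _) (mul_nonneg (jostBound_pos _ _).le (Real.exp_pos _).le)
  refine h.trans (le_of_eq ?_)
  have e : Real.exp (-(ζ.im * |x - y|))
      = Real.exp (-(ζ.im * max x y)) * Real.exp (ζ.im * min x y) := by
    rw [← Real.exp_add, ← max_sub_min_eq_abs' x y]; congr 1; ring
  rw [e]; ring

theorem continuous_green (hV : ShortRange V) (hζ : ζ ∈ closedUpper) :
    Continuous fun p : ℝ × ℝ => green V ζ p.1 p.2 := by
  have h1 := (solPair_jostSol hV hζ).continuous
  have h2 := (solPair_jostSolM hV hζ).continuous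
  unfold green
  fun_prop

theorem integrable_green_mul (hV : ShortRange V) (hζ : ζ ∈ closedUpper) {f : ℝ → ℂ} (hf : Dec f)
    (x : ℝ) : Integrable fun y => green V ζ x y * f y := by
  have h1 := (solPair_jostSol hV hζ).continuous
  have h2 := (solPair_jostSolM hV hζ).continuous
  have hc : Continuous fun y => green V ζ x y := by
    unfold green
    fun_prop
  suffices hb : BddCont (green V ζ x) from (hf.bdd_mul hb).integrable
  refine ⟨hc, greenBound V ζ, fun y => ?_⟩
  refine (norm_green_le hV hζ x y).trans (mul_le_of_le_one_right ?_ ?_)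
  · exact div_nonneg (mul_nonneg (jostBound_pos _ _).le (jostBound_pos _ _).le) (norm_nonneg _)
  · rw [Real.exp_le_one_iff, neg_nonpos]
    exact mul_nonneg hζ.1 (abs_nonneg _)

theorem integrableOn_jostSolM_mul (hV : ShortRange V) (hζ : ζ ∈ closedUpper) {f : ℝ → ℂ}
    (hf : Dec f) (x : ℝ) : IntegrableOn (fun y => jostSolM V ζ y * f y) (Set.Iic x) := by
  have h1 := (solPair_jostSolM hV hζ).continuous
  have h2 := hf.1
  have h3 := jostBound_pos (fun x => V (-x)) ζ
  refine (hf.integrable.norm.const_mul (jostBound (fun x => V (-x)) ζ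
    * Real.exp (ζ.im * x))).integrableOn.mono' (Continuous.aestronglyMeasurable (by fun_prop)) ?_
  refine (ae_restrict_iff' measurableSet_Iic).2 (Eventually.of_forall fun y hy => ?_)
  rw [norm_mul]
  refine mul_le_mul_of_nonneg_right ((norm_jostSolM_le hV hζ y).trans ?_) (norm_nonneg _)
  have := mul_le_mul_of_nonneg_left (Set.mem_Iic.1 hy) hζ.1
  gcongr

theorem integrableOn_jostSol_mul (hV : ShortRange V) (hζ : ζ ∈ closedUpper) {f : ℝ → ℂ}
    (hf : Dec f) (x : ℝ) : IntegrableOn (fun y => jostSol V ζ y * f y) (Set.Ioi x) := by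
  have h1 := (solPair_jostSol hV hζ).continuous
  have h2 := hf.1
  have h3 := jostBound_pos V ζ
  refine (hf.integrable.norm.const_mul (jostBound V ζ
    * Real.exp (-(ζ.im * x)))).integrableOn.mono' (Continuous.aestronglyMeasurable (by fun_prop)) ?_
  refine (ae_restrict_iff' measurableSet_Ioi).2 (Eventually.of_forall fun y hy => ?_)
  rw [norm_mul]
  refine mul_le_mul_of_nonneg_right ((norm_jostSol_le hV hζ y).trans ?_) (norm_nonneg _)
  have := mul_le_mul_of_nonneg_left (le_of_lt (Set.mem_Ioi.1 hy)) hζ.1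
  gcongr

theorem resol_eq (hV : ShortRange V) (hζ : ζ ∈ closedUpper) {f : ℝ → ℂ} (hf : Dec f) (x : ℝ) :
    resol V ζ f x = -(jw V ζ)⁻¹ * (jostSol V ζ x * (∫ y in Set.Iic x, jostSolM V ζ y * f y)
      + jostSolM V ζ x * ∫ y in Set.Ioi x, jostSol V ζ y * f y) := by
  have hi := integrable_green_mul hV hζ hf x
  rw [resol, ← intervalIntegral.integral_Iic_add_Ioi (b := x) hi.integrableOn hi.integrableOn,
    mul_add]
  congr 1
  · rw [← integral_const_mul, ← integral_const_mul]
    refine setIntegral_congr_fun measurableSet_Iic fun y hy => ?_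
    simp only [green, max_eq_left (Set.mem_Iic.1 hy), min_eq_right (Set.mem_Iic.1 hy)]
    ring
  · rw [← integral_const_mul, ← integral_const_mul]
    refine setIntegral_congr_fun measurableSet_Ioi fun y hy => ?_
    have hy' := le_of_lt (Set.mem_Ioi.1 hy)
    simp only [green, max_eq_right hy', min_eq_left hy']
    ring

/-- The derivative of `(h - ζ²)⁻¹ f`. -/
def resolDeriv (V : ℝ → ℝ) (ζ : ℂ) (f : ℝ → ℂ) (x : ℝ) : ℂ :=
  -(jw V ζ)⁻¹ * (jostSolDeriv V ζ x * (∫ y in Set.Iic x, jostSolM V ζ y * f y)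
      + jostSolMDeriv V ζ x * ∫ y in Set.Ioi x, jostSol V ζ y * f y)

/-- `u` solves `-u'' + V u - z u = f`, all functions being `O((1 + x²)⁻¹)`. -/
structure ResPair (V : ℝ → ℝ) (z : ℂ) (f u u' : ℝ → ℂ) : Prop where
  dec_f : Dec f
  dec₀ : Dec u
  dec₁ : Dec u'
  deriv₁ : ∀ x, HasDerivAt u (u' x) x
  deriv₂ : ∀ x, HasDerivAt u' ((V x - z) * u x - f x) x

/-- Serves both the resolvent and its derivative: on each half line the opposite growth rates
combine into `e^{-η|x-y|}`. -/
theorem dec_kernel_sum {η : ℝ} (hη : 0 < η) {f : ℝ → ℂ} (hf : Dec f) {a b p q : ℝ → ℂ}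
    {A B P Q : ℝ} (hA : 0 ≤ A) (hB : 0 ≤ B) (hP : 0 ≤ P) (hQ : 0 ≤ Q)
    (ha : ∀ x, ‖a x‖ ≤ A * Real.exp (-(η * x))) (hp : ∀ x, ‖p x‖ ≤ P * Real.exp (η * x))
    (hb : ∀ x, ‖b x‖ ≤ B * Real.exp (η * x)) (hq : ∀ x, ‖q x‖ ≤ Q * Real.exp (-(η * x))) (c : ℂ) :
    ∃ C, ∀ x, ‖c * (a x * (∫ y in Set.Iic x, p y * f y) + b x * ∫ y in Set.Ioi x, q y * f y)‖
      ≤ C * (1 + x ^ 2)⁻¹ := by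
  obtain ⟨C, hC⟩ := exists_norm_setIntegral_exp_le hη hf
  refine ⟨‖c‖ * ((A * P) * C + (B * Q) * C), fun x => ?_⟩
  rw [norm_mul, mul_assoc]
  refine mul_le_mul_of_nonneg_left ((norm_add_le _ _).trans ?_) (norm_nonneg _)
  rw [add_mul, ← integral_const_mul, ← integral_const_mul]
  refine add_le_add (hC (A * P) _ _ x (by positivity) measurableSet_Iic fun y hy => ?_)
    (hC (B * Q) _ _ x (by positivity) measurableSet_Ioi fun y hy => ?_)
  · rw [norm_mul, norm_mul, ← mul_assoc]
    refine mul_le_mul_of_nonneg_right ?_ (norm_nonneg _)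
    refine (mul_le_mul (ha x) (hp y) (norm_nonneg _) (by positivity)).trans (le_of_eq ?_)
    rw [abs_of_nonneg (sub_nonneg.2 (Set.mem_Iic.1 hy))]
    have : Real.exp (-(η * (x - y))) = Real.exp (-(η * x)) * Real.exp (η * y) := by
      rw [← Real.exp_add]; congr 1; ring
    rw [this]; ring
  · rw [norm_mul, norm_mul, ← mul_assoc]
    refine mul_le_mul_of_nonneg_right ?_ (norm_nonneg _)
    refine (mul_le_mul (hb x) (hq y) (norm_nonneg _) (by positivity)).trans (le_of_eq ?_)
    rw [abs_of_nonpos (sub_nonpos.2 (le_of_lt (Set.mem_Ioi.1 hy)))]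
    have : Real.exp (-(η * -(x - y))) = Real.exp (η * x) * Real.exp (-(η * y)) := by
      rw [← Real.exp_add]; congr 1; ring
    rw [this]; ring

/-- Variation of constants: the endpoint terms cancel in the first derivative, and in the second
they contribute `-w⁻¹ · w f = -f`. -/
theorem resPair_resol (hV : ShortRange V) (hζ : 0 < ζ.im) (hw : jw V ζ ≠ 0) {f : ℝ → ℂ}
    (hf : Dec f) : ResPair V (ζ ^ 2) f (resol V ζ f) (resolDeriv V ζ f) := by
  have hz := mem_closedUpper_of_im_pos hζ
  have sp := solPair_jostSol hV hz
  have sm := solPair_jostSolM hV hz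
  have c1 : Continuous fun y => jostSolM V ζ y * f y := sm.continuous.mul hf.1
  have c2 : Continuous fun y => jostSol V ζ y * f y := sp.continuous.mul hf.1
  have i1 := hasDerivAt_integral_Iic c1 (integrableOn_jostSolM_mul hV hz hf)
  have i2 := hasDerivAt_integral_Ioi c2 (integrableOn_jostSol_mul hV hz hf)
  have hinv := inv_mul_cancel₀ hw
  have d1 : ∀ x, HasDerivAt (resol V ζ f) (resolDeriv V ζ f x) x := by
    intro x
    rw [funext (resol_eq hV hz hf)]
    refine ((((sp.deriv₁ x).mul (i1 x)).add ((sm.deriv₁ x).mul (i2 x))).const_mul _).congr_deriv ?_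
    rw [resolDeriv]; ring
  have d2 : ∀ x, HasDerivAt (resolDeriv V ζ f) ((V x - ζ ^ 2) * resol V ζ f x - f x) x := by
    intro x
    refine ((((sp.deriv₂ x).mul (i1 x)).add ((sm.deriv₂ x).mul (i2 x))).const_mul
      (-(jw V ζ)⁻¹)).congr_deriv ?_
    rw [resol_eq hV hz hf]
    have hj := jw_eq hV hz x
    linear_combination (-(jw V ζ)⁻¹ * f x) * hj - f x * hinv
  have n0 : 0 ≤ ∫ y, |V y| := integral_nonneg fun y => abs_nonneg _
  have n1 : 0 ≤ ∫ y, |V (-y)| := integral_nonneg fun y => abs_nonneg _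
  have b1 := (jostBound_pos V ζ).le
  have b2 := (jostBound_pos (fun x => V (-x)) ζ).le
  refine ⟨hf, ⟨continuous_iff_continuousAt.2 fun x => (d1 x).continuousAt, ?_⟩,
    ⟨continuous_iff_continuousAt.2 fun x => (d2 x).continuousAt, ?_⟩, d1, d2⟩
  · rw [funext (resol_eq hV hz hf)]
    exact dec_kernel_sum hζ hf b1 b2 b2 b1 (norm_jostSol_le hV hz) (norm_jostSolM_le hV hz)
      (norm_jostSolM_le hV hz) (norm_jostSol_le hV hz) _
  · exact dec_kernel_sum hζ hf (by positivity) (by positivity) b2 b1 (norm_jostSolDeriv_le hV hz)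
      (norm_jostSolM_le hV hz) (norm_jostSolMDeriv_le hV hz) (norm_jostSol_le hV hz) _

/-! ### Energy identities: symmetry, coercivity, uniqueness -/

namespace ResPair

variable {z w : ℂ} {f g u u' v v' : ℝ → ℂ}

theorem green_identity (hV : ShortRange V) (hu : Dec u) (hu' : Dec u')
    (hd : ∀ x, HasDerivAt u (u' x) x) (h : ResPair V w g v v') :
    ∫ x, conj (u x) * ((V x - w) * v x - g x) = -∫ x, conj (u' x) * v' x := by
  have hd2 : Dec fun x => (V x - w) * v x - g x := (h.dec₀.bdd_mul (hV.bddCont.sub_const w)).sub h.dec_f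
  exact integral_mul_deriv_of_dec hu.conj.bddCont hu'.conj.bddCont h.dec₁ hd2
    (fun x => (hd x).star) h.deriv₂

/-- Symmetry of `h`. -/
theorem symmetric (hV : ShortRange V) (h₁ : ResPair V z f u u') (h₂ : ResPair V w g v v') :
    ∫ x, conj (u x) * (g x + w * v x) = ∫ x, conj (f x + z * u x) * v x := by
  have a := green_identity hV h₁.dec₀ h₁.dec₁ h₁.deriv₁ h₂
  have b := green_identity hV h₂.dec₀ h₂.dec₁ h₂.deriv₁ h₁
  have b' := congrArg conj b
  rw [← integral_conj, map_neg, ← integral_conj] at b'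
  simp only [map_mul, map_sub, Complex.conj_conj, Complex.conj_ofReal] at b'
  have e1 : ∫ x, v' x * conj (u' x) = ∫ x, conj (u' x) * v' x := by simp only [mul_comm]
  rw [e1] at b'
  have hab := a.trans b'.symm
  have i0 : Integrable fun x => V x * (conj (u x) * v x) :=
    (((h₂.dec₀.bdd_mul h₁.dec₀.bddCont.conj)).bdd_mul hV.bddCont).integrable
  have i1 : Integrable fun x => conj (u x) * (g x + w * v x) :=
    ((h₂.dec_f.add (h₂.dec₀.const_mul w)).bdd_mul h₁.dec₀.bddCont.conj).integrable
  have i2 : Integrable fun x => conj (f x + z * u x) * v x :=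
    (h₂.dec₀.bdd_mul (h₁.dec_f.add (h₁.dec₀.const_mul z)).bddCont.conj).integrable
  have l1 : ∀ x, conj (u x) * ((V x - w) * v x - g x)
      = V x * (conj (u x) * v x) - conj (u x) * (g x + w * v x) := fun x => by ring
  have l2 : ∀ x, v x * ((V x - conj z) * conj (u x) - conj (f x))
      = V x * (conj (u x) * v x) - conj (f x + z * u x) * v x := fun x => by
    rw [map_add, map_mul]; ring
  simp only [l1, l2] at hab
  rw [integral_sub i0 i1, integral_sub i0 i2] at hab
  exact sub_right_inj.1 hab

theorem integrable_sq (hu : Dec u) : Integrable fun x => ‖u x‖ ^ 2 := by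
  have := (hu.bdd_mul hu.bddCont).integrable.norm
  simpa [sq] using this

theorem eq_zero_of_integral_sq (hu : Dec u) (h : ∫ x, ‖u x‖ ^ 2 ≤ 0) : u = 0 := by
  have h0 : ∫ x, ‖u x‖ ^ 2 = 0 := le_antisymm h (integral_nonneg fun x => sq_nonneg _)
  have h1 := (integral_eq_zero_iff_of_nonneg (fun x => sq_nonneg ‖u x‖) (integrable_sq hu)).1 h0
  have h2 := (Continuous.ae_eq_iff_eq volume (hu.1.norm.pow 2) continuous_const).1 h1
  ext x
  have h3 : ‖u x‖ ^ 2 = 0 := congrFun h2 x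
  exact norm_eq_zero.1 ((pow_eq_zero_iff two_ne_zero).1 h3)

theorem integral_conj_mul_self (u : ℝ → ℂ) :
    ∫ x, conj (u x) * u x = ((∫ x, ‖u x‖ ^ 2 : ℝ) : ℂ) := by
  rw [← integral_complex_ofReal]
  refine integral_congr_ae (Eventually.of_forall fun x => ?_)
  simp only [Complex.conj_mul']
  push_cast; rfl

/-- Coercivity of `h + c`. -/
theorem coercive (hV : ShortRange V) {c : ℝ} (hc : ∀ x, 1 ≤ V x + c)
    (h : ResPair V (-c : ℝ) f u u') :
    ∫ x, ‖u x‖ ^ 2 ≤ (∫ x, conj (u x) * f x).re := by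
  have a := green_identity hV h.dec₀ h.dec₁ h.deriv₁ h
  rw [integral_conj_mul_self] at a
  have i0 : Integrable fun x => ((V x + c : ℝ) : ℂ) * (conj (u x) * u x) := by
    refine ((h.dec₀.bdd_mul h.dec₀.bddCont.conj).bdd_mul (g := fun x => ((V x + c : ℝ) : ℂ)) ?_).integrable
    simpa using hV.bddCont.sub_const (-c)
  have i1 : Integrable fun x => conj (u x) * f x := (h.dec_f.bdd_mul h.dec₀.bddCont.conj).integrable
  have l1 : ∀ x, conj (u x) * ((V x - (-c : ℝ)) * u x - f x)
      = ((V x + c : ℝ) : ℂ) * (conj (u x) * u x) - conj (u x) * f x := fun x => by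
    push_cast; ring
  simp only [l1] at a
  rw [integral_sub i0 i1] at a
  have l2 : ∀ x, ((V x + c : ℝ) : ℂ) * (conj (u x) * u x) = (((V x + c) * ‖u x‖ ^ 2 : ℝ) : ℂ) := by
    intro x
    rw [Complex.conj_mul']; push_cast; rfl
  simp only [l2] at a i0
  rw [integral_complex_ofReal] at a
  have a' := congrArg Complex.re a
  simp only [Complex.sub_re, Complex.ofReal_re, Complex.neg_re] at a'
  have i0' : Integrable fun x => (V x + c) * ‖u x‖ ^ 2 := by
    exact i0.re
  have m1 : ∫ x, ‖u x‖ ^ 2 ≤ ∫ x, (V x + c) * ‖u x‖ ^ 2 :=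
    integral_mono (integrable_sq h.dec₀) i0' fun x =>
      le_mul_of_one_le_left (sq_nonneg _) (hc x)
  -- The identity reads `∫ (V + c)|u|² + ∫ |u'|² = Re ∫ conj u · f`; here the kinetic term is
  -- discarded.
  have m2 : 0 ≤ ∫ x, ‖u' x‖ ^ 2 := integral_nonneg fun x => sq_nonneg _
  linarith

theorem sub (h₁ : ResPair V z f u u') (h₂ : ResPair V z g v v') :
    ResPair V z (fun x => f x - g x) (fun x => u x - v x) (fun x => u' x - v' x) where
  dec_f := h₁.dec_f.sub h₂.dec_f
  dec₀ := h₁.dec₀.sub h₂.dec₀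
  dec₁ := h₁.dec₁.sub h₂.dec₁
  deriv₁ x := (h₁.deriv₁ x).sub (h₂.deriv₁ x)
  deriv₂ x := ((h₁.deriv₂ x).sub (h₂.deriv₂ x)).congr_deriv (by ring)

theorem unique (hV : ShortRange V) {c : ℝ} (hc : ∀ x, 1 ≤ V x + c)
    (h₁ : ResPair V (-c : ℝ) f u u') (h₂ : ResPair V (-c : ℝ) f v v') : u = v := by
  have h := coercive hV hc (h₁.sub h₂)
  simp only [sub_self, mul_zero, integral_zero, Complex.zero_re] at h
  have := eq_zero_of_integral_sq (h₁.sub h₂).dec₀ h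
  ext x
  exact sub_eq_zero.1 (congrFun this x)

/-- Moving the spectral parameter into the right-hand side; this is what lets the single operator
`A` describe the resolvent at every `z`. -/
theorem shift (h : ResPair V z f u u') (w : ℂ) :
    ResPair V w (fun x => f x + (z - w) * u x) u u' where
  dec_f := h.dec_f.add (h.dec₀.const_mul _)
  dec₀ := h.dec₀
  dec₁ := h.dec₁
  deriv₁ := h.deriv₁
  deriv₂ x := (h.deriv₂ x).congr_deriv (by ring)

/-- A symmetric operator has only real eigenvalues. -/
theorem eq_zero_of_im_ne_zero (hV : ShortRange V) (hz : z.im ≠ 0)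
    (h : ResPair V z (fun _ => 0) u u') : u = 0 := by
  have hs := symmetric hV h h
  simp only [zero_add, map_mul] at hs
  have e1 : ∀ x, conj (u x) * (z * u x) = z * (conj (u x) * u x) := fun x => by ring
  have e2 : ∀ x, conj z * conj (u x) * u x = conj z * (conj (u x) * u x) := fun x => by ring
  simp only [e1, e2, integral_const_mul, integral_conj_mul_self] at hs
  have h5 : z - conj z ≠ 0 := by rw [Complex.sub_conj]; simpa using hz
  have h6 : (z - conj z) * ((∫ x, ‖u x‖ ^ 2 : ℝ) : ℂ) = 0 := by
    rw [sub_mul]; exact sub_eq_zero.2 hs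
  have h7 : ∫ x, ‖u x‖ ^ 2 = 0 := by
    rcases mul_eq_zero.1 h6 with h | h
    · exact absurd h h5
    · exact_mod_cast h
  exact eq_zero_of_integral_sq h.dec₀ h7.le

end ResPair

/-! ### Zeros of the Wronskian in the upper half plane -/

theorem dec_of_le_exp_abs {η C : ℝ} (hη : 0 < η) {u : ℝ → ℂ} (hu : Continuous u) (hC : 0 ≤ C)
    (h : ∀ x, ‖u x‖ ≤ C * Real.exp (-(η * |x|))) : Dec u := by
  refine ⟨hu, C * (2 + 48 / η ^ 4), fun x => (h x).trans ?_⟩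
  rw [mul_assoc]
  refine mul_le_mul_of_nonneg_left ((exp_neg_mul_abs_le hη x).trans ?_) hC
  refine mul_le_of_le_one_right (by positivity) (inv_le_one_of_one_le₀ ?_)
  nlinarith [sq_nonneg x]

theorem exists_jostSol_ne_zero (hV : ShortRange V) (hζ : ζ ∈ closedUpper) :
    ∃ x, jostSol V ζ x ≠ 0 := by
  have h := tendsto_jostSol_div hV hζ
  have := h.eventually_ne one_ne_zero
  obtain ⟨x, hx⟩ := this.exists
  exact ⟨x, fun h => hx (by rw [h, zero_div])⟩

/-- At a zero of the Wronskian the Jost solution is an exponentially decaying eigenfunction. -/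
theorem resPair_of_jw_eq_zero (hV : ShortRange V) (hζ : 0 < ζ.im) (hw : jw V ζ = 0) :
    ResPair V (ζ ^ 2) (fun _ => 0) (jostSol V ζ) (jostSolDeriv V ζ) := by
  have hz := mem_closedUpper_of_im_pos hζ
  have sp := solPair_jostSol hV hz
  have sm := solPair_jostSolM hV hz
  have hev : ∀ᶠ x in atTop, jostSol (fun x => V (-x)) ζ x ≠ 0 := by
    filter_upwards [(tendsto_jostSol_div hV.comp_neg hz).eventually_ne one_ne_zero] with x hx h
    exact hx (by rw [h, zero_div])
  obtain ⟨X, hX⟩ := (hev.and (eventually_ge_atTop 0)).exists_forall_of_atTop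
  have hX0 : 0 ≤ X := (hX X le_rfl).2
  have hne : ∀ x, x ≤ -X → jostSolM V ζ x ≠ 0 := fun x hx => (hX (-x) (by linarith)).1
  -- Near `-∞` the denominator does not vanish, and `q' = w/θ₋² = 0`. So `θ₊ = c θ₋` there, and `θ₊`
  -- decays at both ends.
  let q : ℝ → ℂ := fun x => jostSol V ζ x / jostSolM V ζ x
  have hq : ∀ x ∈ Set.Iio (-X), HasDerivAt q 0 x := by
    intro x hx
    have hx' := hne x (le_of_lt hx)
    refine ((sp.deriv₁ x).div (sm.deriv₁ x) hx').congr_deriv ?_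
    rw [jw_eq hV hz x, hw, zero_div]
  obtain ⟨c, hc⟩ := isOpen_Iio.exists_is_const_of_deriv_eq_zero isPreconnected_Iio
    (fun x hx => (hq x hx).differentiableAt.differentiableWithinAt) (fun x hx => (hq x hx).deriv)
  have hc' : ∀ x ∈ Set.Iio (-X), jostSol V ζ x = c * jostSolM V ζ x := fun x hx =>
    (div_eq_iff (hne x (le_of_lt hx))).1 (hc x hx)
  have hcd : ∀ x ∈ Set.Iio (-X), jostSolDeriv V ζ x = c * jostSolMDeriv V ζ x := by
    intro x hx
    have : jostSol V ζ =ᶠ[𝓝 x] fun x => c * jostSolM V ζ x :=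
      Filter.eventuallyEq_of_mem (isOpen_Iio.mem_nhds hx) hc'
    exact (sp.deriv₁ x).unique (((sm.deriv₁ x).const_mul c).congr_of_eventuallyEq this)
  have key : ∀ (u v : ℝ → ℂ) (C D : ℝ), Continuous u → 0 ≤ C → 0 ≤ D →
      (∀ x, ‖u x‖ ≤ C * Real.exp (-(ζ.im * x))) → (∀ x, ‖v x‖ ≤ D * Real.exp (ζ.im * x)) →
      (∀ x ∈ Set.Iio (-X), u x = c * v x) → Dec u := by
    intro u v C D hu hC hD h1 h2 h3
    refine dec_of_le_exp_abs (C := C * Real.exp (2 * ζ.im * X) + ‖c‖ * D) hζ hu (by positivity)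
      fun x => ?_
    rw [add_mul]
    by_cases hx : x < -X
    · rw [h3 x hx, norm_mul, abs_of_neg (by linarith)]
      have := mul_le_mul_of_nonneg_left (h2 x) (norm_nonneg c)
      have e : -(ζ.im * -x) = ζ.im * x := by ring
      rw [e]
      have : 0 ≤ C * Real.exp (2 * ζ.im * X) * Real.exp (ζ.im * x) := by positivity
      linarith
    · have hx' := not_lt.1 hx
      have h4 : Real.exp (-(ζ.im * x)) ≤ Real.exp (2 * ζ.im * X) * Real.exp (-(ζ.im * |x|)) := by
        rw [← Real.exp_add, Real.exp_le_exp]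
        have : |x| ≤ x + 2 * X := by
          rcases abs_cases x with h | h <;> linarith
        nlinarith
      have h5 := mul_le_mul_of_nonneg_left h4 hC
      have : 0 ≤ ‖c‖ * D * Real.exp (-(ζ.im * |x|)) := by positivity
      linarith [h1 x]
  have n0 : 0 ≤ ∫ y, |V y| := integral_nonneg fun y => abs_nonneg _
  have n1 : 0 ≤ ∫ y, |V (-y)| := integral_nonneg fun y => abs_nonneg _
  have b1 := (jostBound_pos V ζ).le
  have b2 := (jostBound_pos (fun x => V (-x)) ζ).le
  exact ⟨Dec.zero, key _ _ _ _ sp.continuous b1 b2 (norm_jostSol_le hV hz)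
      (norm_jostSolM_le hV hz) hc',
    key _ _ _ _ sp.continuous' (by positivity) (by positivity) (norm_jostSolDeriv_le hV hz)
      (norm_jostSolMDeriv_le hV hz) hcd, sp.deriv₁, fun x => by simpa using sp.deriv₂ x⟩

/-- A zero would be a nontrivial decaying eigenfunction with the nonreal eigenvalue `ζ²`. -/
theorem jw_ne_zero_of_im_sq_ne_zero (hV : ShortRange V) (hζ : 0 < ζ.im) (h : (ζ ^ 2).im ≠ 0) :
    jw V ζ ≠ 0 := by
  intro hw
  obtain ⟨x, hx⟩ := exists_jostSol_ne_zero hV (mem_closedUpper_of_im_pos hζ)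
  exact hx (congrFun (ResPair.eq_zero_of_im_ne_zero hV h (resPair_of_jw_eq_zero hV hζ hw)) x)

theorem jw_ne_zero_of_coercive (hV : ShortRange V) {κ : ℝ} (hκ : 0 < κ)
    (hc : ∀ x, 1 ≤ V x + κ ^ 2) : jw V (Complex.I * κ) ≠ 0 := by
  intro hw
  have hi : 0 < (Complex.I * (κ : ℂ)).im := by simpa using hκ
  obtain ⟨x, hx⟩ := exists_jostSol_ne_zero hV (mem_closedUpper_of_im_pos hi)
  have h := resPair_of_jw_eq_zero hV hi hw
  have e : (Complex.I * (κ : ℂ)) ^ 2 = ((-κ ^ 2 : ℝ) : ℂ) := by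
    rw [mul_pow, Complex.I_sq]; push_cast; ring
  rw [e] at h
  have h2 := ResPair.coercive (c := κ ^ 2) hV hc h
  simp only [mul_zero, integral_zero, Complex.zero_re] at h2
  exact hx (congrFun (ResPair.eq_zero_of_integral_sq h.dec₀ h2) x)

end Resolvent

/-! ### The inverse of the Hamiltonian on L² -/

section Operator

variable {V : ℝ → ℝ}

theorem inner_toLp {f g : ℝ → ℂ} (hf : MemLp f 2 volume) (hg : MemLp g 2 volume) :
    inner ℂ (hf.toLp f) (hg.toLp g) = ∫ x, conj (f x) * g x := by
  rw [L2.inner_def]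
  refine integral_congr_ae ?_
  filter_upwards [hf.coeFn_toLp, hg.coeFn_toLp] with x h1 h2
  rw [h1, h2, RCLike.inner_apply, mul_comm]

theorem inner_toLp_left {f : ℝ → ℂ} (hf : MemLp f 2 volume) (g : Lp ℂ 2 (volume : Measure ℝ)) :
    inner ℂ (hf.toLp f) g = ∫ x, conj (f x) * g x := by
  rw [L2.inner_def]
  refine integral_congr_ae ?_
  filter_upwards [hf.coeFn_toLp] with x h1
  rw [h1, RCLike.inner_apply, mul_comm]

theorem norm_sq_toLp {f : ℝ → ℂ} (hf : MemLp f 2 volume) :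
    ‖hf.toLp f‖ ^ 2 = ∫ x, ‖f x‖ ^ 2 := by
  have h := inner_toLp hf hf
  rw [inner_self_eq_norm_sq_to_K, ResPair.integral_conj_mul_self] at h
  apply Complex.ofReal_injective
  rw [Complex.ofReal_pow]
  exact h

theorem Dec.toLp_eq_zero {f : ℝ → ℂ} (hf : Dec f) (h : hf.memLp.toLp f = 0) : f = 0 := by
  refine ResPair.eq_zero_of_integral_sq hf ?_
  rw [← norm_sq_toLp hf.memLp, h]; simp

/-- The subspace of functions that are `O((1 + x²)⁻¹)`. -/
def decSubmodule : Submodule ℂ (ℝ → ℂ) where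
  carrier := {f | Dec f}
  add_mem' hf hg := hf.add hg
  zero_mem' := Dec.zero
  smul_mem' c _ hf := hf.const_mul c

/-- The inclusion of `decSubmodule` in `L²`. -/
def decToL2 : decSubmodule →ₗ[ℂ] Lp ℂ 2 (volume : Measure ℝ) where
  toFun f := (Dec.memLp f.2).toLp f.1
  map_add' f g := MemLp.toLp_add (Dec.memLp f.2) (Dec.memLp g.2)
  map_smul' c f := MemLp.toLp_const_smul c (Dec.memLp f.2)

theorem denseRange_decToL2 : DenseRange decToL2 := by
  have h := SchwartzMap.denseRange_toLpCLM (F := ℂ) (E := ℝ) (p := 2) (μ := volume)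
    ENNReal.ofNat_ne_top
  refine h.mono ?_
  rintro _ ⟨φ, rfl⟩
  exact ⟨⟨φ, dec_schwartz φ⟩, rfl⟩

theorem resol_add (hV : ShortRange V) {ζ : ℂ} (hζ : ζ ∈ closedUpper) {f g : ℝ → ℂ} (hf : Dec f)
    (hg : Dec g) : resol V ζ (f + g) = resol V ζ f + resol V ζ g := by
  ext x
  simp only [resol, Pi.add_apply, mul_add]
  exact integral_add (integrable_green_mul hV hζ hf x) (integrable_green_mul hV hζ hg x)

theorem resol_smul (V : ℝ → ℝ) (ζ c : ℂ) (f : ℝ → ℂ) : resol V ζ (c • f) = c • resol V ζ f := by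
  ext x
  simp only [resol, Pi.smul_apply, smul_eq_mul, ← integral_const_mul]
  congr 1; ext y; ring

/-- The bounded inverse of `h + c` on `L²`, for `c` large. -/
theorem exists_inverse_operator (hV : ShortRange V) :
    ∃ (c : ℝ) (A : Lp ℂ 2 (volume : Measure ℝ) →L[ℂ] Lp ℂ 2 (volume : Measure ℝ)),
      IsSelfAdjoint A ∧ ∀ f u u' (h : ResPair V (-c : ℝ) f u u'),
        A (h.dec_f.memLp.toLp f) = h.dec₀.memLp.toLp u := by
  obtain ⟨B, hB⟩ := hV.bdd
  have hB0 : 0 ≤ B := (abs_nonneg _).trans (hB 0)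
  -- With `κ² = B + 1` and `|V| ≤ B` one has `V + κ² ≥ 1`, so `h + κ²` is coercive and `w(iκ) ≠ 0`.
  let κ : ℝ := Real.sqrt (B + 1)
  have hκ : 0 < κ := Real.sqrt_pos.2 (by linarith)
  have hκ2 : κ ^ 2 = B + 1 := Real.sq_sqrt (by linarith)
  have hc : ∀ x, 1 ≤ V x + κ ^ 2 := fun x => by
    have := (abs_le.1 (hB x)).1
    rw [hκ2]; linarith
  let ζ : ℂ := Complex.I * κ
  have hi : 0 < ζ.im := by simpa [ζ] using hκ
  have hz := mem_closedUpper_of_im_pos hi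
  have hw : jw V ζ ≠ 0 := jw_ne_zero_of_coercive hV hκ hc
  have e : ζ ^ 2 = ((-κ ^ 2 : ℝ) : ℂ) := by
    simp only [ζ]; rw [mul_pow, Complex.I_sq]; push_cast; ring
  have hres : ∀ f, Dec f → ResPair V ((-κ ^ 2 : ℝ) : ℂ) f (resol V ζ f) (resolDeriv V ζ f) := by
    intro f hf
    rw [← e]; exact resPair_resol hV hi hw hf
  let T : decSubmodule →ₗ[ℂ] Lp ℂ 2 (volume : Measure ℝ) :=
    { toFun := fun f => (hres f.1 f.2).dec₀.memLp.toLp _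
      map_add' := fun f g => by
        rw [← MemLp.toLp_add]
        exact MemLp.toLp_congr _ _ (by
          rw [← resol_add hV hz f.2 g.2]; rfl)
      map_smul' := fun c f => by
        rw [RingHom.id_apply, ← MemLp.toLp_const_smul]
        exact MemLp.toLp_congr _ _ (by
          rw [← resol_smul]; rfl) }
  -- Coercivity and Cauchy–Schwarz give `‖Tf‖² ≤ ‖Tf‖ ‖f‖`, so `T` extends by continuity from the
  -- dense subspace of decaying functions.
  have hT : ∀ f : decSubmodule, ‖T f‖ ≤ 1 * ‖decToL2 f‖ := by
    intro f
    have h1 := ResPair.coercive (c := κ ^ 2) hV hc (hres f.1 f.2)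
    rw [← norm_sq_toLp (hres f.1 f.2).dec₀.memLp,
      ← inner_toLp (hres f.1 f.2).dec₀.memLp (Dec.memLp f.2)] at h1
    have h2 := (Complex.re_le_norm _).trans (norm_inner_le_norm (𝕜 := ℂ) (T f) (decToL2 f))
    have h3 : ‖T f‖ ^ 2 ≤ ‖T f‖ * ‖decToL2 f‖ := h1.trans h2
    rw [one_mul]
    rcases (norm_nonneg (T f)).eq_or_lt with h | h
    · rw [← h]; exact norm_nonneg _
    · rw [sq] at h3; exact le_of_mul_le_mul_left h3 h
  let A := T.extendOfNorm decToL2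
  have hA : ∀ f : decSubmodule, A (decToL2 f) = T f :=
    LinearMap.extendOfNorm_eq denseRange_decToL2 ⟨1, hT⟩
  refine ⟨κ ^ 2, A, ?_, ?_⟩
  · rw [ContinuousLinearMap.isSelfAdjoint_iff_isSymmetric]
    intro u v
    change inner ℂ (A u) v = inner ℂ u (A v)
    refine denseRange_decToL2.induction_on₂ (p := fun u v => inner ℂ (A u) v = inner ℂ u (A v))
      ?_ ?_ u v
    · exact isClosed_eq (by fun_prop) (by fun_prop)
    · intro f g
      rw [hA, hA]
      have hf := hres f.1 f.2
      have hg := hres g.1 g.2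
      have h0 := ResPair.symmetric hV (hf.shift 0) (hg.shift 0)
      simp only [sub_zero, zero_mul, add_zero] at h0
      have h1 := ResPair.symmetric hV hf hg
      simp only [mul_add, add_mul, map_add, map_mul, Complex.conj_ofReal] at h1
      have j1 := (hg.dec_f.bdd_mul hf.dec₀.conj.bddCont).integrable
      have j2 := ((hg.dec₀.const_mul ((-κ ^ 2 : ℝ) : ℂ)).bdd_mul hf.dec₀.conj.bddCont).integrable
      have j3 := (hg.dec₀.bdd_mul hf.dec_f.conj.bddCont).integrable
      have j4 := (hg.dec₀.bdd_mul (hf.dec₀.conj.const_mul ((-κ ^ 2 : ℝ) : ℂ)).bddCont).integrable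
      rw [integral_add j1 j2, integral_add j3 j4] at h1
      have e1 : ∫ x, conj (resol V ζ f.1 x) * (((-κ ^ 2 : ℝ) : ℂ) * resol V ζ g.1 x)
          = ∫ x, ((-κ ^ 2 : ℝ) : ℂ) * conj (resol V ζ f.1 x) * resol V ζ g.1 x := by
        congr 1; ext x; ring
      rw [e1] at h1
      have h2 := add_right_cancel h1
      exact (inner_toLp hf.dec₀.memLp hg.dec_f.memLp).trans
        (h2.trans (inner_toLp hf.dec_f.memLp hg.dec₀.memLp).symm)
  · intro f u u' h
    have h1 := hA ⟨f, h.dec_f⟩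
    refine h1.trans (MemLp.toLp_congr (hres f h.dec_f).dec₀.memLp _ ?_)
    have := ResPair.unique hV hc (hres f h.dec_f) h
    rw [this]

theorem resPair_schwartz (hV : ShortRange V) (c : ℝ) (φ : SchwartzMap ℝ ℂ) :
    ResPair V (-c : ℝ) (fun x => -deriv (deriv (fun y => φ y)) x + (V x + c) * φ x)
      φ (SchwartzMap.derivCLM ℂ ℂ φ) := by
  let φ' := SchwartzMap.derivCLM ℂ ℂ φ
  let φ'' := SchwartzMap.derivCLM ℂ ℂ φ'
  have d1 : deriv (fun y => φ y) = φ' := funext fun x => (hasDerivAt_schwartz φ x).deriv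
  have d2 : deriv φ' = φ'' := funext fun x => (hasDerivAt_schwartz φ' x).deriv
  rw [d1, d2]
  have hb : BddCont fun x => (V x : ℂ) + c := by
    simpa using hV.bddCont.sub_const (-c)
  refine ⟨(dec_schwartz φ'').neg.add ((dec_schwartz φ).bdd_mul hb), dec_schwartz φ,
    dec_schwartz φ', hasDerivAt_schwartz φ, fun x => ?_⟩
  refine (hasDerivAt_schwartz φ' x).congr_deriv ?_
  change φ'' x = _
  push_cast; ring

theorem ResPair.conjugate {c : ℝ} {f u u' : ℝ → ℂ} (h : ResPair V c f u u') :
    ResPair V c (fun x => conj (f x)) (fun x => conj (u x)) (fun x => conj (u' x)) where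
  dec_f := h.dec_f.conj
  dec₀ := h.dec₀.conj
  dec₁ := h.dec₁.conj
  deriv₁ x := (h.deriv₁ x).star
  deriv₂ x := (h.deriv₂ x).star.congr_deriv (by simp)

/-- The bounded inverse of `h + c` on `L²`, for `c` large, and its characteristic properties. -/
theorem exists_hamiltonian_inverse (hV : ShortRange V) :
    ∃ (c : ℝ) (A : Lp ℂ 2 (volume : Measure ℝ) →L[ℂ] Lp ℂ 2 (volume : Measure ℝ)),
      IsSelfAdjoint A ∧ (∀ u, A u = 0 → u = 0) ∧
      (∀ z f u u' (h : ResPair V z f u u'), h.dec₀.memLp.toLp u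
        - (z + c) • A (h.dec₀.memLp.toLp u) = A (h.dec_f.memLp.toLp f)) ∧
      ∀ (E m : ℝ) (v : Lp ℂ 2 (volume : Measure ℝ)), A v = (((E + c)⁻¹ : ℝ) : ℂ) • v →
        IsDistribEigen V m (E + m ^ 2) v := by
  obtain ⟨c, A, hA, hres⟩ := exists_inverse_operator hV
  have hweak : ∀ (v : Lp ℂ 2 (volume : Measure ℝ)) f u u' (h : ResPair V (-c : ℝ) f u u'),
      ∫ x, conj (f x) * A v x = ∫ x, conj (u x) * v x := by
    intro v f u u' h
    rw [← inner_toLp_left h.dec_f.memLp, ← inner_toLp_left h.dec₀.memLp, ← hres _ _ _ h]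
    exact (hA.isSymmetric _ _).symm
  -- Every Schwartz function is `A` applied to its image under `h + c`, so a vector in the kernel of
  -- the symmetric `A` is orthogonal to a dense set.
  have hker : ∀ u, A u = 0 → u = 0 := by
    intro u hu
    refine (SchwartzMap.denseRange_toLpCLM (F := ℂ) (E := ℝ) (p := 2) (μ := volume)
      ENNReal.ofNat_ne_top).eq_zero_of_inner_right ℂ fun φ => ?_
    have h := resPair_schwartz hV c φ
    refine (inner_toLp_left h.dec₀.memLp u).trans ?_
    rw [← hweak u _ _ _ h, hu, integral_eq_zero_of_ae]
    filter_upwards [Lp.coeFn_zero ℂ 2 (volume : Measure ℝ)] with x hx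
    rw [hx]; simp
  refine ⟨c, A, hA, hker, ?_, ?_⟩
  · intro z f u u' h
    have h1 := hres _ _ _ (h.shift (-c : ℝ))
    have h2 : ((h.shift (-c : ℝ)).dec_f.memLp.toLp fun x => f x + (z - ((-c : ℝ) : ℂ)) * u x)
        = h.dec_f.memLp.toLp f + (z + c) • h.dec₀.memLp.toLp u := by
      rw [← MemLp.toLp_const_smul, ← MemLp.toLp_add]
      refine MemLp.toLp_congr _ _ (Eventually.of_forall fun x => ?_)
      simp
    rw [h2, map_add, map_smul] at h1
    exact sub_eq_of_eq_add h1.symm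
  · intro E m v hv φ
    -- At `E = -c` the inverse `(E + c)⁻¹` is `0` by convention, and `v` lies in the kernel of `A`,
    -- hence vanishes.
    by_cases hE : E + c = 0
    · rw [hE] at hv
      have : v = 0 := hker v (by simpa using hv)
      subst this
      have h0 : (fun x => (0 : Lp ℂ 2 (volume : Measure ℝ)) x) =ᵐ[volume] 0 := Lp.coeFn_zero _ _ _
      rw [integral_eq_zero_of_ae ?_, integral_eq_zero_of_ae ?_, mul_zero]
      · filter_upwards [h0] with x hx; rw [hx]; simp
      · filter_upwards [h0] with x hx; rw [hx]; simp
    -- The inner product conjugates its first entry whereas the distributional equation is bilinear,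
    -- so the weak form is tested on `conj φ`; `V` and `c` being real, its equation is again of the
    -- same type.
    · have hr := (resPair_schwartz hV c φ).conjugate
      have h1 := hweak v _ _ _ hr
      rw [← inner_toLp_left hr.dec_f.memLp, hv, inner_smul_right, inner_toLp_left] at h1
      simp only [Complex.conj_conj] at h1
      have hE' : (E : ℂ) + c ≠ 0 := by exact_mod_cast hE
      have h2 : ∫ x, (-deriv (deriv (fun y => φ y)) x + (V x + c) * φ x) * v x
          = (E + c) * ∫ x, φ x * v x := by
        rw [← h1]; push_cast; field_simp
      have hvL := Lp.memLp v
      have e : ∀ x, v x * (-deriv (deriv (fun y => φ y)) x + ((V x : ℂ) + (m : ℂ) ^ 2) * φ x)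
          = (-deriv (deriv (fun y => φ y)) x + (V x + c) * φ x) * v x
            + ((m : ℂ) ^ 2 - c) * (φ x * v x) := fun x => by ring
      simp only [e]
      have i1 : Integrable fun x => (-deriv (deriv (fun y => φ y)) x + (V x + c) * φ x) * v x := by
        exact (resPair_schwartz hV c φ).dec_f.memLp.integrable_mul hvL
      have i2 : Integrable fun x => φ x * v x := (dec_schwartz φ).memLp.integrable_mul hvL
      rw [integral_add i1 (i2.const_mul _), h2, integral_const_mul]
      simp only [mul_comm (v _)]
      push_cast; ring

end Operator

/-! ### Boundary values of the resolvent -/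

section GreenForm

variable {V : ℝ → ℝ}

/-- The quadratic form `(f, (h - ζ²)⁻¹ f)`. -/
def greenForm (V : ℝ → ℝ) (ζ : ℂ) (f : ℝ → ℂ) : ℂ :=
  ∫ p : ℝ × ℝ, conj (f p.1) * (green V ζ p.1 p.2 * f p.2)

/-- The points of the closed upper half plane where the resolvent has boundary values. -/
def regularSet (V : ℝ → ℝ) : Set ℂ := {ζ | ζ ∈ closedUpper ∧ jw V ζ ≠ 0}

theorem greenBound_nonneg (V : ℝ → ℝ) (ζ : ℂ) : 0 ≤ greenBound V ζ :=
  div_nonneg (mul_nonneg (jostBound_pos _ _).le (jostBound_pos _ _).le) (norm_nonneg _)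

theorem norm_green_le' (hV : ShortRange V) {ζ : ℂ} (hζ : ζ ∈ closedUpper) (x y : ℝ) :
    ‖green V ζ x y‖ ≤ greenBound V ζ := by
  refine (norm_green_le hV hζ x y).trans (mul_le_of_le_one_right (greenBound_nonneg V ζ) ?_)
  rw [Real.exp_le_one_iff, neg_nonpos]
  exact mul_nonneg hζ.1 (abs_nonneg _)

theorem continuous_greenForm_integrand (hV : ShortRange V) {ζ : ℂ} (hζ : ζ ∈ closedUpper)
    {f : ℝ → ℂ} (hf : Dec f) :
    Continuous fun p : ℝ × ℝ => conj (f p.1) * (green V ζ p.1 p.2 * f p.2) := by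
  have h1 := continuous_green hV hζ
  have h2 := hf.1
  have h3 : Continuous fun p : ℝ × ℝ => conj (f p.1) :=
    Complex.continuous_conj.comp (h2.comp continuous_fst)
  exact h3.mul (h1.mul (h2.comp continuous_snd))

theorem norm_greenForm_integrand_le (hV : ShortRange V) {ζ : ℂ} (hζ : ζ ∈ closedUpper)
    (f : ℝ → ℂ) (p : ℝ × ℝ) :
    ‖conj (f p.1) * (green V ζ p.1 p.2 * f p.2)‖ ≤ greenBound V ζ * (‖f p.1‖ * ‖f p.2‖) := by
  rw [norm_mul, norm_mul, RCLike.norm_conj]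
  have := mul_le_mul_of_nonneg_right (norm_green_le' hV hζ p.1 p.2)
    (mul_nonneg (norm_nonneg (f p.1)) (norm_nonneg (f p.2)))
  linarith

theorem integrable_norm_mul_norm {f : ℝ → ℂ} (hf : Dec f) :
    Integrable fun p : ℝ × ℝ => ‖f p.1‖ * ‖f p.2‖ :=
  hf.integrable.norm.mul_prod hf.integrable.norm

theorem integrable_greenForm (hV : ShortRange V) {ζ : ℂ} (hζ : ζ ∈ closedUpper)
    {f : ℝ → ℂ} (hf : Dec f) :
    Integrable fun p : ℝ × ℝ => conj (f p.1) * (green V ζ p.1 p.2 * f p.2) :=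
  ((integrable_norm_mul_norm hf).const_mul (greenBound V ζ)).mono'
    (continuous_greenForm_integrand hV hζ hf).aestronglyMeasurable
    (Eventually.of_forall (norm_greenForm_integrand_le hV hζ f))

theorem greenForm_eq (hV : ShortRange V) {ζ : ℂ} (hζ : ζ ∈ closedUpper)
    {f : ℝ → ℂ} (hf : Dec f) : greenForm V ζ f = ∫ x, conj (f x) * resol V ζ f x := by
  have hi := integrable_greenForm hV hζ hf
  rw [greenForm]
  rw [Measure.volume_eq_prod] at hi ⊢
  rw [integral_prod _ hi]
  refine integral_congr_ae (Eventually.of_forall fun x => ?_)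
  simp only [resol, integral_const_mul]

/-- The point `x = 0` suffices, because `w` may be evaluated there; for `y > 0` the exponential is
bounded by `1` on the whole closed half plane. -/
theorem continuousOn_jostA (hV : ShortRange V) : ContinuousOn (fun ζ => jostA V ζ 0) closedUpper := by
  have hj := continuousOn_jostAmp hV
  intro ζ₀ h₀
  have hr : 0 < ‖ζ₀‖ := norm_pos_iff.2 h₀.2
  refine continuousWithinAt_of_dominated
    (bound := fun y => |V y| * (2 * Real.exp (2 * (∫ y, |V y|) / (‖ζ₀‖ / 2)))) ?_ ?_ ?_ ?_
  · filter_upwards [self_mem_nhdsWithin] with ζ hζ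
    have := continuous_V_mul_jostAmp hV hζ
    exact Continuous.aestronglyMeasurable (by fun_prop)
  · have hn : ∀ᶠ ζ in 𝓝[closedUpper] ζ₀, ‖ζ₀‖ / 2 < ‖ζ‖ :=
      nhdsWithin_le_nhds (continuous_norm.continuousAt.eventually (lt_mem_nhds (by linarith)))
    filter_upwards [self_mem_nhdsWithin, hn] with ζ hζ h2
    refine (ae_restrict_iff' measurableSet_Ioi).2 (Eventually.of_forall fun y hy => ?_)
    rw [norm_mul]
    refine (mul_le_of_le_one_left (norm_nonneg _)
      (norm_exp_two_I_mul_le hζ.1 (le_of_lt hy))).trans ?_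
    refine (norm_V_mul_jostAmp_le hV hζ y).trans ?_
    have : 0 ≤ ∫ y, |V y| := integral_nonneg fun y => abs_nonneg _
    unfold jostBound
    gcongr
  · exact (hV.int.abs.mul_const _).integrableOn
  · refine Eventually.of_forall fun y => ?_
    have h1 : ContinuousWithinAt (fun ζ => jostAmp V y ζ) closedUpper ζ₀ :=
      (hj.comp (f := fun ζ : ℂ => (y, ζ)) (by fun_prop) fun ζ hζ => ⟨trivial, hζ⟩) ζ₀ h₀
    have h2 : ContinuousWithinAt (fun ζ : ℂ => Complex.exp (2 * Complex.I * ζ * y)) closedUpper ζ₀ :=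
      Continuous.continuousWithinAt (by fun_prop)
    exact h2.mul (continuousWithinAt_const.mul h1)

theorem continuousOn_jostB (hV : ShortRange V) : ContinuousOn (fun ζ => jostB V ζ 0) closedUpper := by
  have hj := continuousOn_jostAmp hV
  intro ζ₀ h₀
  have hr : 0 < ‖ζ₀‖ := norm_pos_iff.2 h₀.2
  refine continuousWithinAt_of_dominated
    (bound := fun y => |V y| * (2 * Real.exp (2 * (∫ y, |V y|) / (‖ζ₀‖ / 2)))) ?_ ?_ ?_ ?_
  · filter_upwards [self_mem_nhdsWithin] with ζ hζ
    exact (continuous_V_mul_jostAmp hV hζ).aestronglyMeasurable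
  · have hn : ∀ᶠ ζ in 𝓝[closedUpper] ζ₀, ‖ζ₀‖ / 2 < ‖ζ‖ :=
      nhdsWithin_le_nhds (continuous_norm.continuousAt.eventually (lt_mem_nhds (by linarith)))
    filter_upwards [self_mem_nhdsWithin, hn] with ζ hζ h2
    refine Eventually.of_forall fun y => ?_
    refine (norm_V_mul_jostAmp_le hV hζ y).trans ?_
    have : 0 ≤ ∫ y, |V y| := integral_nonneg fun y => abs_nonneg _
    unfold jostBound
    gcongr
  · exact (hV.int.abs.mul_const _).integrableOn
  · refine Eventually.of_forall fun y => ?_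
    have h1 : ContinuousWithinAt (fun ζ => jostAmp V y ζ) closedUpper ζ₀ :=
      (hj.comp (f := fun ζ : ℂ => (y, ζ)) (by fun_prop) fun ζ hζ => ⟨trivial, hζ⟩) ζ₀ h₀
    exact continuousWithinAt_const.mul h1

theorem continuousOn_jostSol_right (hV : ShortRange V) (x : ℝ) :
    ContinuousOn (fun ζ => jostSol V ζ x) closedUpper := by
  have h1 : ContinuousOn (fun ζ => jostAmp V x ζ) closedUpper :=
    (continuousOn_jostAmp hV).comp (f := fun ζ : ℂ => (x, ζ)) (by fun_prop)
      fun ζ hζ => ⟨trivial, hζ⟩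
  exact ContinuousOn.mul (by fun_prop) h1

theorem continuousOn_jostSolDeriv_zero (hV : ShortRange V) :
    ContinuousOn (fun ζ => jostSolDeriv V ζ 0) closedUpper := by
  have h1 := continuousOn_jostA hV
  have h2 := continuousOn_jostB hV
  unfold jostSolDeriv
  fun_prop

theorem continuousOn_jw (hV : ShortRange V) : ContinuousOn (jw V) closedUpper := by
  have h1 := continuousOn_jostSolDeriv_zero hV
  have h2 := continuousOn_jostSolDeriv_zero hV.comp_neg
  have h3 := continuousOn_jostSol_right hV 0
  have h4 := continuousOn_jostSol_right hV.comp_neg 0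
  have e : jw V = fun ζ => jostSolDeriv V ζ 0 * jostSol (fun x => V (-x)) ζ 0
      - jostSol V ζ 0 * (-jostSolDeriv (fun x => V (-x)) ζ 0) := by
    ext ζ; simp [jw, jostSolM, jostSolMDeriv]
  rw [e]
  exact (h1.mul h4).sub (h3.mul h2.neg)

theorem continuousOn_jostBound (V : ℝ → ℝ) : ContinuousOn (jostBound V) closedUpper := by
  unfold jostBound
  refine continuousOn_const.mul (Real.continuous_exp.comp_continuousOn ?_)
  exact ContinuousOn.div continuousOn_const continuous_norm.continuousOn
    fun ζ hζ => norm_ne_zero_iff.2 hζ.2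

theorem regularSet_subset (V : ℝ → ℝ) : regularSet V ⊆ closedUpper := fun _ h => h.1

theorem continuousOn_greenBound (hV : ShortRange V) :
    ContinuousOn (greenBound V) (regularSet V) := by
  unfold greenBound
  refine ContinuousOn.div ?_ ((continuousOn_jw hV).mono (regularSet_subset V)).norm
    fun ζ hζ => norm_ne_zero_iff.2 hζ.2
  exact ((continuousOn_jostBound V).mul (continuousOn_jostBound _)).mono (regularSet_subset V)

theorem continuousOn_green (hV : ShortRange V) (x y : ℝ) :
    ContinuousOn (fun ζ => green V ζ x y) (regularSet V) := by
  unfold green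
  refine ContinuousOn.div ?_ ((continuousOn_jw hV).mono (regularSet_subset V)) fun ζ hζ => hζ.2
  have h1 := (continuousOn_jostSol_right hV (max x y)).mono (regularSet_subset V)
  have h2 := (continuousOn_jostSol_right hV.comp_neg (-min x y)).mono (regularSet_subset V)
  exact (h1.mul h2).neg

/-- Limiting absorption for integrable `f`: the Green function is bounded locally uniformly in `ζ`,
including real `ζ ≠ 0`, so dominated convergence applies to the double integral. -/
theorem continuousOn_greenForm (hV : ShortRange V) {f : ℝ → ℂ} (hf : Dec f) :
    ContinuousOn (fun ζ => greenForm V ζ f) (regularSet V) := by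
  intro ζ₀ h₀
  refine continuousWithinAt_of_dominated
    (bound := fun p => (greenBound V ζ₀ + 1) * (‖f p.1‖ * ‖f p.2‖)) ?_ ?_ ?_ ?_
  · filter_upwards [self_mem_nhdsWithin] with ζ hζ
    exact (continuous_greenForm_integrand hV hζ.1 hf).aestronglyMeasurable
  · have hn : ∀ᶠ ζ in 𝓝[regularSet V] ζ₀, greenBound V ζ < greenBound V ζ₀ + 1 :=
      (continuousOn_greenBound hV ζ₀ h₀).eventually (gt_mem_nhds (by linarith))
    filter_upwards [self_mem_nhdsWithin, hn] with ζ hζ h2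
    refine Eventually.of_forall fun p => (norm_greenForm_integrand_le hV hζ.1 f p).trans ?_
    exact mul_le_mul_of_nonneg_right h2.le (by positivity)
  · exact (integrable_norm_mul_norm hf).const_mul _
  · refine Eventually.of_forall fun p => ?_
    exact continuousWithinAt_const.mul ((continuousOn_green hV p.1 p.2 ζ₀ h₀).mul
      continuousWithinAt_const)

/-- The spectral measure on an interval on which the resolvent has boundary values. -/
theorem measureReal_Icc_eq (hV : ShortRange V) {f : ℝ → ℂ} (hf : Dec f) {ν : Measure ℝ}
    [IsFiniteMeasure ν]
    (hν : ∀ ζ : ℂ, 0 < ζ.im → (ζ ^ 2).im ≠ 0 → greenForm V ζ f = ∫ s : ℝ, 1 / ((s : ℂ) - ζ ^ 2) ∂ν)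
    (σ : ℂ → ℂ) {a b : ℝ} (hab : a < b) (hσ₁ : ∀ z, 0 < z.im → 0 < (σ z).im ∧ σ z ^ 2 = z)
    (hσ₂ : ContinuousOn (fun p : ℝ × ℝ => σ (p.1 + p.2 * Complex.I)) (Set.Icc a b ×ˢ Set.Icc 0 1))
    (hσ₃ : ∀ x ∈ Set.Icc a b, σ (x : ℝ) ∈ regularSet V) :
    ν.real (Set.Icc a b) = Real.pi⁻¹ * ∫ x in a..b, (greenForm V (σ (x : ℝ)) f).im := by
  -- Here `σ` is a branch of `ζ = √z` continuous up to the interval. Regularity on the open part is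
  -- automatic, since `z` is not real there; on the bottom edge it is the assumption `hσ₃`.
  have hmaps : Set.MapsTo (fun p : ℝ × ℝ => σ (p.1 + p.2 * Complex.I)) (Set.Icc a b ×ˢ Set.Icc 0 1)
      (regularSet V) := by
    rintro ⟨x, ε⟩ ⟨hx, hε⟩
    rcases hε.1.eq_or_lt with h | h
    · dsimp only at h ⊢
      rw [← h]
      simpa using hσ₃ x hx
    · have him : 0 < ((x : ℂ) + ε * Complex.I).im := by simpa using h
      obtain ⟨h1, h2⟩ := hσ₁ _ him
      refine ⟨mem_closedUpper_of_im_pos h1, jw_ne_zero_of_im_sq_ne_zero hV h1 ?_⟩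
      dsimp only
      rw [h2]; exact him.ne'
  have hc : ContinuousOn (fun p : ℝ × ℝ => (greenForm V (σ (p.1 + p.2 * Complex.I)) f).im)
      (Set.Icc a b ×ˢ Set.Icc 0 1) :=
    Complex.continuous_im.comp_continuousOn ((continuousOn_greenForm hV hf).comp hσ₂ hmaps)
  obtain ⟨M, hM⟩ := (isCompact_Icc.prod isCompact_Icc).exists_bound_of_continuousOn hc
  refine measureReal_Icc_of_stieltjes (F := fun z => greenForm V (σ z) f) (M := M) ?_ hab ?_ ?_
  · intro z hz
    obtain ⟨h1, h2⟩ := hσ₁ z hz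
    have := hν (σ z) h1 (by rw [h2]; exact hz.ne')
    rw [h2] at this
    exact this
  · intro x hx
    have h1 : ContinuousOn (fun ε : ℝ => (greenForm V (σ (x + ε * Complex.I)) f).im)
        (Set.Icc 0 1) :=
      hc.comp (f := fun ε : ℝ => (x, ε)) (by fun_prop) fun ε hε => ⟨hx, hε⟩
    have h2 := h1 0 ⟨le_rfl, zero_le_one⟩
    have h3 : 𝓝[>] (0 : ℝ) ≤ 𝓝[Set.Icc 0 1] 0 := by
      rw [← nhdsWithin_Ioc_eq_nhdsGT (zero_lt_one' ℝ)]
      exact nhdsWithin_mono _ Set.Ioc_subset_Icc_self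
    have h4 := h2.tendsto.mono_left h3
    simpa using h4
  · intro x hx ε hε
    exact hM (x, ε) ⟨hx, ⟨hε.1.le, hε.2⟩⟩

/-- The branch of the square root that is continuous off the negative half axis. -/
def sqrtP (z : ℂ) : ℂ := Complex.exp (Complex.log z / 2)

/-- The branch of the square root that is continuous off the positive half axis, with values in
the upper half plane. -/
def sqrtM (z : ℂ) : ℂ := Complex.I * sqrtP (-z)

theorem sqrtP_sq {z : ℂ} (hz : z ≠ 0) : sqrtP z ^ 2 = z := by
  rw [sqrtP, ← Complex.exp_nat_mul]
  have : ((2 : ℕ) : ℂ) * (Complex.log z / 2) = Complex.log z := by push_cast; ring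
  rw [this, Complex.exp_log hz]

theorem sqrtP_ofReal {x : ℝ} (hx : 0 < x) : sqrtP x = (Real.sqrt x : ℝ) := by
  rw [sqrtP, ← Complex.ofReal_log hx.le, Real.sqrt_eq_rpow, Real.rpow_def_of_pos hx]
  push_cast; ring_nf

theorem sqrtP_im_pos {z : ℂ} (hz : 0 < z.im) : 0 < (sqrtP z).im := by
  rw [sqrtP, Complex.exp_im]
  refine mul_pos (Real.exp_pos _) (Real.sin_pos_of_pos_of_lt_pi ?_ ?_)
  · simp only [Complex.div_ofNat_im, Complex.log_im]
    have h1 := Complex.arg_nonneg_iff.2 hz.le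
    have h2 : Complex.arg z ≠ 0 := fun h => by
      have := (Complex.arg_eq_zero_iff.1 h).2
      exact hz.ne' this
    have : 0 < Complex.arg z := lt_of_le_of_ne h1 h2.symm
    linarith
  · simp only [Complex.div_ofNat_im, Complex.log_im]
    have := Complex.arg_le_pi z
    linarith [Real.pi_pos]

theorem sqrtM_im_pos {z : ℂ} (hz : 0 < z.im) : 0 < (sqrtM z).im := by
  have h : (sqrtM z).im = (sqrtP (-z)).re := by simp [sqrtM]
  rw [h, sqrtP, Complex.exp_re]
  refine mul_pos (Real.exp_pos _) (Real.cos_pos_of_mem_Ioo ⟨?_, ?_⟩)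
  · simp only [Complex.div_ofNat_im, Complex.log_im]
    have := Complex.neg_pi_lt_arg (-z)
    linarith
  · simp only [Complex.div_ofNat_im, Complex.log_im]
    have : Complex.arg (-z) < 0 := Complex.arg_neg_iff.2 (by simpa using hz)
    linarith [Real.pi_pos]

theorem ne_zero_of_im_pos {z : ℂ} (hz : 0 < z.im) : z ≠ 0 := fun h => by simp [h] at hz

theorem sqrtM_sq {z : ℂ} (hz : z ≠ 0) : sqrtM z ^ 2 = z := by
  rw [sqrtM, mul_pow, sqrtP_sq (neg_ne_zero.2 hz), Complex.I_sq]; ring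

theorem continuousAt_sqrtP {z : ℂ} (hz : z ∈ Complex.slitPlane) : ContinuousAt sqrtP z :=
  Complex.continuous_exp.continuousAt.comp ((continuousAt_clog hz).div_const 2)

/-- The substitution `s = k²`; `w` does not vanish at real `k ≠ 0`, so every compact interval of
positive energies is regular. -/
theorem measureReal_Icc_pos (hV : ShortRange V) {f : ℝ → ℂ} (hf : Dec f) {ν : Measure ℝ}
    [IsFiniteMeasure ν]
    (hν : ∀ ζ : ℂ, 0 < ζ.im → (ζ ^ 2).im ≠ 0 → greenForm V ζ f = ∫ s : ℝ, 1 / ((s : ℂ) - ζ ^ 2) ∂ν)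
    {a b : ℝ} (ha : 0 < a) (hab : a < b) :
    ν.real (Set.Icc (a ^ 2) (b ^ 2)) = Real.pi⁻¹ * ∫ k in a..b, (greenForm V k f).im * (2 * k) := by
  have hb : 0 < b := ha.trans hab
  have ha2 : 0 < a ^ 2 := by positivity
  have hreg : ∀ x ∈ Set.Icc (a ^ 2) (b ^ 2), sqrtP (x : ℝ) ∈ regularSet V := by
    intro x hx
    have hx0 : 0 < x := ha2.trans_le hx.1
    rw [sqrtP_ofReal hx0]
    have h := (Real.sqrt_pos.2 hx0).ne'
    exact ⟨ofReal_mem_closedUpper h, jw_ofReal_ne_zero hV h⟩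
  have hslit : ∀ p ∈ Set.Icc (a ^ 2) (b ^ 2) ×ˢ Set.Icc (0 : ℝ) 1,
      ((p.1 : ℂ) + p.2 * Complex.I) ∈ Complex.slitPlane := by
    rintro ⟨x, ε⟩ ⟨hx, _⟩
    left
    simpa using ha2.trans_le hx.1
  have hab2 : a ^ 2 < b ^ 2 := by nlinarith
  rw [measureReal_Icc_eq hV hf hν sqrtP hab2
    (fun z hz => ⟨sqrtP_im_pos hz, sqrtP_sq (ne_zero_of_im_pos hz)⟩)
    (fun p hp => ((continuousAt_sqrtP (hslit p hp)).comp (f := fun p : ℝ × ℝ =>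
      (p.1 : ℂ) + p.2 * Complex.I) (by fun_prop)).continuousWithinAt) hreg]
  congr 1
  have hc : ContinuousOn (fun x : ℝ => (greenForm V (sqrtP x) f).im) (Set.Icc (a ^ 2) (b ^ 2)) := by
    refine Complex.continuous_im.comp_continuousOn ((continuousOn_greenForm hV hf).comp
      (f := fun x : ℝ => sqrtP x) (fun x hx => ?_) hreg)
    have : (x : ℂ) ∈ Complex.slitPlane := by left; simpa using ha2.trans_le hx.1
    exact ((continuousAt_sqrtP this).comp (f := fun x : ℝ => (x : ℂ))
      (by fun_prop)).continuousWithinAt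
  have h := intervalIntegral.integral_comp_mul_deriv' (a := a) (b := b) (f := fun k => k ^ 2)
    (f' := fun k => 2 * k) (g := fun x : ℝ => (greenForm V (sqrtP x) f).im)
    (fun k _ => by simpa using hasDerivAt_pow 2 k) (by fun_prop) (hc.mono ?_)
  · rw [← h]
    refine intervalIntegral.integral_congr fun k hk => ?_
    rw [Set.uIcc_of_le hab.le] at hk
    have hk0 : 0 < k := ha.trans_le hk.1
    simp only [Function.comp]
    rw [sqrtP_ofReal (by positivity), Real.sqrt_sq hk0.le]
  · rintro _ ⟨k, hk, rfl⟩
    rw [Set.uIcc_of_le hab.le] at hk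
    exact ⟨pow_le_pow_left₀ ha.le hk.1 2, pow_le_pow_left₀ (ha.le.trans hk.1) hk.2 2⟩

/-- At the real energy `-κ²`, outside the zeros of `w`, the resolvent is symmetric and its quadratic
form is real. -/
theorem greenForm_im_eq_zero (hV : ShortRange V) {f : ℝ → ℂ} (hf : Dec f) {κ : ℝ} (hκ : 0 < κ)
    (hw : jw V (Complex.I * κ) ≠ 0) : (greenForm V (Complex.I * κ) f).im = 0 := by
  have hi : 0 < (Complex.I * (κ : ℂ)).im := by simpa using hκ
  have e : (Complex.I * (κ : ℂ)) ^ 2 = ((-κ ^ 2 : ℝ) : ℂ) := by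
    rw [mul_pow, Complex.I_sq]; push_cast; ring
  have h := resPair_resol hV hi hw hf
  rw [e] at h
  have hs := ResPair.symmetric hV h h
  rw [greenForm_eq hV (mem_closedUpper_of_im_pos hi) hf]
  set u := resol V (Complex.I * κ) f
  simp only [mul_add, add_mul, map_add, map_mul, Complex.conj_ofReal] at hs
  have j1 := (hf.bdd_mul h.dec₀.conj.bddCont).integrable
  have j2 := ((h.dec₀.const_mul ((-κ ^ 2 : ℝ) : ℂ)).bdd_mul h.dec₀.conj.bddCont).integrable
  have j3 := (h.dec₀.bdd_mul hf.conj.bddCont).integrable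
  have j4 := (h.dec₀.bdd_mul (h.dec₀.conj.const_mul ((-κ ^ 2 : ℝ) : ℂ)).bddCont).integrable
  rw [integral_add j1 j2, integral_add j3 j4] at hs
  have e1 : ∫ x, conj (u x) * (((-κ ^ 2 : ℝ) : ℂ) * u x)
      = ∫ x, ((-κ ^ 2 : ℝ) : ℂ) * conj (u x) * u x := by
    congr 1; ext x; ring
  rw [e1] at hs
  have h2 := add_right_cancel hs
  rw [← Complex.conj_eq_iff_im, ← integral_conj, ← h2]
  congr 1; ext x
  simp; ring

theorem exists_measure_nhds_eq_zero (hV : ShortRange V) {f : ℝ → ℂ} (hf : Dec f) {ν : Measure ℝ}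
    [IsFiniteMeasure ν]
    (hν : ∀ ζ : ℂ, 0 < ζ.im → (ζ ^ 2).im ≠ 0 → greenForm V ζ f = ∫ s : ℝ, 1 / ((s : ℂ) - ζ ^ 2) ∂ν)
    {E : ℝ} (hE : E < 0) (hw : jw V (Complex.I * Real.sqrt (-E)) ≠ 0) :
    ∃ U ∈ 𝓝 E, ν U = 0 := by
  -- The branch cut must avoid the negative energies, hence `sqrtM`. The nonvanishing of `w` at `E`
  -- persists nearby by continuity, and the density there is the imaginary part of a real form.
  have hsM : ∀ x : ℝ, x < 0 → sqrtM x = Complex.I * Real.sqrt (-x) := by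
    intro x hx
    rw [sqrtM, ← sqrtP_ofReal (neg_pos.2 hx)]
    push_cast; rfl
  have hmem : ∀ x : ℝ, x < 0 → Complex.I * (Real.sqrt (-x) : ℂ) ∈ closedUpper := by
    intro x hx
    refine mem_closedUpper_of_im_pos ?_
    simpa using hx
  have hcw : ContinuousOn (fun x : ℝ => jw V (Complex.I * Real.sqrt (-x))) (Set.Iio 0) := by
    refine (continuousOn_jw hV).comp (f := fun x : ℝ => Complex.I * (Real.sqrt (-x) : ℂ)) ?_ hmem
    have : Continuous fun x : ℝ => Real.sqrt (-x) := Real.continuous_sqrt.comp continuous_neg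
    fun_prop
  have hev : ∀ᶠ x in 𝓝 E, x < 0 ∧ jw V (Complex.I * Real.sqrt (-x)) ≠ 0 :=
    (gt_mem_nhds hE).and
      ((hcw.continuousAt (isOpen_Iio.mem_nhds hE)).eventually_ne hw)
  obtain ⟨δ, hδ, hball⟩ := Metric.nhds_basis_closedBall.eventually_iff.1 hev
  have hIcc : ∀ x ∈ Set.Icc (E - δ) (E + δ), x < 0 ∧ jw V (Complex.I * Real.sqrt (-x)) ≠ 0 := by
    intro x hx
    refine hball ?_
    rw [Real.closedBall_eq_Icc]; exact hx
  refine ⟨Set.Icc (E - δ) (E + δ), Icc_mem_nhds (by linarith) (by linarith), ?_⟩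
  rw [← measureReal_eq_zero_iff]
  rw [measureReal_Icc_eq hV hf hν sqrtM (by linarith)
    (fun z hz => ⟨sqrtM_im_pos hz, sqrtM_sq (ne_zero_of_im_pos hz)⟩) ?_ ?_]
  · rw [intervalIntegral.integral_congr (g := fun _ => (0 : ℝ))]
    · simp
    · intro x hx
      rw [Set.uIcc_of_le (by linarith)] at hx
      obtain ⟨h1, h2⟩ := hIcc x hx
      dsimp only
      rw [hsM x h1]
      exact greenForm_im_eq_zero hV hf (Real.sqrt_pos.2 (neg_pos.2 h1)) h2
  · intro p hp
    have hp1 := (hIcc p.1 hp.1).1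
    have : -((p.1 : ℂ) + p.2 * Complex.I) ∈ Complex.slitPlane := by left; simpa using hp1
    refine ContinuousAt.continuousWithinAt (continuousAt_const.mul ?_)
    exact (continuousAt_sqrtP this).comp (f := fun p : ℝ × ℝ =>
      -((p.1 : ℂ) + p.2 * Complex.I)) (by fun_prop)
  · intro x hx
    obtain ⟨h1, h2⟩ := hIcc x hx
    rw [hsM x h1]
    exact ⟨hmem x h1, h2⟩

end GreenForm

/-! ### The spectral density on the positive half axis -/

section SpectralDensity

variable {V : ℝ → ℝ}

/-- The jump across the continuous spectrum has rank two: both `G` and `conj G` solve the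
homogeneous equation in each variable with opposite-signed identical singularities, and rewriting in
Jost solutions leaves only the two outgoing channels. -/
theorem green_sub_conj_of_le (hV : ShortRange V) {k : ℝ} (hk : k ≠ 0) {x y : ℝ} (hxy : y ≤ x) :
    green V k x y - conj (green V k x y)
      = 2 * Complex.I * k / (jw V k * conj (jw V k)) *
        (jostSol V k x * conj (jostSol V k y) + jostSolM V k x * conj (jostSolM V k y)) := by
  have hζ := ofReal_mem_closedUpper hk
  have hw := jw_ofReal_ne_zero hV hk
  have hw' : conj (jw V k) ≠ 0 := by simpa using hw
  have hc : ∀ u u' : ℝ → ℂ, SolPair V ((k : ℂ) ^ 2) u u' →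
      SolPair V ((k : ℂ) ^ 2) (fun x => conj (u x)) (fun x => conj (u' x)) := fun u u' h => by
    simpa using h.conjugate
  have hp := solPair_jostSol hV hζ
  have hq := solPair_jostSolM hV hζ
  have ha := hq.wronskian_eq (hc _ _ hp) x y
  have hp1 := jostSol_wronskian_conj hV hk x
  have hp2 := jostSolM_wronskian_conj hV hk y
  have hwx := jw_eq hV hζ x
  have hwy := congrArg conj (jw_eq hV hζ y)
  simp only [map_sub, map_mul] at hwy ha
  rw [green, max_eq_left hxy, min_eq_right hxy]
  generalize jw V k = w at *
  simp only [map_neg, map_mul, map_div₀]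
  generalize jostSol V k x = p at *
  generalize jostSolDeriv V k x = p' at *
  generalize jostSolM V k x = q at *
  generalize jostSolMDeriv V k x = q' at *
  generalize jostSol V k y = r at *
  generalize jostSolDeriv V k y = r' at *
  generalize jostSolM V k y = s at *
  generalize jostSolMDeriv V k y = s' at *
  -- Connection formulas: `conj θ₊` in the basis `θ₊, θ₋` at `x`, and below `θ₋` in the conjugate
  -- basis at `y`. Both contain the coefficient `W(θ₋, conj θ₊)`, and `ha` identifies its values at
  -- `x` and `y`.
  have h1 : conj p * w = -p * (q' * conj p - q * conj p') + 2 * Complex.I * k * q := by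
    linear_combination (-conj p) * hwx + q * hp1
  have h2 : s * conj w = -(2 * Complex.I * k) * conj r - conj s * (s' * conj r - s * conj r') := by
    linear_combination (-s) * hwy + conj r * hp2
  field_simp
  linear_combination conj s * h1 - p * h2 - p * conj s * ha

theorem green_sub_conj (hV : ShortRange V) {k : ℝ} (hk : k ≠ 0) (x y : ℝ) :
    green V k x y - conj (green V k x y)
      = 2 * Complex.I * k / (jw V k * conj (jw V k)) *
        (jostSol V k x * conj (jostSol V k y) + jostSolM V k x * conj (jostSolM V k y)) := by
  rcases le_total y x with h | h
  · exact green_sub_conj_of_le hV hk h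
  · have e := congrArg conj (green_sub_conj_of_le hV hk h)
    rw [green_comm]
    simp only [map_sub, map_mul, map_add, map_div₀, Complex.conj_conj, Complex.conj_I,
      Complex.conj_ofReal, map_ofNat] at e
    linear_combination (exp := 1) -e

theorem pairing_const_mul_left (c : ℂ) (u f : ℝ → ℂ) :
    pairing (fun x => c * u x) f = conj c * pairing u f := by
  simp only [pairing, map_mul, mul_assoc, integral_const_mul]

theorem integrable_pairing {u f : ℝ → ℂ} (hu : BddCont u) (hf : Dec f) :
    Integrable fun x => conj (u x) * f x := (hf.bdd_mul hu.conj).integrable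

theorem integral_rankOne {u f : ℝ → ℂ} (hu : BddCont u) (hf : Dec f) :
    Integrable (fun p : ℝ × ℝ => conj (f p.1) * (u p.1 * conj (u p.2) * f p.2)) ∧
    ∫ p : ℝ × ℝ, conj (f p.1) * (u p.1 * conj (u p.2) * f p.2) = (‖pairing u f‖ ^ 2 : ℝ) := by
  have h1 := integrable_pairing hu hf
  have h2 : Integrable fun x => conj (f x) * u x := by
    refine (hf.conj.bdd_mul hu).integrable.congr (Eventually.of_forall fun x => ?_)
    exact mul_comm _ _
  have e : (fun p : ℝ × ℝ => conj (f p.1) * (u p.1 * conj (u p.2) * f p.2))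
      = fun p => (conj (f p.1) * u p.1) * (conj (u p.2) * f p.2) := by ext p; ring
  rw [e]
  refine ⟨h2.mul_prod h1, ?_⟩
  rw [Measure.volume_eq_prod, integral_prod_mul (fun x => conj (f x) * u x)
    fun x => conj (u x) * f x]
  have e2 : ∫ x, conj (f x) * u x = conj (pairing u f) := by
    rw [pairing, ← integral_conj]
    congr 1; ext x
    simp [mul_comm]
  rw [e2, ← pairing, mul_comm, Complex.mul_conj, Complex.normSq_eq_norm_sq]

theorem greenForm_sub_conj (hV : ShortRange V) {k : ℝ} (hk : k ≠ 0) {f : ℝ → ℂ} (hf : Dec f) :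
    greenForm V k f - conj (greenForm V k f)
      = 2 * Complex.I * k / (jw V k * conj (jw V k)) *
        ((‖pairing (jostSol V k) f‖ ^ 2 + ‖pairing (jostSolM V k) f‖ ^ 2 : ℝ) : ℂ) := by
  have hζ := ofReal_mem_closedUpper hk
  have hi := integrable_greenForm hV hζ hf
  obtain ⟨ip, ep⟩ := integral_rankOne (bddCont_jostSol hV hk).1 hf
  obtain ⟨iq, eq⟩ := integral_rankOne (bddCont_jostSolM hV hk).1 hf
  have hc : conj (greenForm V k f)
      = ∫ p : ℝ × ℝ, conj (f p.1) * (conj (green V k p.1 p.2) * f p.2) := by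
    rw [greenForm, ← integral_conj, Measure.volume_eq_prod, ← integral_prod_swap]
    congr 1; ext p
    simp only [Prod.fst_swap, Prod.snd_swap, map_mul, Complex.conj_conj]
    rw [green_comm]; ring
  have hi' : Integrable fun p : ℝ × ℝ => conj (f p.1) * (conj (green V k p.1 p.2) * f p.2) := by
    refine hi.norm.mono' ?_ (Eventually.of_forall fun p => ?_)
    · have h1 := continuous_green hV hζ
      have h2 := hf.1
      have h3 : Continuous fun p : ℝ × ℝ => conj (f p.1) :=
        Complex.continuous_conj.comp (h2.comp continuous_fst)
      have h4 : Continuous fun p : ℝ × ℝ => conj (green V k p.1 p.2) :=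
        Complex.continuous_conj.comp h1
      exact Continuous.aestronglyMeasurable (by fun_prop)
    · simp only [norm_mul, RCLike.norm_conj, le_refl]
  rw [hc, greenForm, ← integral_sub hi hi', Complex.ofReal_add, ← ep, ← eq, ← integral_add ip iq,
    ← integral_const_mul]
  congr 1; ext p
  linear_combination conj (f p.1) * f p.2 * green_sub_conj hV hk p.1 p.2

/-- The density of the spectral measure of `f` on the continuous spectrum. -/
theorem greenForm_im (hV : ShortRange V) {k : ℝ} (hk : 0 < k) {f : ℝ → ℂ} (hf : Dec f) :
    (greenForm V k f).im * (2 * k)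
      = (‖pairing (jostPsi V k) f‖ ^ 2 + ‖pairing (jostPsi V (-k)) f‖ ^ 2) / 2 := by
  have hw := jw_ofReal_ne_zero hV hk.ne'
  have hw' : 0 < ‖jw V k‖ := norm_pos_iff.2 hw
  have h := greenForm_sub_conj hV hk.ne' hf
  rw [Complex.sub_conj, Complex.mul_conj, Complex.normSq_eq_norm_sq] at h
  have h2 := congrArg Complex.im h
  have e : 2 * Complex.I * (k : ℂ) / ((‖jw V k‖ ^ 2 : ℝ) : ℂ)
      = ((2 * k / ‖jw V k‖ ^ 2 : ℝ) : ℂ) * Complex.I := by push_cast; ring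
  rw [e, mul_right_comm, ← Complex.ofReal_mul] at h2
  simp only [Complex.mul_I_im, Complex.ofReal_re] at h2
  have hp : ‖pairing (jostPsi V k) f‖ ^ 2
      = 4 * k ^ 2 / ‖jw V k‖ ^ 2 * ‖pairing (jostSol V k) f‖ ^ 2 := by
    rw [jostPsi_of_pos hV hk, pairing_const_mul_left]
    simp [abs_of_pos hk]
    ring
  have hm : ‖pairing (jostPsi V (-k)) f‖ ^ 2
      = 4 * k ^ 2 / ‖jw V k‖ ^ 2 * ‖pairing (jostSolM V k) f‖ ^ 2 := by
    rw [jostPsi_of_neg hV (neg_lt_zero.2 hk), pairing_const_mul_left, neg_neg]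
    simp [abs_of_pos hk]
    ring
  rw [hp, hm]
  linear_combination k * h2

theorem bddCont_jostPsi (hV : ShortRange V) {k : ℝ} (hk : k ≠ 0) : BddCont (jostPsi V k) := by
  rcases lt_or_gt_of_ne hk with h | h
  · rw [jostPsi_of_neg hV h]
    exact (bddCont_jostSolM hV (neg_pos.2 h).ne').1.const_mul _
  · rw [jostPsi_of_pos hV h]
    exact (bddCont_jostSol hV hk).1.const_mul _

/-- Provides the measurability in `k` and the integrability on compact intervals needed below; the
uniform bound on `ψ` supplies the domination. -/
theorem continuousOn_pairing_jostPsi (hV : ShortRange V) {f : ℝ → ℂ} (hf : Dec f) :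
    ContinuousOn (fun k => pairing (jostPsi V k) f) (Set.Ioi 0) ∧
    ContinuousOn (fun k => pairing (jostPsi V (-k)) f) (Set.Ioi 0) := by
  obtain ⟨B, hB0, hB⟩ := exists_jostPsi_bound hV
  have hreal : Set.MapsTo (fun k : ℝ => (k : ℂ)) (Set.Ioi 0) closedUpper :=
    fun k hk => ofReal_mem_closedUpper (ne_of_gt hk)
  have hw : ContinuousOn (fun k : ℝ => jw V k) (Set.Ioi 0) :=
    (continuousOn_jw hV).comp Complex.continuous_ofReal.continuousOn hreal
  have hm : ContinuousOn (fun k : ℝ => 2 * Complex.I * k / jw V k) (Set.Ioi 0) := by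
    refine ContinuousOn.div (by fun_prop) hw fun k hk => jw_ofReal_ne_zero hV (ne_of_gt hk)
  have key : ∀ σ : ℝ → ℝ, (∀ k, 0 < k → σ k ≠ 0) →
      (∀ x, ContinuousOn (fun k => jostPsi V (σ k) x) (Set.Ioi 0)) →
      ContinuousOn (fun k => pairing (jostPsi V (σ k)) f) (Set.Ioi 0) := by
    intro σ hσ hx k₀ hk₀
    refine continuousWithinAt_of_dominated (bound := fun x => B * ‖f x‖) ?_ ?_
      (hf.integrable.norm.const_mul B) ?_
    · filter_upwards [self_mem_nhdsWithin] with k hk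
      exact (integrable_pairing (bddCont_jostPsi hV (hσ k hk)) hf).aestronglyMeasurable
    · filter_upwards [self_mem_nhdsWithin] with k hk
      refine Eventually.of_forall fun x => ?_
      rw [norm_mul, RCLike.norm_conj]
      exact mul_le_mul_of_nonneg_right (hB _ (hσ k hk) x) (norm_nonneg _)
    · refine Eventually.of_forall fun x => ?_
      exact (Complex.continuous_conj.continuousAt.comp_continuousWithinAt (hx x k₀ hk₀)).mul
        continuousWithinAt_const
  refine ⟨key id (fun k hk => hk.ne') fun x => ?_, key Neg.neg (fun k hk => by simpa using hk.ne')
    fun x => ?_⟩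
  · have h1 : ContinuousOn (fun k : ℝ => jostSol V k x) (Set.Ioi 0) :=
      (continuousOn_jostSol_right hV x).comp Complex.continuous_ofReal.continuousOn hreal
    exact (hm.mul h1).congr fun k hk => congrFun (jostPsi_of_pos hV hk) x
  · have h1 : ContinuousOn (fun k : ℝ => jostSolM V k x) (Set.Ioi 0) :=
      (continuousOn_jostSol_right hV.comp_neg (-x)).comp Complex.continuous_ofReal.continuousOn hreal
    refine (hm.mul h1).congr fun k hk => ?_
    have := congrFun (jostPsi_of_neg hV (neg_lt_zero.2 (Set.mem_Ioi.1 hk))) x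
    simpa using this

/-- The formula on compact intervals of positive energies is exhausted to `(0, ∞)`. Integrability up
to `k = 0` and `k = ∞` comes from the finiteness of `ν`; finally the terms `ψ(·,-k)` are unfolded
into an integral over the whole line. -/
theorem integral_density (hV : ShortRange V) {f : ℝ → ℂ} (hf : Dec f) {ν : Measure ℝ}
    [IsFiniteMeasure ν]
    (hν : ∀ ζ : ℂ, 0 < ζ.im → (ζ ^ 2).im ≠ 0 → greenForm V ζ f = ∫ s : ℝ, 1 / ((s : ℂ) - ζ ^ 2) ∂ν) :
    Integrable (fun k => ‖pairing (jostPsi V k) f‖ ^ 2) ∧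
    ν.real (Set.Ioi 0) = (2 * Real.pi)⁻¹ * ∫ k, ‖pairing (jostPsi V k) f‖ ^ 2 := by
  obtain ⟨hc1, hc2⟩ := continuousOn_pairing_jostPsi hV hf
  set F : ℝ → ℝ := fun k => ‖pairing (jostPsi V k) f‖ ^ 2 with hF
  have hF1 : ContinuousOn F (Set.Ioi 0) := hc1.norm.pow 2
  have hF2 : ContinuousOn (fun k => F (-k)) (Set.Ioi 0) := hc2.norm.pow 2
  -- The shift by `2` ensures `a n < 1 < b n` for every `n`, including `n = 0`.
  let a : ℕ → ℝ := fun n => ((n : ℝ) + 2)⁻¹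
  let b : ℕ → ℝ := fun n => (n : ℝ) + 2
  have ha0 : ∀ n, 0 < a n := fun n => by positivity
  have hab : ∀ n, a n < b n := fun n => by
    have h2 : (1 : ℝ) < b n := by simp only [b]; have := n.cast_nonneg (α := ℝ); linarith
    exact (inv_lt_one_of_one_lt₀ h2).trans h2
  have hb : Tendsto b atTop atTop :=
    tendsto_atTop_add_const_right _ _ tendsto_natCast_atTop_atTop
  have ha : Tendsto a atTop (𝓝 0) := tendsto_inv_atTop_zero.comp hb
  have hbmono : Monotone b := fun m n h => by simp only [b]; gcongr
  have hamono : Antitone a := fun m n h => by simp only [a]; gcongr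
  have hval : ∀ n, ν.real (Set.Icc (a n ^ 2) (b n ^ 2))
      = (2 * Real.pi)⁻¹ * ∫ k in Set.Ioc (a n) (b n), (F k + F (-k)) := by
    intro n
    rw [measureReal_Icc_pos hV hf hν (ha0 n) (hab n), intervalIntegral.integral_of_le (hab n).le]
    have h1 : ∫ k in Set.Ioc (a n) (b n), (greenForm V k f).im * (2 * k)
        = ∫ k in Set.Ioc (a n) (b n), (F k + F (-k)) / 2 :=
      setIntegral_congr_fun measurableSet_Ioc fun k hk =>
        greenForm_im hV ((ha0 n).trans hk.1) hf
    rw [h1, integral_div, mul_inv]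
    ring
  have hcover : AECover (volume.restrict (Set.Ioi (0 : ℝ))) atTop fun n => Set.Ioc (a n) (b n) :=
    (aecover_Ioi_of_Ioi ha).inter (aecover_Iic (b := b) hb)
  have hsub : ∀ n, Set.Ioc (a n) (b n) ⊆ Set.Ioi 0 := fun n k hk => (ha0 n).trans hk.1
  have hG : ContinuousOn (fun k => F k + F (-k)) (Set.Ioi 0) := hF1.add hF2
  have hnn : ∀ k, 0 ≤ F k := fun k => sq_nonneg _
  have hGi : IntegrableOn (fun k => F k + F (-k)) (Set.Ioi 0) := by
    refine hcover.integrable_of_integral_bounded_of_nonneg_ae (2 * Real.pi * ν.real Set.univ)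
      (fun n => ?_) (Eventually.of_forall fun k => add_nonneg (hnn _) (hnn _))
      (Eventually.of_forall fun n => ?_)
    · refine IntegrableOn.restrict ?_
      refine ((hG.mono fun k hk => ?_).integrableOn_Icc (a := a n) (b := b n)).mono_set
        Set.Ioc_subset_Icc_self
      exact (ha0 n).trans_le hk.1
    · rw [Measure.restrict_restrict measurableSet_Ioc, Set.inter_eq_left.2 (hsub n)]
      have h1 := hval n
      have h2 : ν.real (Set.Icc (a n ^ 2) (b n ^ 2)) ≤ ν.real Set.univ :=
        measureReal_mono (Set.subset_univ _)
      rw [h1, inv_mul_le_iff₀ Real.two_pi_pos] at h2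
      exact h2
  have hlim1 : Tendsto (fun n => ν.real (Set.Icc (a n ^ 2) (b n ^ 2))) atTop
      (𝓝 ((2 * Real.pi)⁻¹ * ∫ k in Set.Ioi 0, (F k + F (-k)))) := by
    simp_rw [hval]
    refine Tendsto.const_mul _ ?_
    have := hcover.integral_tendsto_of_countably_generated hGi
    refine this.congr fun n => ?_
    rw [Measure.restrict_restrict measurableSet_Ioc, Set.inter_eq_left.2 (hsub n)]
  have hU : ⋃ n, Set.Icc (a n ^ 2) (b n ^ 2) = Set.Ioi 0 := by
    ext s
    simp only [Set.mem_iUnion, Set.mem_Icc, Set.mem_Ioi]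
    constructor
    · rintro ⟨n, h, -⟩
      exact (pow_pos (ha0 n) 2).trans_le h
    · intro hs
      have h0 : (0 : ℝ) ^ 2 < s := by simpa using hs
      have h1 := (ha.pow 2).eventually (gt_mem_nhds h0)
      have h2 := hb.eventually_ge_atTop (max 1 s)
      obtain ⟨n, h1, h2⟩ := (h1.and h2).exists
      refine ⟨n, h1.le, ?_⟩
      have h3 := le_of_max_le_left h2
      have h4 := le_of_max_le_right h2
      nlinarith
  have hlim2 : Tendsto (fun n => ν.real (Set.Icc (a n ^ 2) (b n ^ 2))) atTop
      (𝓝 (ν.real (Set.Ioi 0))) := by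
    rw [← hU]
    refine (ENNReal.tendsto_toReal (measure_ne_top _ _)).comp
      (tendsto_measure_iUnion_atTop fun m n h => Set.Icc_subset_Icc ?_ ?_)
    · exact pow_le_pow_left₀ (ha0 n).le (hamono h) 2
    · exact pow_le_pow_left₀ ((ha0 m).trans (hab m)).le (hbmono h) 2
  have hE := tendsto_nhds_unique hlim2 hlim1
  have hi1 : IntegrableOn F (Set.Ioi 0) := by
    refine hGi.mono' (hF1.aestronglyMeasurable measurableSet_Ioi) (Eventually.of_forall fun k => ?_)
    rw [Real.norm_of_nonneg (hnn k)]; linarith [hnn (-k)]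
  have hi2 : IntegrableOn (fun k => F (-k)) (Set.Ioi 0) := by
    refine hGi.mono' (hF2.aestronglyMeasurable measurableSet_Ioi) (Eventually.of_forall fun k => ?_)
    rw [Real.norm_of_nonneg (hnn (-k))]; linarith [hnn k]
  have hi3 : IntegrableOn F (Set.Iio 0) := by
    have h0 : IntegrableOn (fun k => F (-k)) (Set.Ioi (-0)) := by rwa [neg_zero]
    have := h0.comp_neg_Iio
    simp only [neg_neg] at this
    exact this
  have hi4 : IntegrableOn F (Set.Iic 0) := by
    rwa [integrableOn_Iic_iff_integrableOn_Iio]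
  have hint : Integrable F := by
    rw [← integrableOn_univ, ← Set.Iic_union_Ioi (a := (0 : ℝ))]
    exact hi4.union hi1
  refine ⟨hint, ?_⟩
  rw [hE, integral_add hi1 hi2]
  congr 1
  rw [← intervalIntegral.integral_Iic_add_Ioi hi4 hi1, integral_comp_neg_Ioi]
  simp [add_comm]

end SpectralDensity

/-! ### A countable basis of eigenvectors -/

section Eigenbasis

variable {H : Type*} [NormedAddCommGroup H] [InnerProductSpace ℂ H]

/-- Orthonormal vectors are at distance `√2`, so balls of radius `1/2` around them are disjoint. -/
theorem Orthonormal.countable_of_separable [TopologicalSpace.SeparableSpace H] {ι : Type*}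
    {v : ι → H} (hv : Orthonormal ℂ v) : Countable ι := by
  refine Pairwise.countable_of_isOpen_disjoint (s := fun i => Metric.ball (v i) (1 / 2)) ?_
    (fun i => Metric.isOpen_ball) fun i => Metric.nonempty_ball.2 (by norm_num)
  intro i j hij
  refine Metric.ball_disjoint_ball ?_
  have h : ‖v i - v j‖ ^ 2 = 2 := by
    rw [@norm_sub_sq ℂ, hv.2 hij, hv.1 i, hv.1 j]
    norm_num
  rw [dist_eq_norm]
  nlinarith [norm_nonneg (v i - v j)]

theorem exists_equiv_nat_subset (J : Type*) [Countable J] :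
    ∃ I : Set ℕ, (I = Set.univ ∨ I.Finite) ∧ Nonempty (I ≃ J) := by
  cases finite_or_infinite J
  · obtain ⟨n, ⟨e⟩⟩ := Finite.exists_equiv_fin J
    exact ⟨{i | i < n}, Or.inr (Set.finite_lt_nat n), ⟨Fin.equivSubtype.symm.trans e.symm⟩⟩
  · obtain ⟨d⟩ := nonempty_denumerable J
    exact ⟨Set.univ, Or.inl rfl, ⟨(Equiv.Set.univ ℕ).trans (Denumerable.eqv J).symm⟩⟩

theorem HilbertBasis.tsum_ofReal_norm_inner_sq {ι : Type*} (b : HilbertBasis ι ℂ H) (x : H) :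
    ∑' i, ENNReal.ofReal (‖inner ℂ (b i) x‖ ^ 2) = ENNReal.ofReal (‖x‖ ^ 2) := by
  have h := b.hasSum_inner_mul_inner x x
  have h2 : HasSum (fun i => ‖inner ℂ (b i) x‖ ^ 2) (‖x‖ ^ 2) := by
    rw [inner_self_eq_norm_sq_to_K] at h
    rw [← Complex.hasSum_ofReal, Complex.ofReal_pow]
    refine (congrArg (fun g => HasSum g _) (funext fun i => ?_)).mp h
    rw [← inner_conj_symm x (b i), mul_comm, Complex.mul_conj, Complex.normSq_eq_norm_sq]
  rw [← ENNReal.ofReal_tsum_of_nonneg (fun i => sq_nonneg _) h2.summable, h2.tsum_eq]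

/-- An orthonormal basis of the span of the eigenvectors of `A⁻¹ - c` with nonpositive eigenvalue,
indexed by a set of natural numbers, computes the mass of the nonpositive half axis for every
measure that is carried there by the eigenvalues. -/
theorem exists_eigenbasis [CompleteSpace H] [TopologicalSpace.SeparableSpace H] (A : H →L[ℂ] H)
    (hA : IsSelfAdjoint A) (c : ℝ) :
    ∃ I : Set ℕ, (I = Set.univ ∨ I.Finite) ∧ ∃ (E : I → ℝ) (v : I → H),
      (∀ l, E l ≤ 0 ∧ A (v l) = (((E l + c)⁻¹ : ℝ) : ℂ) • v l) ∧
      ∀ (f : H) (ν : Measure ℝ) [IsFiniteMeasure ν],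
        (∀ (E : ℝ) (K : Submodule ℂ H) [K.HasOrthogonalProjection],
          (∀ u, u ∈ K ↔ A u = (((E + c)⁻¹ : ℝ) : ℂ) • u) →
            ν.real {E} = ‖K.starProjection f‖ ^ 2) →
        (∀ E < 0, (∀ u, A u = (((E + c)⁻¹ : ℝ) : ℂ) • u → u = 0) → ∃ U ∈ 𝓝 E, ν U = 0) →
        HasSum (fun l => ‖inner ℂ (v l) f‖ ^ 2) (ν.real (Set.Iic 0)) := by
  let K : ℝ → Submodule ℂ H := fun E => Module.End.eigenspace (A : H →ₗ[ℂ] H) (((E + c)⁻¹ : ℝ) : ℂ)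
  have hK : ∀ E u, u ∈ K E ↔ A u = (((E + c)⁻¹ : ℝ) : ℂ) • u := fun E u =>
    Module.End.mem_eigenspace_iff
  have hclosed : ∀ E, IsClosed (K E : Set H) := by
    intro E
    have : (K E : Set H) = {u | A u = (((E + c)⁻¹ : ℝ) : ℂ) • u} := Set.ext fun u => hK E u
    rw [this]
    exact isClosed_eq A.continuous (continuous_const_smul _)
  have hcomplete : ∀ E, CompleteSpace (K E) := fun E => (hclosed E).completeSpace_coe
  -- Inversion with `0⁻¹ = 0` is injective on all of `ℝ`, so distinct energies give distinct
  -- eigenvalues of `A` without excluding `E = -c`.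
  have hinj : Function.Injective fun E : ℝ => (((E + c)⁻¹ : ℝ) : ℂ) := fun E E' h => by
    have := inv_injective (Complex.ofReal_injective h)
    linarith
  have hfam : OrthogonalFamily ℂ (fun E => K E) fun E => (K E).subtypeₗᵢ :=
    hA.isSymmetric.orthogonalFamily_eigenspaces.comp hinj
  let Z : Set ℝ := {E | E ≤ 0 ∧ K E ≠ ⊥}
  have hfamZ : OrthogonalFamily ℂ (fun E : Z => K E) fun E : Z => (K E).subtypeₗᵢ :=
    hfam.comp Subtype.coe_injective
  choose w b _ using fun E : Z => exists_hilbertBasis ℂ (K E)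
  have hon : Orthonormal ℂ fun a : Σ E : Z, w E => ((b a.1 a.2 : K a.1) : H) :=
    hfamZ.orthonormal_sigma_orthonormal fun E => (b E).orthonormal
  have hJ : Countable (Σ E : Z, w E) := hon.countable_of_separable
  have hne : ∀ E : Z, Nonempty (w E) := by
    intro E
    by_contra h
    rw [not_nonempty_iff] at h
    refine E.2.2 ((Submodule.eq_bot_iff _).2 fun u hu => ?_)
    have h2 := (b E).tsum_ofReal_norm_inner_sq ⟨u, hu⟩
    rw [tsum_empty, eq_comm, ENNReal.ofReal_eq_zero] at h2
    have h3 : ‖u‖ ^ 2 ≤ 0 := h2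
    exact norm_eq_zero.1 (pow_eq_zero_iff two_ne_zero |>.1 (le_antisymm h3 (sq_nonneg _)))
  have hZ : Z.Countable := by
    have : Function.Surjective (Sigma.fst : (Σ E : Z, w E) → Z) :=
      fun E => ⟨⟨E, (hne E).some⟩, rfl⟩
    exact this.countable
  obtain ⟨I, hI, ⟨e⟩⟩ := exists_equiv_nat_subset (Σ E : Z, w E)
  refine ⟨I, hI, fun l => (e l).1, fun l => ((b (e l).1 (e l).2 : K (e l).1) : H),
    fun l => ⟨(e l).1.2.1, (hK _ _).1 (b (e l).1 (e l).2).2⟩, ?_⟩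
  intro f ν _ hatom hnull
  have hsum : ν (Set.Iic 0)
      = ∑' a : Σ E : Z, w E, ENNReal.ofReal (‖inner ℂ ((b a.1 a.2 : K a.1) : H) f‖ ^ 2) := by
    have hbot : ∀ E ∈ Set.Iic 0 \ Z, K E = ⊥ := fun E hE => by
      by_contra h
      exact hE.2 ⟨hE.1, h⟩
    -- Each negative energy that is not an eigenvalue has a null neighbourhood, and a locally null
    -- set is null. The point `0` is treated apart: there the atom formula with trivial eigenspace
    -- is used.
    have hneg : ν (Set.Iio 0 \ Z) = 0 := by
      refine measure_null_of_locally_null _ fun E hE => ?_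
      obtain ⟨U, hU, h0⟩ := hnull E hE.1 fun u hu => by
        have := (hK E u).2 hu
        rwa [hbot E ⟨le_of_lt (Set.mem_Iio.1 hE.1), hE.2⟩] at this
      exact ⟨U, mem_nhdsWithin_of_mem_nhds hU, h0⟩
    have hzero : ν ({0} \ Z) = 0 := by
      by_cases h : (0 : ℝ) ∈ Z
      · rw [Set.sdiff_eq_empty.2 (Set.singleton_subset_iff.2 h), measure_empty]
      · refine measure_mono_null Set.sdiff_subset ?_
        have h3 := hatom 0 ⊥ fun u => by rw [← hbot 0 ⟨Set.self_mem_Iic, h⟩]; exact hK 0 u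
        rw [Submodule.starProjection_bot] at h3
        refine (measureReal_eq_zero_iff).1 (h3.trans ?_)
        simp
    have h1 : ν (Set.Iic 0 \ Z) = 0 := by
      rw [← Set.Iio_insert, ← Set.singleton_union, Set.union_sdiff_distrib]
      exact measure_union_null hzero hneg
    have h2 : ν (Set.Iic 0) = ν Z := by
      refine le_antisymm ?_ (measure_mono fun E hE => hE.1)
      calc ν (Set.Iic 0) ≤ ν ((Set.Iic 0 \ Z) ∪ Z) := measure_mono (by simp)
        _ ≤ ν (Set.Iic 0 \ Z) + ν Z := measure_union_le _ _
        _ = ν Z := by rw [h1, zero_add]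
    -- `Z` is countable, so its mass is the sum of its atoms; each atom is then expanded in a
    -- Hilbert basis of its eigenspace. Working in `ENNReal` avoids summability questions.
    have h3 : ν Z = ∑' E : Z, ν {(E : ℝ)} := by
      rw [← measure_biUnion hZ (fun i _ j _ h => by simpa using h)
        fun E _ => measurableSet_singleton E, Set.biUnion_of_singleton]
    rw [h2, ENNReal.tsum_sigma', h3]
    refine tsum_congr fun E => ?_
    have h3 := hatom E (K E) (hK E)
    rw [← ofReal_measureReal (measure_ne_top _ _), h3, Submodule.starProjection_apply]
    refine ((b E).tsum_ofReal_norm_inner_sq ((K E).orthogonalProjectionOnto f)).symm.trans ?_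
    simp only [Submodule.inner_orthogonalProjectionOnto_eq_of_mem_left]
  have h4 := e.tsum_eq fun a : Σ E : Z, w E =>
    ENNReal.ofReal (‖inner ℂ ((b a.1 a.2 : K a.1) : H) f‖ ^ 2)
  rw [← hsum] at h4
  have h5 := ENNReal.hasSum_toReal (h4.trans_ne (measure_ne_top _ _))
  rw [← ENNReal.tsum_toReal_eq fun l => ENNReal.ofReal_ne_top, h4] at h5
  exact (congrArg (fun g => HasSum g _) (funext fun l =>
    ENNReal.toReal_ofReal (sq_nonneg _))).mp h5

end Eigenbasis

/-! ### Parseval's identity and the resolution of the identity -/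

section Expansion

variable {V : ℝ → ℝ}

theorem four_mul_conj_mul (a b : ℂ) :
    4 * (conj a * b) = (‖a + b‖ ^ 2 : ℝ) - (‖a + -1 * b‖ ^ 2 : ℝ)
      - Complex.I * ((‖a + Complex.I * b‖ ^ 2 : ℝ) - (‖a + -Complex.I * b‖ ^ 2 : ℝ)) := by
  simp only [← Complex.normSq_eq_norm_sq, ← Complex.mul_conj, map_add, map_mul, map_neg, map_one,
    Complex.conj_I]
  linear_combination (2 * conj a * b - 2 * a * conj b) * Complex.I_sq

theorem pairing_toLp_left {f : ℝ → ℂ} (hf : Dec f) (v : Lp ℂ 2 (volume : Measure ℝ)) :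
    pairing f v = inner ℂ (hf.memLp.toLp f) v := (inner_toLp_left hf.memLp v).symm

theorem conj_pairing (u f : ℝ → ℂ) : conj (pairing u f) = pairing f u := by
  rw [pairing, pairing, ← integral_conj]
  congr 1; ext x
  simp [mul_comm]

theorem pairing_toLp_right {f : ℝ → ℂ} (hf : Dec f) (v : Lp ℂ 2 (volume : Measure ℝ)) :
    pairing v f = inner ℂ v (hf.memLp.toLp f) := by
  rw [← conj_pairing, pairing_toLp_left hf, inner_conj_symm]

theorem pairing_add_mul {u f g : ℝ → ℂ} (hu : BddCont u) (hf : Dec f) (hg : Dec g) (z : ℂ) :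
    pairing u (fun x => f x + z * g x) = pairing u f + z * pairing u g := by
  simp only [pairing, ← integral_const_mul]
  rw [← integral_add (integrable_pairing hu hf) ((integrable_pairing hu hg).const_mul z)]
  congr 1; ext x; ring

theorem toLp_add_mul {f g : ℝ → ℂ} (hf : Dec f) (hg : Dec g) (z : ℂ)
    (h : Dec fun x => f x + z * g x) :
    h.memLp.toLp (fun x => f x + z * g x) = hf.memLp.toLp f + z • hg.memLp.toLp g := rfl

/-- A zero of `w` at `i√(-E)` makes `θ₊` a decaying eigenfunction of `h`, which the resolvent
relation turns into an eigenvector of `A`. -/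
theorem jw_ne_zero_of_no_eigenvector (hV : ShortRange V) {c : ℝ}
    {A : Lp ℂ 2 (volume : Measure ℝ) →L[ℂ] Lp ℂ 2 (volume : Measure ℝ)}
    (hA : ∀ z f u u' (h : ResPair V z f u u'), h.dec₀.memLp.toLp u
        - (z + c) • A (h.dec₀.memLp.toLp u) = A (h.dec_f.memLp.toLp f)) {E : ℝ} (hE : E < 0)
    (h : ∀ u, A u = (((E + c)⁻¹ : ℝ) : ℂ) • u → u = 0) :
    jw V (Complex.I * Real.sqrt (-E)) ≠ 0 := by
  intro hw
  have hi : 0 < (Complex.I * (Real.sqrt (-E) : ℂ)).im := by simpa using hE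
  have e : (Complex.I * (Real.sqrt (-E) : ℂ)) ^ 2 = E := by
    rw [mul_pow, Complex.I_sq, ← Complex.ofReal_pow, Real.sq_sqrt (by linarith)]; simp
  have hr := resPair_of_jw_eq_zero hV hi hw
  rw [e] at hr
  have h1 := hA _ _ _ _ hr
  have h0 : hr.dec_f.memLp.toLp (fun _ => (0 : ℂ)) = 0 := MemLp.toLp_zero _
  rw [h0, map_zero, sub_eq_zero] at h1
  obtain ⟨x, hx⟩ := exists_jostSol_ne_zero hV (mem_closedUpper_of_im_pos hi)
  refine hx (congrFun (hr.dec₀.toLp_eq_zero ?_) x)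
  -- For `E = -c` the resolvent relation itself forces the vector to be `0`.
  by_cases hc : E + c = 0
  · rw [h1, ← Complex.ofReal_add, hc]; simp
  · refine h _ ?_
    rw [← Complex.ofReal_add] at h1
    conv_rhs => rw [h1]
    rw [smul_smul, ← Complex.ofReal_mul, inv_mul_cancel₀ hc]; simp

/-- Mass balance for the energy measure of `f`: the total `‖f‖²` splits into the eigenvalue part on
`(-∞, 0]` and the continuous part on `(0, ∞)`. -/
theorem exists_parseval (hV : ShortRange V) (m : ℝ) :
    ∃ I : Set ℕ, (I = Set.univ ∨ I.Finite) ∧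
      ∃ (ε : I → ℝ) (v : I → Lp ℂ 2 (volume : Measure ℝ)),
      (∀ l, ε l ≤ m ^ 2) ∧ (∀ l, IsDistribEigen V m (ε l) (v l)) ∧
      ∀ f, ∀ hf : Dec f, Integrable (fun k => ‖pairing (jostPsi V k) f‖ ^ 2) ∧
        HasSum (fun l => ‖inner ℂ (v l) (hf.memLp.toLp f)‖ ^ 2)
          (‖hf.memLp.toLp f‖ ^ 2
            - (2 * Real.pi)⁻¹ * ∫ k, ‖pairing (jostPsi V k) f‖ ^ 2) := by
  obtain ⟨c, A, hsa, hker, hres, hdist⟩ := exists_hamiltonian_inverse hV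
  have : Fact ((2 : ENNReal) ≠ ⊤) := ⟨ENNReal.ofNat_ne_top⟩
  obtain ⟨I, hI, E, v, hv, hsum⟩ := exists_eigenbasis A hsa c
  refine ⟨I, hI, fun l => E l + m ^ 2, v, fun l => by linarith [(hv l).1],
    fun l => hdist _ m _ (hv l).2, fun f hf => ?_⟩
  obtain ⟨ν, hfin, huniv, hst, hatom⟩ := exists_energyMeasure A hsa hker c (hf.memLp.toLp f)
  have hν : ∀ ζ : ℂ, 0 < ζ.im → (ζ ^ 2).im ≠ 0 →
      greenForm V ζ f = ∫ s : ℝ, 1 / ((s : ℂ) - ζ ^ 2) ∂ν := by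
    intro ζ h1 h2
    have hr := resPair_resol hV h1 (jw_ne_zero_of_im_sq_ne_zero hV h1 h2) hf
    rw [← hst _ h2 _ (hres _ _ _ _ hr), inner_toLp, greenForm_eq hV (mem_closedUpper_of_im_pos h1) hf]
  obtain ⟨hint, hpos⟩ := integral_density hV hf hν
  refine ⟨hint, ?_⟩
  have h := hsum (hf.memLp.toLp f) ν hatom fun E hE hno =>
    exists_measure_nhds_eq_zero hV hf hν hE (jw_ne_zero_of_no_eigenvector hV hres hE hno)
  convert h using 1
  rw [← hpos, ← huniv, ← measureReal_add_measureReal_compl measurableSet_Iic (s := Set.Iic 0),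
    Set.compl_Iic]
  ring

/-- Parseval's identity is applied to `f + z g` with `z = ±1, ±i` and polarized in each of its three
terms. -/
theorem isGenEigenfunctionFamily_jostPsi (hV : ShortRange V) (m : ℝ) :
    IsGenEigenfunctionFamily V m (jostPsi V) := by
  obtain ⟨I, hI, ε, v, hε, hv, hpars⟩ := exists_parseval hV m
  refine ⟨I, ε, fun l => v l, hI, fun l => Lp.memLp _, hv, hε,
    fun k hk => (jostPsi_isGenEigen hV m hk).1, fun k hk => (jostPsi_isGenEigen hV m hk).2,
    fun f g => ?_⟩
  have hf := dec_schwartz f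
  have hg := dec_schwartz g
  have hz : ∀ z : ℂ, Dec fun x => f x + z * g x := fun z => hf.add (hg.const_mul z)
  set F := hf.memLp.toLp f
  set G := hg.memLp.toLp g
  let T : ℂ → ℝ → ℝ := fun z k => ‖pairing (jostPsi V k) f + z * pairing (jostPsi V k) g‖ ^ 2
  have hT : ∀ z, (fun k => ‖pairing (jostPsi V k) fun x => f x + z * g x‖ ^ 2) =ᵐ[volume] T z := by
    intro z
    filter_upwards [Measure.ae_ne volume 0] with k hk
    simp only [T]
    rw [pairing_add_mul (bddCont_jostPsi hV hk) hf hg]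
  have hTi : ∀ z, Integrable fun k => (T z k : ℂ) := fun z =>
    ((hpars _ (hz z)).1.congr (hT z)).ofReal
  have hS : ∀ z, HasSum (fun l => ((‖inner ℂ (v l) F + z * inner ℂ (v l) G‖ ^ 2 : ℝ) : ℂ))
      ((‖F + z • G‖ ^ 2 : ℝ) - (2 * Real.pi : ℂ)⁻¹ * ∫ k, (T z k : ℂ)) := by
    intro z
    have h := (hpars _ (hz z)).2
    rw [toLp_add_mul hf hg z (hz z), integral_congr_ae (hT z)] at h
    have h2 := Complex.hasSum_ofReal.2 h
    simp only [inner_add_right, inner_smul_right] at h2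
    convert h2 using 1
    rw [integral_complex_ofReal]
    push_cast; rfl
  have hk : ∀ k, pairing f (jostPsi V k) * pairing (jostPsi V k) g
      = 4⁻¹ * ((T 1 k : ℂ) - T (-1) k - Complex.I * (T Complex.I k - T (-Complex.I) k)) := by
    intro k
    have h := four_mul_conj_mul (pairing (jostPsi V k) f) (pairing (jostPsi V k) g)
    rw [conj_pairing] at h
    simp only [T, one_mul]
    linear_combination 4⁻¹ * h
  have hl : ∀ l, pairing f (v l) * pairing (v l) g
      = 4⁻¹ * (((‖inner ℂ (v l) F + 1 * inner ℂ (v l) G‖ ^ 2 : ℝ) : ℂ)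
        - (‖inner ℂ (v l) F + -1 * inner ℂ (v l) G‖ ^ 2 : ℝ)
        - Complex.I * ((‖inner ℂ (v l) F + Complex.I * inner ℂ (v l) G‖ ^ 2 : ℝ)
          - (‖inner ℂ (v l) F + -Complex.I * inner ℂ (v l) G‖ ^ 2 : ℝ))) := by
    intro l
    have h := four_mul_conj_mul (inner ℂ (v l) F) (inner ℂ (v l) G)
    rw [inner_conj_symm] at h
    rw [pairing_toLp_left hf, pairing_toLp_right hg, one_mul]
    linear_combination 4⁻¹ * h
  have hFG : pairing f g = 4⁻¹ * (((‖F + (1 : ℂ) • G‖ ^ 2 : ℝ) : ℂ)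
        - (‖F + (-1 : ℂ) • G‖ ^ 2 : ℝ)
        - Complex.I * ((‖F + Complex.I • G‖ ^ 2 : ℝ) - (‖F + -Complex.I • G‖ ^ 2 : ℝ))) := by
    have h : pairing f g = inner ℂ F G := (inner_toLp hf.memLp hg.memLp).symm
    rw [h, inner_eq_sum_norm_sq_div_four, one_smul, neg_one_smul, neg_smul, ← sub_eq_add_neg,
      ← sub_eq_add_neg]
    simp only [RCLike.I_to_complex, Complex.coe_algebraMap]
    push_cast
    ring
  have hint := (((hTi 1).sub (hTi (-1))).sub
    (((hTi Complex.I).sub (hTi (-Complex.I))).const_mul Complex.I)).const_mul (4⁻¹ : ℂ)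
  simp only [hk, hl]
  refine ⟨hint, ?_⟩
  have hs := (((hS 1).sub (hS (-1))).sub
    (((hS Complex.I).sub (hS (-Complex.I))).mul_left Complex.I)).mul_left (4⁻¹ : ℂ)
  refine Eq.subst (motive := fun a => HasSum _ a) ?_ hs
  have h1 : ∫ k, ((T 1 k : ℂ) - T (-1) k - Complex.I * (T Complex.I k - T (-Complex.I) k))
      = (∫ k, (T 1 k : ℂ)) - (∫ k, (T (-1) k : ℂ))
        - Complex.I * ((∫ k, (T Complex.I k : ℂ)) - ∫ k, (T (-Complex.I) k : ℂ)) := by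
    rw [← integral_sub (hTi _) (hTi _), ← integral_sub (hTi _) (hTi _), ← integral_const_mul]
    exact integral_sub ((hTi _).sub (hTi _)) (((hTi _).sub (hTi _)).const_mul _)
  rw [hFG, integral_const_mul, h1]
  ring

end Expansion

end

/-! ### The theorem -/

theorem mainTheorem9 (V : ℝ → ℝ) (μ : ℝ) (hμ : 2 < μ) (hV : IsSymbol (-μ) V) (m : ℝ) :
    -- the Jost solutions are well defined and the normalization does not divide by zero
    (∀ k : ℝ, k ≠ 0 →
      (∃! θ, IsJostPlus V k θ) ∧ (∃! θ, IsJostMinus V k θ) ∧ jostW V k ≠ 0) ∧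
    (¬ HasZeroEnergyResonance V → SatisfiesBM2 V m (fun _ => 1) (jostPsi V)) ∧
    (HasZeroEnergyResonance V →
      (∃ C : ℝ, 0 < C ∧ ∃ ε : ℝ, 0 < ε ∧
        ∀ᶠ k : ℝ in 𝓝[≠] 0, C * |k| ^ ((3 / 2 : ℝ) - ε) ≤ ‖jostW V k‖) →
      SatisfiesBM2' V m (fun _ => 1) (jostPsi V)) := by
  have hs := shortRange_of_isSymbol hμ hV
  have hfam := isGenEigenfunctionFamily_jostPsi hs m
  obtain ⟨B, hB0, hB⟩ := exists_jostPsi_bound hs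
  have hbound : ∀ k : ℝ, k ≠ 0 →
      eLpNorm (fun x => (((1 : ℝ) : ℂ))⁻¹ * jostPsi V k x) ⊤ volume ≤ ENNReal.ofReal B := by
    intro k hk
    simp only [Complex.ofReal_one, inv_one, one_mul]
    rw [eLpNorm_exponent_top]
    exact eLpNormEssSup_le_of_ae_bound (Eventually.of_forall (hB k hk))
  -- The same uniform bound `B` serves (BM2) and (BM2'), the latter with exponent `α = 0`.
  refine ⟨fun k hk => ?_, fun _ => ⟨hfam, B, hbound⟩, fun _ _ => ⟨hfam, 0, le_rfl, by norm_num, B,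
    fun k hk => ?_⟩⟩
  · have hζ := ofReal_mem_closedUpper hk
    refine ⟨⟨_, isJostPlus_jostSol hs hζ, fun θ h => eq_jostSol_of_isJostPlus hs hk h⟩,
      ⟨_, isJostMinus_jostSolM hs hζ, fun θ h => eq_jostSolM_of_isJostMinus hs hk h⟩, ?_⟩
    rw [jostW_eq hs hk]
    exact jw_ofReal_ne_zero hs hk
  · simpa using hbound k hk
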